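/- Let $d\ge 2$ and let $E$ be the set of nearest-neighbour edges of $\mathbb Z^d$. Let $\nu$ be a probability measure on $\mathbb R_+=[0,\infty)$, let $\mu=\nu^{\otimes E}$ be the product measure on $\mathbb R_+^E$, and for $x\in\mathbb R_+^E$ and $u,v\in\mathbb Z^d$ let $$d_x(u,v)=\inf_{\alpha}\sum_{e\in\alpha}x_e ,$$ the infimum being over all finite nearest-neighbour paths $\alpha$ from $u$ to $v$. Write $|v|=\sum_{i=1}^d|v_i|$. Let $g$ and $G$ be the density and the distribution function of the standard Gaussian law on $\mathbb R$, with the convention that $g\circ G^{-1}$ is extended to $[0,1]$ by its limits $g\circ G^{-1}(0)=g\circ G^{-1}(1)=0$. Call $\nu$ *nearly gamma* if it is absolutely continuous with respect to the Lebesgue measure and has a density $h\ge 0$ such that, with $H(t)=\int_0^t h(u)\,du$ and $I=\{t\ge 0: h(t)>0\}$: (i) $I$ is an interval; (ii) the restriction of $h$ to $I$ is continuous; (iii) there is $A>0$ such that $\dfrac{g(G^{-1}(H(y)))}{h(y)}\le A\sqrt y$ for all $y\in I$. **Theorem.** Suppose that $\nu$ is nearly gamma and that $\int e^{\delta x}\,d\nu(x)<\infty$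 for some $\delta>0$. Then there are constants $C_1,C_2>0$ (depending only on $d$ and $\nu$) such that, for every $v\in\mathbb Z^d$ with $|v|\ge 2$, the function $x\mapsto d_x(0,v)$ is $\mu$-integrable and, for every real $t$ with $0<t\le |v|$, $$\mu\left(\left|d_x(0,v)-\int d_y(0,v)\,d\mu(y)\right|>t\sqrt{\frac{|v|}{\log|v|}}\right)\le C_1e^{-C_2t}.$$ -/

import Mathlib

open MeasureTheory ProbabilityTheory
open scoped NNReal ENNReal

noncomputable section

namespace FPP

/-- The `L¹`-norm `|v|` of a vertex of `ℤ^d`. -/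
def l1norm {d : ℕ} (v : Fin d → ℤ) : ℕ := ∑ i, (v i).natAbs

/-- The nearest-neighbour graph on `ℤ^d`: `u` and `v` are joined when `|u - v| = 1`. -/
def lattice (d : ℕ) : SimpleGraph (Fin d → ℤ) where
  Adj u v := l1norm (u - v) = 1
  symm := ⟨by
    intro u v h
    rw [← h]
    simp only [l1norm, Pi.sub_apply]
    exact Finset.sum_congr rfl fun i _ => by omega⟩
  loopless := ⟨by intro u h; simp [l1norm] at h⟩

/-- The set `E` of (undirected) edges of `ℤ^d`. -/
abbrev Edge (d : ℕ) : Type := (lattice d).edgeSet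

/-- Configurations of nonnegative edge times, `ℝ₊^E`. -/
abbrev Config (d : ℕ) : Type := Edge d → ℝ≥0

/-- The total time `∑_{e ∈ α} x_e` along a finite nearest-neighbour path `α` from `u` to `v`. -/
def pathTime {d : ℕ} (x : Config d) {u v : Fin d → ℤ} (α : (lattice d).Walk u v) : ℝ :=
  (α.darts.map fun a => (x ⟨a.edge, a.edge_mem⟩ : ℝ)).sum

/-- The first passage time `d_x(u,v)`, the infimum of the total times of the paths
from `u` to `v`. -/
def passageTime {d : ℕ} (x : Config d) (u v : Fin d → ℤ) : ℝ :=
  ⨅ α : (lattice d).Walk u v, pathTime x α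

/-- The product measure `μ = ν^{⊗E}`. -/
def edgeLaw (d : ℕ) (ν : Measure ℝ≥0) [IsProbabilityMeasure ν] : Measure (Config d) :=
  Measure.infinitePi fun _ : Edge d => ν

/-- The standard Gaussian density `g`. -/
def gaussDensity (x : ℝ) : ℝ := gaussianPDFReal 0 1 x

/-- The standard Gaussian distribution function `G`. -/
def gaussCDF (x : ℝ) : ℝ := cdf (gaussianReal 0 1) x

open Classical in
/-- The function `g ∘ G⁻¹` on `[0,1]`. Since `G` is a bijection of `ℝ` onto `(0,1)`, the inverse is
the genuine one there; at the end points (`G⁻¹(0) = -∞`, `G⁻¹(1) = +∞`) the value is the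
limit `0`. -/
def gaussProfile (u : ℝ) : ℝ :=
  if 0 < u ∧ u < 1 then gaussDensity (Function.invFun gaussCDF u) else 0

/-- The distribution function `H(t) = ∫₀ᵗ h(u) du` of a density `h` on `ℝ₊`. -/
def distFun (h : ℝ → ℝ) (t : ℝ) : ℝ := ∫ u in (0 : ℝ)..t, h u

/-- The set `I = {t ≥ 0 : h(t) > 0}`. -/
def posSet (h : ℝ → ℝ) : Set ℝ := {t | 0 ≤ t ∧ 0 < h t}

/-- The function `ψ(y) = g(G⁻¹(H(y))) / h(y)`, of interest for `y ∈ I`. -/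
def psi (h : ℝ → ℝ) (y : ℝ) : ℝ := gaussProfile (distFun h y) / h y

/-- `h` is a density of `ν` with respect to the Lebesgue measure of `ℝ₊`. -/
structure IsDensity (ν : Measure ℝ≥0) (h : ℝ → ℝ) : Prop where
  measurable : Measurable h
  nonneg : ∀ t, 0 ≤ h t
  map_eq : ν.map (fun x : ℝ≥0 => (x : ℝ)) =
    (volume.restrict (Set.Ici (0 : ℝ))).withDensity fun t => ENNReal.ofReal (h t)

/-- `ν` is nearly gamma: it has a density `h` such that `I` is an interval, `h` restricted to `I` is
continuous, and `ψ(y) ≤ A √y` on `I` for some `A > 0`. -/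
def IsNearlyGamma (ν : Measure ℝ≥0) : Prop :=
  ∃ h : ℝ → ℝ, IsDensity ν h ∧
    (posSet h).OrdConnected ∧
    ContinuousOn h (posSet h) ∧
    ∃ A : ℝ, 0 < A ∧ ∀ y ∈ posSet h, psi h y ≤ A * Real.sqrt y

end FPP

end

set_option linter.unusedSectionVars false

/-! A Poincaré inequality only gives a variance of order `|v|` for the passage time. Two things are
gained here: a factor `log |v|`, because after smoothing every single edge has small influence, and
exponential tails, because the variance bound is applied to exponentials of the passage time.

The engine is `LogSobolev.variance_le`, in the spirit of Falik and Samorodnitsky. A function is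
split into orthogonal increments, one per coordinate; the logarithmic Sobolev inequality is applied
to each increment, and the entropy of the square of an increment is large when its `L¹` norm is far
below its `L²` norm. The outcome is `Var f * (1 - log σ) ≤ energy + σ⁻¹ * ∑ (L¹ influences)²`. It is
proved on discrete cubes and carried to Gaussian space by the central limit theorem. The nearly
gamma condition makes `ν` the law of `R²` for a Lipschitz function `R` of a Gaussian
(`IsNearlyGamma.exists_lipschitz`). The derivative of `R²` is of order `R = √x_e`, so the energy of
`exp (θ G / 2)` is controlled by the sum of `x_e` along minimizing paths, hence by `G` itself
(`variance_exp_le`).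

An edge near `0` or `v` may have large influence, so the passage time is replaced by `smoothTime`:
an average over translations by a box of side `m ≈ |v|^(1/4)` of a minimum over paths of length
`O(|v|)`, capped at `O(|v|)`. Among the `m^d` translates of an edge a minimizing path contains
`O(m)` on average, since a longer stay in the box could be replaced by a short detour
(`countP_support_le`, `exists_integral_sum_minWeight_le`). The influences are thus `O(m / m^d)`,
which is `O(1 / m)` because `d ≥ 2`, and `σ = 1 / m` yields the gain `log m`, comparable to `log
|v|`.

With `K = O(|v| / log |v|)` the Laplace transform `φ` of the centred smoothed time satisfies `φ(θ) -
φ(θ/2)² ≤ K θ² φ(θ)`. Iterating over dyadic scales gives `φ(θ) ≤ exp (4 K θ²)` for `θ` of order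
`K^(-1/2)` (`integral_exp_le_of_variance_le`), and Markov's inequality gives exponential tails at
scale `√(|v| / log |v|)`. Smoothing changes the passage time by `O(m)` up to exponential tails,
which is negligible at this scale. -/

namespace FPP

open scoped BigOperators
open Function

/-! ### Entropy and variance inequalities on finite product spaces. -/

section Cube

variable {Ω β κ ι : Type*} [Fintype Ω] [Fintype β] [Fintype κ] [Fintype ι] [DecidableEq ι]

/-- The entropy of a function on a finite set with the uniform probability. -/
noncomputable def ent (u : Ω → ℝ) : ℝ :=
  (𝔼 x, u x * Real.log (u x)) - (𝔼 x, u x) * Real.log (𝔼 x, u x)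

/-- The logarithmic Sobolev inequality for the family of moves `τ`. -/
def LogSobolev (τ : κ → β → β) : Prop :=
  ∀ f : β → ℝ, ent (fun x => f x ^ 2) ≤ ∑ k, 𝔼 x, (f (τ k x) - f x) ^ 2

/-- The move of coordinate `p.1` by `τ p.2`. -/
def coordMove (τ : κ → β → β) (p : ι × κ) (x : ι → β) : ι → β :=
  update x p.1 (τ p.2 (x p.1))

/-- The average of `f` over the coordinate `a`. -/
noncomputable def avg (a : ι) (f : (ι → β) → ℝ) (x : ι → β) : ℝ := 𝔼 y, f (update x a y)

lemma expect_sq_mul_le (u v : Ω → ℝ) :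
    (𝔼 x, u x * v x) ^ 2 ≤ (𝔼 x, u x ^ 2) * 𝔼 x, v x ^ 2 := by
  simp only [Fintype.expect_eq_sum_div_card]
  rw [div_pow, div_mul_div_comm, ← sq]
  gcongr
  exact Finset.sum_mul_sq_le_sq_mul_sq _ _ _

/-- Reverse triangle inequality in `L²`. It is what keeps the energies in the other directions from
growing when a coordinate is averaged out during tensorization. -/
lemma sqrt_expect_sub_sq_le (u v : Ω → ℝ) :
    (√(𝔼 x, u x ^ 2) - √(𝔼 x, v x ^ 2)) ^ 2 ≤ 𝔼 x, (u x - v x) ^ 2 := by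
  have hu : 0 ≤ 𝔼 x, u x ^ 2 := Finset.expect_nonneg fun _ _ => sq_nonneg _
  have hv : 0 ≤ 𝔼 x, v x ^ 2 := Finset.expect_nonneg fun _ _ => sq_nonneg _
  have h : 𝔼 x, (u x - v x) ^ 2 = (𝔼 x, u x ^ 2) + (𝔼 x, v x ^ 2) - 2 * 𝔼 x, u x * v x := by
    rw [Finset.mul_expect, ← Finset.expect_add_distrib, ← Finset.expect_sub_distrib]
    exact Finset.expect_congr rfl fun x _ => by ring
  have hcs : 𝔼 x, u x * v x ≤ √(𝔼 x, u x ^ 2) * √(𝔼 x, v x ^ 2) := by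
    rw [← Real.sqrt_mul hu]
    exact Real.le_sqrt_of_sq_le (expect_sq_mul_le u v)
  rw [h, sub_sq, Real.sq_sqrt hu, Real.sq_sqrt hv]
  linarith

/-- Exchanging a coordinate of `x` with an independent copy preserves the uniform law. -/
lemma expect_swap (a : ι) (Φ : (ι → β) → β → ℝ) :
    𝔼 x, 𝔼 y, Φ (update x a y) (x a) = 𝔼 x, 𝔼 y, Φ x y := by
  have h := fun Ψ : (ι → β) × β → ℝ => Finset.expect_product (Finset.univ : Finset (ι → β))
    (Finset.univ : Finset β) Ψ
  rw [← h fun p => Φ (update p.1 a p.2) (p.1 a), ← h fun p => Φ p.1 p.2]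
  refine Finset.expect_nbij' (fun p => (update p.1 a p.2, p.1 a))
    (fun p => (update p.1 a p.2, p.1 a)) ?_ ?_ ?_ ?_ ?_ <;> simp

variable [Nonempty β]

lemma expect_avg (a : ι) (f : (ι → β) → ℝ) : 𝔼 x, avg a f x = 𝔼 x, f x := by
  have h := expect_swap a fun (x : ι → β) (_ : β) => f x
  simpa [avg, Fintype.expect_const] using h

lemma avg_update_self (a : ι) (f : (ι → β) → ℝ) (x : ι → β) (y : β) :
    avg a f (update x a y) = avg a f x := by simp [avg]

lemma avg_update_of_ne {a j : ι} (h : j ≠ a) (f : (ι → β) → ℝ) (x : ι → β) (y : β) :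
    avg a f (update x j y) = avg a (fun x => f (update x j y)) x := by
  simp only [avg, update_comm h]

lemma avg_comm {a j : ι} (h : j ≠ a) (f : (ι → β) → ℝ) (x : ι → β) :
    avg j (avg a f) x = avg a (avg j f) x := by
  simp only [avg]
  rw [Finset.expect_comm]
  simp only [update_comm h]

lemma eq_of_forall_update_eq {g : (ι → β) → ℝ} (h : ∀ j x y, g (update x j y) = g x)
    (x y : ι → β) : g x = g y := by
  have key : ∀ s : Finset ι, g (s.piecewise y x) = g x := by
    intro s
    induction s using Finset.induction_on with
    | empty => simp
    | insert a s ha ih => rw [Finset.piecewise_insert, h, ih]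
  simpa using (key Finset.univ).symm

lemma ent_const (c : ℝ) [Nonempty Ω] : ent (fun _ : Ω => c) = 0 := by
  simp [ent]

/-- Chain rule for the entropy. -/
lemma ent_eq_expect_ent_add (a : ι) (u : (ι → β) → ℝ) :
    ent u = (𝔼 x, ent fun y => u (update x a y)) + ent (avg a u) := by
  have h1 : 𝔼 x, 𝔼 y, u (update x a y) * Real.log (u (update x a y))
      = 𝔼 x, u x * Real.log (u x) := expect_avg a fun x => u x * Real.log (u x)
  simp only [ent, Finset.expect_sub_distrib]
  rw [h1, expect_avg]
  simp only [avg]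
  ring

/-- From `log r ≤ r - 1`, the entropy of `u = f²` is at most `Var u / 𝔼 u`; here this is `(a² - b²)²
/ (2 (a² + b²))`, which is at most `(a - b)²`. The constant is not sharp, which only affects later
constants. -/
lemma logSobolev_bool : LogSobolev fun (_ : Unit) => Bool.not := by
  intro f
  set a := f true
  set b := f false
  have e : ∀ u : Bool → ℝ, 𝔼 x, u x = (u true + u false) / 2 := by
    intro u; rw [Fintype.expect_eq_sum_div_card]; simp
  simp only [ent, e, Finset.univ_unique, Finset.sum_const, Finset.card_singleton, one_smul,
    Bool.not_true, Bool.not_false]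
  change (a ^ 2 * Real.log (a ^ 2) + b ^ 2 * Real.log (b ^ 2)) / 2 -
    (a ^ 2 + b ^ 2) / 2 * Real.log ((a ^ 2 + b ^ 2) / 2) ≤ ((b - a) ^ 2 + (a - b) ^ 2) / 2
  set m := (a ^ 2 + b ^ 2) / 2 with hm
  rcases eq_or_ne m 0 with h0 | h0
  · have ha : a = 0 := by nlinarith [sq_nonneg a, sq_nonneg b]
    have hb : b = 0 := by nlinarith [sq_nonneg a, sq_nonneg b]
    simp [ha, hb, h0]
  have hpos : 0 < m := lt_of_le_of_ne (by positivity) h0.symm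
  have key : ∀ u : ℝ, 0 ≤ u → u * Real.log u ≤ u * Real.log m + u * (u / m - 1) := by
    intro u hu
    rcases hu.eq_or_lt with rfl | hu
    · simp
    rw [← mul_add]
    refine mul_le_mul_of_nonneg_left ?_ hu.le
    have := Real.log_le_sub_one_of_pos (div_pos hu hpos)
    rw [Real.log_div hu.ne' h0] at this
    linarith
  have ka := key (a ^ 2) (sq_nonneg _)
  have kb := key (b ^ 2) (sq_nonneg _)
  have hq : a ^ 2 * (a ^ 2 / m - 1) + b ^ 2 * (b ^ 2 / m - 1) ≤ 2 * (a - b) ^ 2 := by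
    have : a ^ 2 * (a ^ 2 / m - 1) + b ^ 2 * (b ^ 2 / m - 1)
        = (a ^ 4 + b ^ 4 - (a ^ 2 + b ^ 2) * m) / m := by field_simp; ring
    rw [this, div_le_iff₀ hpos, hm]
    nlinarith [sq_nonneg ((a - b) ^ 2), mul_nonneg (sq_nonneg (a - b)) (sq_nonneg (a - b))]
  have hsum : a ^ 2 * Real.log m + b ^ 2 * Real.log m = 2 * (m * Real.log m) := by
    rw [hm]; ring
  nlinarith

/-- The logarithmic Sobolev inequality tensorizes. -/
theorem LogSobolev.pi {τ : κ → β → β} (hτ : LogSobolev τ) :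
    LogSobolev (coordMove τ : ι × κ → (ι → β) → (ι → β)) := by
  intro f
  have key : ∀ S : Finset ι, ∃ g : (ι → β) → ℝ, (∀ j ∈ S, ∀ x y, g (update x j y) = g x) ∧
      (∀ p, 𝔼 x, (g (coordMove τ p x) - g x) ^ 2 ≤ 𝔼 x, (f (coordMove τ p x) - f x) ^ 2) ∧
      ent (fun x => f x ^ 2) ≤ (∑ j ∈ S, ∑ k, 𝔼 x, (f (coordMove τ (j, k) x) - f x) ^ 2) +
        ent fun x => g x ^ 2 := by
    intro S
    induction S using Finset.induction_on with
    | empty => exact ⟨f, by simp, fun _ => le_rfl, by simp⟩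
    | insert a S ha ih =>
      obtain ⟨g, hg, hD, hE⟩ := ih
      -- Taking the square root of the averaged square makes `g'²` exactly the marginal that appears
      -- in the chain rule for the entropy.
      set g' : (ι → β) → ℝ := fun x => √(avg a (fun x => g x ^ 2) x) with hg'
      have hinv : ∀ x y, g' (update x a y) = g' x := fun x y => by
        simp only [hg', avg_update_self]
      have hsq : ∀ x, g' x ^ 2 = avg a (fun x => g x ^ 2) x := fun x =>
        Real.sq_sqrt (Finset.expect_nonneg fun _ _ => sq_nonneg _)
      refine ⟨g', ?_, ?_, ?_⟩
      · intro j hj x y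
        rcases Finset.mem_insert.1 hj with rfl | hj
        · exact hinv x y
        · have hne : j ≠ a := fun h => ha (h ▸ hj)
          simp only [hg', avg_update_of_ne hne, hg j hj]
      · rintro ⟨j, k⟩
        refine le_trans ?_ (hD (j, k))
        by_cases hj : j = a
        · subst hj
          simp only [coordMove, hinv, sub_self]
          simpa using Finset.expect_nonneg fun _ _ => sq_nonneg _
        · rw [← expect_avg a fun x => (g (coordMove τ (j, k) x) - g x) ^ 2]
          refine Finset.expect_le_expect fun x _ => ?_
          have h1 : ∀ y, update (coordMove τ (j, k) x) a y = coordMove τ (j, k) (update x a y) := by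
            intro y
            simp only [coordMove, update_of_ne hj]
            rw [update_comm hj]
          simp only [hg', avg, h1]
          exact sqrt_expect_sub_sq_le _ _
      · rw [Finset.sum_insert ha]
        have h1 : ent (fun x => g x ^ 2) ≤
            (∑ k, 𝔼 x, (g (coordMove τ (a, k) x) - g x) ^ 2) + ent fun x => g' x ^ 2 := by
          rw [ent_eq_expect_ent_add a]
          simp only [hsq]
          refine add_le_add ?_ le_rfl
          calc (𝔼 x, ent fun y => g (update x a y) ^ 2)
              ≤ 𝔼 x : ι → β, ∑ k, 𝔼 y, (g (update x a (τ k y)) - g (update x a y)) ^ 2 :=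
                Finset.expect_le_expect fun x _ => hτ fun y => g (update x a y)
            _ = ∑ k, 𝔼 x, (g (coordMove τ (a, k) x) - g x) ^ 2 := by
                rw [Finset.expect_sum_comm]
                refine Finset.sum_congr rfl fun k _ => ?_
                rw [← expect_avg a fun x => (g (coordMove τ (a, k) x) - g x) ^ 2]
                simp [avg, coordMove]
        have h2 : (∑ k, 𝔼 x, (g (coordMove τ (a, k) x) - g x) ^ 2) ≤
            ∑ k, 𝔼 x, (f (coordMove τ (a, k) x) - f x) ^ 2 :=
          Finset.sum_le_sum fun k _ => hD (a, k)
        linarith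
  obtain ⟨g, hg, -, hE⟩ := key Finset.univ
  have hc : (fun x => g x ^ 2) = fun _ => g (Classical.arbitrary _) ^ 2 := by
    funext x
    rw [eq_of_forall_update_eq (fun j x y => hg j (Finset.mem_univ j) x y) x]
  rw [hc, ent_const, add_zero, ← Fintype.sum_prod_type'] at hE
  exact hE

/-- Entropy is large for functions whose `L¹`-norm is much smaller than their `L²`-norm. -/
lemma le_ent_sq [Nonempty Ω] (u : Ω → ℝ) {σ : ℝ} (hσ : 0 < σ) :
    (𝔼 x, u x ^ 2) * (1 - Real.log σ) - σ⁻¹ * (𝔼 x, |u x|) ^ 2 ≤ ent fun x => u x ^ 2 := by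
  set q := 𝔼 x, u x ^ 2 with hq
  set p := 𝔼 x, |u x| with hp
  have hq0 : 0 ≤ q := Finset.expect_nonneg fun _ _ => sq_nonneg _
  have hp0 : 0 ≤ p := Finset.expect_nonneg fun _ _ => abs_nonneg _
  rcases hq0.eq_or_lt with h0 | hqpos
  · have hu : ∀ x, u x = 0 := by
      intro x
      have := (Finset.expect_eq_zero_iff_of_nonneg
        (fun x _ => sq_nonneg (u x))).1 (hq.symm.trans h0.symm) x (Finset.mem_univ x)
      simpa using this
    have hp' : p = 0 := by simp [hp, hu]
    simp [ent, ← h0, hp', hu]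
  set s := √σ with hs
  have hspos : 0 < s := Real.sqrt_pos.2 hσ
  -- This is `log r ≤ r - 1` at `r = √q / (|u x| * √σ)`, multiplied by `2 * u x ^ 2`. The choice `σ
  -- = p² / q` would give the bound `q * log (q / p²)`; leaving `σ` free avoids optimizing
  -- separately for each coordinate.
  have hpt : ∀ x, u x ^ 2 * Real.log q - 2 * (|u x| * √q / s - u x ^ 2 + u x ^ 2 * Real.log s) ≤
      u x ^ 2 * Real.log (u x ^ 2) := by
    intro x
    rcases eq_or_ne (u x) 0 with h | h
    · simp [h]
    have ha : 0 < |u x| := abs_pos.2 h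
    have hsq := Real.sqrt_pos.2 hqpos
    have h1 := Real.log_le_sub_one_of_pos (div_pos hsq (mul_pos ha hspos))
    rw [Real.log_div hsq.ne' (mul_pos ha hspos).ne', Real.log_mul ha.ne' hspos.ne',
      Real.log_sqrt hqpos.le] at h1
    have h2 : Real.log (u x ^ 2) = 2 * Real.log |u x| := by
      rw [← sq_abs, Real.log_pow]; norm_num
    have h3 : u x ^ 2 * (√q / (|u x| * s)) = |u x| * √q / s := by
      rw [← sq_abs]; field_simp
    have h4 := mul_le_mul_of_nonneg_left h1 (sq_nonneg (u x))
    rw [h2]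
    rw [mul_sub _ (√q / _), h3] at h4
    linarith
  have hsum := Finset.expect_le_expect fun x (_ : x ∈ Finset.univ) => hpt x
  have heq : 𝔼 x, (u x ^ 2 * Real.log q - 2 * (|u x| * √q / s - u x ^ 2 + u x ^ 2 * Real.log s))
      = q * Real.log q - 2 * (p * √q / s - q + q * Real.log s) := by
    rw [Finset.expect_sub_distrib, ← Finset.expect_mul, ← Finset.mul_expect,
      Finset.expect_add_distrib, Finset.expect_sub_distrib, ← Finset.expect_mul,
      ← Finset.expect_div, ← Finset.expect_mul]
  rw [heq] at hsum
  have hls : Real.log s = Real.log σ / 2 := Real.log_sqrt hσ.le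
  have hamgm : 2 * (p * √q / s) ≤ σ⁻¹ * p ^ 2 + q := by
    have h1 : σ⁻¹ * p ^ 2 = (p / s) ^ 2 := by
      rw [div_pow, hs, Real.sq_sqrt hσ.le]; field_simp
    have h2 : q = √q ^ 2 := (Real.sq_sqrt hq0).symm
    have h3 : p * √q / s = (p / s) * √q := by ring
    rw [h1, h3]
    nlinarith [sq_nonneg (p / s - √q)]
  simp only [ent]
  rw [← hq]
  rw [hls] at hsum
  nlinarith

/-- Pythagoras: `avg a` is the orthogonal projection of `L²` onto the functions that do not depend
on coordinate `a`. -/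
lemma expect_sub_avg_sq (a : ι) (g : (ι → β) → ℝ) :
    𝔼 x, (g x - avg a g x) ^ 2 = (𝔼 x, g x ^ 2) - 𝔼 x, avg a g x ^ 2 := by
  have h : 𝔼 x, g x * avg a g x = 𝔼 x, avg a g x ^ 2 := by
    rw [← expect_avg a fun x => g x * avg a g x]
    refine Finset.expect_congr rfl fun x _ => ?_
    simp only [avg, update_idem]
    rw [← Finset.expect_mul, sq]
  have h2 : 𝔼 x, (g x - avg a g x) ^ 2 =
      (𝔼 x, g x ^ 2) - 2 * (𝔼 x, g x * avg a g x) + 𝔼 x, avg a g x ^ 2 := by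
    rw [Finset.mul_expect, ← Finset.expect_sub_distrib, ← Finset.expect_add_distrib]
    exact Finset.expect_congr rfl fun x _ => by ring
  rw [h2, h]; ring

lemma expect_abs_avg_le (a : ι) (g : (ι → β) → ℝ) : 𝔼 x, |avg a g x| ≤ 𝔼 x, |g x| := by
  rw [← expect_avg a fun x => |g x|]
  exact Finset.expect_le_expect fun x _ => Finset.abs_expect_le _ _

/-- Falik–Samorodnitsky type inequality, with a free parameter `σ`. -/
theorem LogSobolev.variance_le {τ : κ → β → β} (hτ : LogSobolev τ) (f : (ι → β) → ℝ) {σ : ℝ}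
    (hσ : 0 < σ) :
    ((𝔼 x, f x ^ 2) - (𝔼 x, f x) ^ 2) * (1 - Real.log σ) -
      σ⁻¹ * ∑ j, (𝔼 x, 𝔼 y, |f x - f (update x j y)|) ^ 2 ≤
    ∑ p : ι × κ, 𝔼 x, (f (coordMove τ p x) - f x) ^ 2 := by
  have hls : LogSobolev (coordMove τ : ι × κ → (ι → β) → (ι → β)) := hτ.pi
  have key : ∀ S : Finset ι, ∃ g : (ι → β) → ℝ, (∀ j ∈ S, ∀ x y, g (update x j y) = g x) ∧
      (𝔼 x, g x = 𝔼 x, f x) ∧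
      (∀ j, 𝔼 x, |g x - avg j g x| ≤ 𝔼 x, |f x - avg j f x|) ∧
      ((𝔼 x, f x ^ 2) - (𝔼 x, g x ^ 2)) * (1 - Real.log σ) -
        σ⁻¹ * ∑ j ∈ S, (𝔼 x, |f x - avg j f x|) ^ 2 ≤
      (∑ p : ι × κ, 𝔼 x, (f (coordMove τ p x) - f x) ^ 2) -
        ∑ p : ι × κ, 𝔼 x, (g (coordMove τ p x) - g x) ^ 2 := by
    intro S
    induction S using Finset.induction_on with
    | empty => exact ⟨f, by simp, rfl, fun _ => le_rfl, by simp⟩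
    | insert a S ha ih =>
      obtain ⟨g, hg, hmean, hL, hE⟩ := ih
      refine ⟨avg a g, ?_, (expect_avg a g).trans hmean, ?_, ?_⟩
      · intro j hj x y
        rcases Finset.mem_insert.1 hj with rfl | hj
        · exact avg_update_self _ _ _ _
        · have hne : j ≠ a := fun h => ha (h ▸ hj)
          simp only [avg_update_of_ne hne, hg j hj]
      · intro j
        by_cases hj : j = a
        · subst hj
          have : ∀ x, avg j g x - avg j (avg j g) x = 0 := by
            intro x
            simp [avg]
          simp only [this, abs_zero]
          simpa using Finset.expect_nonneg fun _ _ => abs_nonneg _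
        · refine le_trans ?_ (hL j)
          have : ∀ x, avg a g x - avg j (avg a g) x = avg a (fun x => g x - avg j g x) x := by
            intro x
            rw [avg_comm hj]
            simp only [avg, Finset.expect_sub_distrib]
          simp only [this]
          exact expect_abs_avg_le _ _
      · rw [Finset.sum_insert ha]
        -- The increments `Δ` obtained as the coordinates are averaged out in turn are orthogonal,
        -- and their squared norms add up to the variance. Averaging contracts `L¹`, so the `L¹`
        -- norm of `Δ` is at most that of `f - avg a f`.
        set Δ : (ι → β) → ℝ := fun x => g x - avg a g x with hΔ
        have h1 := (le_ent_sq Δ hσ).trans (hls Δ)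
        have h2 : 𝔼 x, Δ x ^ 2 = (𝔼 x, g x ^ 2) - 𝔼 x, avg a g x ^ 2 := expect_sub_avg_sq a g
        have h3 : (𝔼 x, |Δ x|) ^ 2 ≤ (𝔼 x, |f x - avg a f x|) ^ 2 := by
          refine pow_le_pow_left₀ (Finset.expect_nonneg fun _ _ => abs_nonneg _) (hL a) 2
        -- Pythagoras again, applied to the difference along a move: the energies of the increments
        -- telescope. For a move of `a` itself the projected part is constant.
        have h4 : ∀ p : ι × κ, 𝔼 x, (Δ (coordMove τ p x) - Δ x) ^ 2 =
            (𝔼 x, (g (coordMove τ p x) - g x) ^ 2) -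
              𝔼 x, (avg a g (coordMove τ p x) - avg a g x) ^ 2 := by
          rintro ⟨j, k⟩
          by_cases hj : j = a
          · subst hj
            simp [hΔ, coordMove, avg_update_self]
          · have h5 : ∀ x, avg a g (coordMove τ (j, k) x) =
                avg a (fun x => g (coordMove τ (j, k) x)) x := by
              intro x
              simp only [avg, coordMove, update_of_ne hj]
              simp only [update_comm hj]
            have h6 : ∀ x, avg a g (coordMove τ (j, k) x) - avg a g x =
                avg a (fun x => g (coordMove τ (j, k) x) - g x) x := by
              intro x
              rw [h5]
              simp only [avg, Finset.expect_sub_distrib]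
            simp only [h6]
            rw [← expect_sub_avg_sq]
            refine Finset.expect_congr rfl fun x _ => ?_
            rw [← h6]
            simp only [hΔ]
            ring
        simp only [h4, Finset.sum_sub_distrib] at h1
        rw [h2] at h1
        have h7 := mul_le_mul_of_nonneg_left h3 (inv_pos.2 hσ).le
        nlinarith
  obtain ⟨g, hg, hmean, -, hE⟩ := key Finset.univ
  have hc : g = fun _ => g (Classical.arbitrary _) := by
    funext x
    exact eq_of_forall_update_eq (fun j x y => hg j (Finset.mem_univ j) x y) x _
  have hc1 : 𝔼 x, g x ^ 2 = (𝔼 x, f x) ^ 2 := by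
    rw [← hmean, hc]; simp
  have hnn : 0 ≤ ∑ p : ι × κ, 𝔼 x, (g (coordMove τ p x) - g x) ^ 2 :=
    Finset.sum_nonneg fun _ _ => Finset.expect_nonneg fun _ _ => sq_nonneg _
  rw [hc1] at hE
  have hle : ∑ j, (𝔼 x, |f x - avg j f x|) ^ 2 ≤
      ∑ j, (𝔼 x, 𝔼 y, |f x - f (update x j y)|) ^ 2 := by
    refine Finset.sum_le_sum fun j _ => pow_le_pow_left₀
      (Finset.expect_nonneg fun _ _ => abs_nonneg _) (Finset.expect_le_expect fun x _ => ?_) 2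
    have : f x - avg j f x = 𝔼 y, (f x - f (update x j y)) := by
      rw [Finset.expect_sub_distrib, Fintype.expect_const]; rfl
    rw [this]
    exact Finset.abs_expect_le _ _
  have := mul_le_mul_of_nonneg_left hle (inv_pos.2 hσ).le
  linarith

end Cube

end FPP

namespace FPP

open scoped BigOperators Topology
open Function Filter

/-! ### Normalized sums of random signs and their Gaussian limit. -/

section Limit

/-- The uniform probability measure on a finite type. -/
noncomputable def unif (α : Type*) [Fintype α] [Nonempty α] [MeasurableSpace α] : Measure α :=
  (PMF.uniformOfFintype α).toMeasure

instance (α : Type*) [Fintype α] [Nonempty α] [MeasurableSpace α] :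
    IsProbabilityMeasure (unif α) := by
  unfold unif; infer_instance

variable {α β ι : Type*} [Fintype α] [Nonempty α] [MeasurableSpace α] [MeasurableSingletonClass α]
  [Fintype β] [Nonempty β] [MeasurableSpace β] [MeasurableSingletonClass β] [Fintype ι]
  [DecidableEq ι]

lemma integral_unif (f : α → ℝ) : ∫ a, f a ∂(unif α) = 𝔼 a, f a := by
  rw [unif, PMF.integral_eq_sum, Fintype.expect_eq_sum_div_card, Finset.sum_div]
  refine Finset.sum_congr rfl fun a _ => ?_
  simp [div_eq_inv_mul]

lemma pi_unif : Measure.pi (fun _ : ι => unif β) = unif (ι → β) := by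
  refine Measure.ext_of_singleton fun a => ?_
  rw [Measure.pi_singleton]
  simp only [unif, PMF.toMeasure_apply_singleton _ _ (MeasurableSet.singleton _),
    PMF.uniformOfFintype_apply, Finset.prod_const, Finset.card_univ, Fintype.card_fun,
    Nat.cast_pow, ENNReal.inv_pow]

/-- The sign of a bit. -/
noncomputable def bitSign (b : Bool) : ℝ := if b then 1 else -1

/-- The normalized sum of `n` signs. -/
noncomputable def signSum (n : ℕ) (b : Fin n → Bool) : ℝ := (√n)⁻¹ * ∑ i, bitSign (b i)

/-- The law of the normalized sum of `n` random signs. -/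
noncomputable def signSumLaw (n : ℕ) : ProbabilityMeasure ℝ :=
  ⟨(unif (Fin n → Bool)).map (signSum n),
    Measure.isProbabilityMeasure_map (measurable_of_finite _).aemeasurable⟩

/-- The standard Gaussian law. -/
noncomputable def stdGaussian : ProbabilityMeasure ℝ := ⟨gaussianReal 0 1, inferInstance⟩

/-- Central limit theorem through pointwise convergence of characteristic functions. It transfers
inequalities from the cube to Gaussian space. -/
lemma tendsto_signSumLaw : Tendsto signSumLaw atTop (𝓝 stdGaussian) := by
  refine ProbabilityMeasure.tendsto_iff_tendsto_charFun.2 fun t => ?_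
  have hm : AEMeasurable bitSign (unif Bool) := (measurable_of_finite _).aemeasurable
  have h0 : ∫ b, bitSign b ∂(unif Bool) = 0 := by
    rw [integral_unif, Fintype.expect_eq_sum_div_card]; simp [bitSign]
  have h1 : ∫ b, (bitSign ^ 2) b ∂(unif Bool) = 1 := by
    rw [integral_unif, Fintype.expect_eq_sum_div_card]; simp [bitSign]
  have h := tendsto_charFun_inv_sqrt_mul_pow hm h0 h1 t
  have hg : charFun (stdGaussian : Measure ℝ) t = Complex.exp (-(t : ℂ) ^ 2 / 2) := by
    change charFun (gaussianReal 0 1) t = _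
    rw [charFun_gaussianReal]
    congr 1
    push_cast
    ring
  rw [hg]
  refine h.congr fun n => ?_
  change _ = charFun ((unif (Fin n → Bool)).map (signSum n)) t
  rw [charFun_apply_real, charFun_apply_real, integral_map hm (by fun_prop),
    integral_map (measurable_of_finite _).aemeasurable (by fun_prop), ← pi_unif]
  have := integral_fintype_prod_eq_pow (ι := Fin n) (μ := unif Bool)
    (fun b : Bool => Complex.exp (((√n)⁻¹ * t : ℝ) * (bitSign b : ℂ) * Complex.I))
  rw [Fintype.card_fin] at this
  rw [← this]
  refine integral_congr_ae (ae_of_all _ fun b => ?_)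
  simp only
  rw [← Complex.exp_sum]
  congr 1
  simp only [signSum, ← Finset.sum_mul, ← Finset.mul_sum]
  push_cast
  ring

lemma bitSign_not (b : Bool) : |bitSign (!b) - bitSign b| ≤ 2 := by
  cases b <;> norm_num [bitSign]

/-- Flipping bit `k.1`. -/
def flipBit (n : ℕ) : Fin n × Unit → (Fin n → Bool) → (Fin n → Bool) :=
  coordMove fun (_ : Unit) => Bool.not

lemma logSobolev_flipBit (n : ℕ) : LogSobolev (flipBit n) := logSobolev_bool.pi

lemma flipBit_flipBit (n : ℕ) (k : Fin n × Unit) (b : Fin n → Bool) :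
    flipBit n k (flipBit n k b) = b := by
  simp [flipBit, coordMove]

lemma signSum_flipBit (n : ℕ) (k : Fin n × Unit) (b : Fin n → Bool) :
    |signSum n (flipBit n k b) - signSum n b| ≤ 2 * (√n)⁻¹ := by
  have h : ∑ i, bitSign (flipBit n k b i) - ∑ i, bitSign (b i)
      = bitSign (!(b k.1)) - bitSign (b k.1) := by
    rw [← Finset.sum_sub_distrib, Finset.sum_eq_single k.1]
    · simp [flipBit, coordMove]
    · intro j _ hj
      simp [flipBit, coordMove, update_of_ne hj]
    · simp
  rw [signSum, signSum, ← mul_sub, h, abs_mul, abs_of_nonneg (by positivity), mul_comm]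
  exact mul_le_mul_of_nonneg_right (bitSign_not _) (by positivity)

end Limit

/-! ### Monotone functions with an upper gradient, evaluated on cube configurations. -/

section GaussianSquare

variable {ι : Type*} [DecidableEq ι]

/-- `w x` bounds the upward increments of the monotone function `G` at `x`; the coordinates that
matter are at most `M`. -/
structure UpperGradient (G : (ι → ℝ≥0) → ℝ) (w : (ι → ℝ≥0) → ι → ℝ) (M : ℝ) : Prop where
  nonneg : ∀ x e, 0 ≤ w x e
  le_one : ∀ x e, w x e ≤ 1
  le_bound : ∀ x e, w x e ≠ 0 → (x e : ℝ) ≤ M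
  mono : ∀ x e y, x e ≤ y → G x ≤ G (update x e y)
  le_add : ∀ x e y, x e ≤ y → G (update x e y) ≤ G x + w x e * (y - x e)

lemma abs_exp_sub_exp_le (a b : ℝ) :
    |Real.exp b - Real.exp a| ≤ |b - a| * Real.exp |b - a| * Real.exp a := by
  have h1 : Real.exp b - Real.exp a = (Real.exp (b - a) - 1) * Real.exp a := by
    rw [sub_mul, ← Real.exp_add]; simp
  rw [h1, abs_mul, abs_of_pos (Real.exp_pos a)]
  refine mul_le_mul_of_nonneg_right ?_ (Real.exp_pos a).le
  generalize b - a = t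
  rcases le_total 0 t with ht | ht
  · rw [abs_of_nonneg ht, abs_of_nonneg (by linarith [Real.add_one_le_exp t])]
    have := Real.add_one_le_exp (-t)
    have h2 : Real.exp t * Real.exp (-t) = 1 := by rw [← Real.exp_add]; simp
    nlinarith [Real.exp_pos t]
  · rw [abs_of_nonpos ht, abs_of_nonpos (by linarith [Real.exp_le_one_iff.2 ht])]
    have := Real.add_one_le_exp t
    have h3 : 1 ≤ Real.exp (-t) := Real.one_le_exp (by linarith)
    nlinarith

/-- The weight is kept in the linear factor, where both energy and influences need it, and bounded
by one in the correction `exp (|θ| / 2 * δ)`. -/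
lemma UpperGradient.abs_exp_sub_le {G : (ι → ℝ≥0) → ℝ} {w : (ι → ℝ≥0) → ι → ℝ} {M : ℝ}
    (h : UpperGradient G w M) (θ : ℝ) (x : ι → ℝ≥0) (e : ι) (y : ℝ≥0) (hy : x e ≤ y) {δ : ℝ}
    (hδ : (y : ℝ) - x e ≤ δ) :
    |Real.exp (θ / 2 * G (update x e y)) - Real.exp (θ / 2 * G x)| ≤
      |θ| / 2 * (w x e * δ) * Real.exp (|θ| / 2 * δ) * Real.exp (θ / 2 * G x) := by
  refine (abs_exp_sub_exp_le _ _).trans ?_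
  have hδ0 : 0 ≤ δ := le_trans (sub_nonneg.2 (by exact_mod_cast hy)) hδ
  have hw := h.nonneg x e
  have h1 : |θ / 2 * G (update x e y) - θ / 2 * G x| ≤ |θ| / 2 * (w x e * δ) := by
    rw [← mul_sub, abs_mul, abs_div, abs_two]
    refine mul_le_mul_of_nonneg_left ?_ (by positivity)
    rw [abs_of_nonneg (sub_nonneg.2 (h.mono x e y hy))]
    have := h.le_add x e y hy
    have := mul_le_mul_of_nonneg_left hδ hw
    linarith
  have h2 : |θ| / 2 * (w x e * δ) ≤ |θ| / 2 * δ := by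
    refine mul_le_mul_of_nonneg_left ?_ (by positivity)
    exact mul_le_of_le_one_left hδ0 (h.le_one x e)
  gcongr
  exact h1.trans h2

variable [Fintype ι]

/-- The image of the cube configuration `ω` under the map `T` of the normalized sums. -/
noncomputable def cubeConfig (T : ℝ → ℝ≥0) (n : ℕ) (ω : ι → Fin n → Bool) (e : ι) : ℝ≥0 :=
  T (signSum n (ω e))

lemma cubeConfig_update (T : ℝ → ℝ≥0) (n : ℕ) (ω : ι → Fin n → Bool) (e : ι) (b : Fin n → Bool) :
    cubeConfig T n (update ω e b) = update (cubeConfig T n ω) e (T (signSum n b)) := by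
  funext j
  by_cases hj : j = e
  · subst hj; simp [cubeConfig]
  · simp [cubeConfig, update_of_ne hj]

/-- The law of `T` of a standard Gaussian. -/
noncomputable def gaussImage (T : C(ℝ, ℝ≥0)) : ProbabilityMeasure ℝ≥0 :=
  stdGaussian.map (f := T) T.continuous.measurable.aemeasurable

/-- The extra variable is an independent copy of one coordinate: the influences compare a
configuration with the one where a coordinate is resampled, so the weak limit is taken on the
product with this copy. -/
lemma tendsto_expect_cubeConfig (T : C(ℝ, ℝ≥0)) (Φ : (ι → ℝ≥0) × ℝ≥0 → ℝ) (hΦ : Continuous Φ)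
    {C : ℝ} (hC : ∀ p, |Φ p| ≤ C) :
    Tendsto (fun n : ℕ => 𝔼 ω : ι → Fin n → Bool, 𝔼 b : Fin n → Bool,
      Φ (cubeConfig T n ω, T (signSum n b))) atTop
      (𝓝 (∫ x, ∫ y, Φ (x, y) ∂(gaussImage T : Measure ℝ≥0)
        ∂(Measure.pi fun _ : ι => (gaussImage T : Measure ℝ≥0)))) := by
  set ν := gaussImage T
  set νn : ℕ → ProbabilityMeasure ℝ≥0 := fun n =>
    (signSumLaw n).map (f := T) T.continuous.measurable.aemeasurable with hνn
  have hν : Tendsto νn atTop (𝓝 ν) :=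
    ProbabilityMeasure.tendsto_map_of_tendsto_of_continuous _ _ tendsto_signSumLaw T.continuous
  have hpi : Tendsto (fun n => ProbabilityMeasure.pi fun _ : ι => νn n) atTop
      (𝓝 (ProbabilityMeasure.pi fun _ : ι => ν)) :=
    (ProbabilityMeasure.continuous_pi.tendsto _).comp (tendsto_pi_nhds.2 fun _ => hν)
  have hprod : Tendsto (fun n => (ProbabilityMeasure.pi fun _ : ι => νn n).prod (νn n)) atTop
      (𝓝 ((ProbabilityMeasure.pi fun _ : ι => ν).prod ν)) :=
    (ProbabilityMeasure.continuous_prod.tendsto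
      (ProbabilityMeasure.pi (fun _ : ι => ν), ν)).comp (hpi.prodMk_nhds hν)
  let Ψ : BoundedContinuousFunction ((ι → ℝ≥0) × ℝ≥0) ℝ :=
    BoundedContinuousFunction.ofNormedAddCommGroup Φ hΦ C hC
  have key := ProbabilityMeasure.tendsto_iff_forall_integral_tendsto.1 hprod Ψ
  have hfub : ∀ ρ : ProbabilityMeasure ℝ≥0,
      ∫ p, Ψ p ∂((ProbabilityMeasure.pi fun _ : ι => ρ).prod ρ : Measure _) =
      ∫ x, ∫ y, Φ (x, y) ∂(ρ : Measure ℝ≥0) ∂(Measure.pi fun _ : ι => (ρ : Measure ℝ≥0)) := by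
    intro ρ
    rw [ProbabilityMeasure.toMeasure_prod, ProbabilityMeasure.toMeasure_pi]
    exact integral_prod _ (Ψ.integrable _)
  rw [hfub] at key
  refine key.congr fun n => ?_
  rw [hfub]
  have hmap : (νn n : Measure ℝ≥0) =
      (unif (Fin n → Bool)).map (fun b => T (signSum n b)) := by
    change ((unif (Fin n → Bool)).map (signSum n)).map T = _
    rw [Measure.map_map T.continuous.measurable (measurable_of_finite _)]
    rfl
  have hmp : Measure.pi (fun _ : ι => (νn n : Measure ℝ≥0)) =
      (unif (ι → Fin n → Bool)).map (cubeConfig T n) := by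
    rw [hmap, ← Measure.pi_map_pi fun _ => (measurable_of_finite _).aemeasurable, pi_unif]
    rfl
  have hsm : AEStronglyMeasurable (fun x : ι → ℝ≥0 => ∫ y, Φ (x, y) ∂(νn n : Measure ℝ≥0))
      ((unif (ι → Fin n → Bool)).map (cubeConfig T n)) :=
    (hΦ.stronglyMeasurable.integral_prod_right').aestronglyMeasurable
  rw [hmp, integral_map (measurable_of_finite _).aemeasurable hsm, integral_unif]
  refine Finset.expect_congr rfl fun ω _ => ?_
  rw [hmap, integral_map (measurable_of_finite _).aemeasurable, integral_unif]
  exact (hΦ.comp (by fun_prop)).aestronglyMeasurable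

lemma tendsto_expect_cubeConfig' (T : C(ℝ, ℝ≥0)) (Φ : (ι → ℝ≥0) → ℝ) (hΦ : Continuous Φ)
    {C : ℝ} (hC : ∀ p, |Φ p| ≤ C) :
    Tendsto (fun n : ℕ => 𝔼 ω : ι → Fin n → Bool, Φ (cubeConfig T n ω)) atTop
      (𝓝 (∫ x, Φ x ∂(Measure.pi fun _ : ι => (gaussImage T : Measure ℝ≥0)))) := by
  have := tendsto_expect_cubeConfig T (fun p : (ι → ℝ≥0) × ℝ≥0 => Φ p.1)
    (hΦ.comp continuous_fst) fun p => hC p.1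
  simpa using this

end GaussianSquare

end FPP

namespace FPP

open scoped BigOperators Topology
open Function Filter

/-! ### Energy estimate on the cube and passage to the Gaussian limit. -/

section GaussianSquare

variable {ι : Type*} [DecidableEq ι] [Fintype ι]

lemma expect_coordMove_flipBit (n : ℕ) (p : ι × Fin n × Unit) (Φ : (ι → Fin n → Bool) → ℝ) :
    𝔼 ω, Φ (coordMove (flipBit n) p ω) = 𝔼 ω, Φ ω := by
  refine Finset.expect_nbij' (coordMove (flipBit n) p) (coordMove (flipBit n) p) ?_ ?_ ?_ ?_ ?_ <;>
    simp [coordMove, flipBit_flipBit]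

/-- The increments at `e` are the sum of the upward increments from both configurations. -/
lemma abs_sub_update_eq (f : (ι → ℝ≥0) → ℝ) (x : ι → ℝ≥0) (e : ι) (y : ℝ≥0) :
    |f x - f (update x e y)| = |f (update x e (max y (x e))) - f x| +
      |f (update (update x e y) e (max (x e) (update x e y e))) - f (update x e y)| := by
  rcases le_total (x e) y with h | h
  · simp [max_eq_left h, max_eq_right h, abs_sub_comm]
  · simp [max_eq_left h, max_eq_right h]

lemma sq_sub_update_eq (f : (ι → ℝ≥0) → ℝ) (x : ι → ℝ≥0) (e : ι) (y : ℝ≥0) :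
    (f (update x e y) - f x) ^ 2 = (f (update x e (max y (x e))) - f x) ^ 2 +
      (f (update (update x e y) e (max (x e) (update x e y e))) - f (update x e y)) ^ 2 := by
  rcases le_total (x e) y with h | h
  · simp [max_eq_left h, max_eq_right h]
  · simp [max_eq_left h, max_eq_right h]; ring

/-- Exchanging the coordinate with its independent copy turns downward increments into upward ones,
the only increments that an upper gradient controls. -/
lemma expect_expect_abs_sub (T : C(ℝ, ℝ≥0)) (n : ℕ) (f : (ι → ℝ≥0) → ℝ) (e : ι) :
    𝔼 ω : ι → Fin n → Bool, 𝔼 b, |f (cubeConfig T n ω) - f (cubeConfig T n (update ω e b))| =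
      𝔼 ω : ι → Fin n → Bool, 𝔼 b : Fin n → Bool, 2 *
        |f (update (cubeConfig T n ω) e (max (T (signSum n b)) (cubeConfig T n ω e)))
          - f (cubeConfig T n ω)| := by
  set Φ : (ι → Fin n → Bool) → (Fin n → Bool) → ℝ := fun ω b =>
    |f (update (cubeConfig T n ω) e (max (T (signSum n b)) (cubeConfig T n ω e)))
          - f (cubeConfig T n ω)| with hΦ
  have h : ∀ ω b, |f (cubeConfig T n ω) - f (cubeConfig T n (update ω e b))| =
      Φ ω b + Φ (update ω e b) (ω e) := by
    intro ω b
    simp only [hΦ, cubeConfig_update]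
    exact abs_sub_update_eq f _ e _
  simp only [h, Finset.expect_add_distrib, expect_swap, ← Finset.mul_expect]
  ring

/-- One flip moves `R` by at most `ε = O(n^(-1/2))`, hence raises `R²` by at most `ε * (2 * R + ε)`,
whose square is `O(ε² (x_e + ε²))`. Summed over the `n` bits of an edge the factor `n * ε²` stays
bounded, and summed over the edges `∑ w_e * x_e ≤ G` appears. -/
lemma sum_expect_sq_le {R : ℝ → ℝ} {L : ℝ} (hL : 0 ≤ L) (hR : ∀ s t, |R s - R t| ≤ L * |s - t|)
    (hR0 : ∀ s, 0 ≤ R s) (T : C(ℝ, ℝ≥0)) (hT : ∀ s, (T s : ℝ) = R s ^ 2)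
    {G : (ι → ℝ≥0) → ℝ} {w : (ι → ℝ≥0) → ι → ℝ} {M : ℝ}
    (h : UpperGradient G w M) (hsum : ∀ x, ∑ e, w x e * x e ≤ G x) {θ : ℝ} (hθ : |θ| ≤ 1)
    {n : ℕ} (hn : 0 < n) {ε : ℝ} (hε : ε = 2 * L * (√n)⁻¹) (hεM : ε * (2 * √M + ε) ≤ 1) :
    ∑ p : ι × Fin n × Unit, 𝔼 ω : ι → Fin n → Bool,
      (Real.exp (θ / 2 * G (cubeConfig T n (coordMove (flipBit n) p ω))) -
        Real.exp (θ / 2 * G (cubeConfig T n ω))) ^ 2 ≤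
    48 * θ ^ 2 * L ^ 2 * 𝔼 ω : ι → Fin n → Bool,
      (G (cubeConfig T n ω) + Fintype.card ι * ε ^ 2) *
        Real.exp (θ / 2 * G (cubeConfig T n ω)) ^ 2 := by
  set f : (ι → ℝ≥0) → ℝ := fun x => Real.exp (θ / 2 * G x) with hf
  have hε0 : 0 ≤ ε := by rw [hε]; positivity
  set Ψ : ι × Fin n × Unit → (ι → Fin n → Bool) → ℝ := fun p ω =>
    (f (update (cubeConfig T n ω) p.1
      (max (T (signSum n (flipBit n p.2 (ω p.1)))) (cubeConfig T n ω p.1)))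
          - f (cubeConfig T n ω)) ^ 2 with hΨ
  have h1 : ∀ p ω, (f (cubeConfig T n (coordMove (flipBit n) p ω)) - f (cubeConfig T n ω)) ^ 2 =
      Ψ p ω + Ψ p (coordMove (flipBit n) p ω) := by
    intro p ω
    simp only [hΨ, coordMove, cubeConfig_update, update_self, flipBit_flipBit]
    have := sq_sub_update_eq f (cubeConfig T n ω) p.1 (T (signSum n (flipBit n p.2 (ω p.1))))
    rw [update_self] at this
    exact this
  have h2 : ∀ p, 𝔼 ω : ι → Fin n → Bool,
      (f (cubeConfig T n (coordMove (flipBit n) p ω)) - f (cubeConfig T n ω)) ^ 2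
      = 2 * 𝔼 ω, Ψ p ω := by
    intro p
    simp only [h1, Finset.expect_add_distrib, expect_coordMove_flipBit n p (Ψ p)]
    ring
  have h3 : ∀ p ω, Ψ p ω ≤ 6 * θ ^ 2 * ε ^ 2 *
      (w (cubeConfig T n ω) p.1 * (cubeConfig T n ω p.1 + ε ^ 2) * f (cubeConfig T n ω) ^ 2) := by
    rintro ⟨e, k⟩ ω
    simp only [hΨ]
    set x := cubeConfig T n ω with hx
    set s := signSum n (ω e)
    set s' := signSum n (flipBit n k (ω e))
    have hxe : (x e : ℝ) = R s ^ 2 := hT s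
    have hw0 := h.nonneg x e
    by_cases hw : w x e = 0
    · have := h.abs_exp_sub_le θ x e (max (T s') (x e)) (le_max_right _ _) le_rfl
      rw [hw] at this
      have h0 : f (update x e (max (T s') (x e))) - f x = 0 := by
        rw [← abs_nonpos_iff]; simpa [hf] using this
      rw [h0, hw]; simp
    -- Only coordinates of nonzero weight matter, and for these `x e ≤ M`; this makes the increment
    -- `δ` at most one as soon as `n` is large, uniformly in `ω`.
    have hM := h.le_bound x e hw
    have hM0 : 0 ≤ M := le_trans (x e).2 hM
    have hr : R s ≤ √M := Real.le_sqrt_of_sq_le (hxe ▸ hM)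
    have hd : R s' - R s ≤ ε := by
      refine (le_abs_self _).trans ((hR s' s).trans ?_)
      rw [hε, mul_comm 2 L, mul_assoc]
      exact mul_le_mul_of_nonneg_left (signSum_flipBit n k (ω e)) hL
    set δ := ε * (2 * R s + ε) with hδ
    have hδ0 : 0 ≤ δ := by have := hR0 s; positivity
    have hδ1 : δ ≤ 1 := le_trans (by rw [hδ]; gcongr) hεM
    have hinc : ((max (T s') (x e) : ℝ≥0) : ℝ) - x e ≤ δ := by
      rw [NNReal.coe_max, hT s', hxe, sub_le_iff_le_add]
      refine max_le ?_ (by linarith)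
      have := hR0 s
      have := hR0 s'
      rw [hδ]
      nlinarith
    have key := h.abs_exp_sub_le θ x e (max (T s') (x e)) (le_max_right _ _) hinc
    have hexp : Real.exp (|θ| / 2 * δ) ^ 2 ≤ 3 := by
      rw [← Real.exp_nat_mul]
      refine le_trans (Real.exp_le_exp.2 (?_ : _ ≤ (1 : ℝ))) (Real.exp_one_lt_d9.le.trans (by norm_num))
      push_cast
      nlinarith [abs_nonneg θ]
    have hδ2 : δ ^ 2 ≤ ε ^ 2 * (8 * x e + 2 * ε ^ 2) := by
      rw [hδ, hxe, mul_pow]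
      refine mul_le_mul_of_nonneg_left ?_ (sq_nonneg _)
      nlinarith [sq_nonneg (2 * R s - ε)]
    have hf0 : 0 ≤ f x ^ 2 := sq_nonneg _
    calc (f (update x e (max (T s') (x e))) - f x) ^ 2
        = |f (update x e (max (T s') (x e))) - f x| ^ 2 := (sq_abs _).symm
      _ ≤ (|θ| / 2 * (w x e * δ) * Real.exp (|θ| / 2 * δ) * f x) ^ 2 :=
          pow_le_pow_left₀ (abs_nonneg _) key 2
      _ = θ ^ 2 / 4 * (w x e * w x e) * δ ^ 2 * Real.exp (|θ| / 2 * δ) ^ 2 * f x ^ 2 := by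
          rw [← sq_abs θ]; ring
      _ ≤ θ ^ 2 / 4 * (w x e * 1) * (ε ^ 2 * (8 * x e + 2 * ε ^ 2)) * 3 * f x ^ 2 := by
          gcongr
          exact h.le_one x e
      _ ≤ 6 * θ ^ 2 * ε ^ 2 * (w x e * (x e + ε ^ 2) * f x ^ 2) := by
          have : 0 ≤ θ ^ 2 * w x e * ε ^ 2 * ε ^ 2 * f x ^ 2 := by positivity
          nlinarith
  -- The constant `48` is `2 * 6 * 4`: two directions of change, the factor `6 = 8 * 3 / 4` of `h3`,
  -- and `n * ε ^ 2 = 4 * L ^ 2`.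
  have hεn : (n : ℝ) * ε ^ 2 = 4 * L ^ 2 := by
    have : (0 : ℝ) < n := by exact_mod_cast hn
    rw [hε, mul_pow, inv_pow, Real.sq_sqrt this.le]
    field_simp
    ring
  calc _ = ∑ p : ι × Fin n × Unit, 2 * 𝔼 ω, Ψ p ω := Finset.sum_congr rfl fun p _ => h2 p
    _ ≤ ∑ p : ι × Fin n × Unit, 2 * 𝔼 ω : ι → Fin n → Bool, 6 * θ ^ 2 * ε ^ 2 *
      (w (cubeConfig T n ω) p.1 * (cubeConfig T n ω p.1 + ε ^ 2) * f (cubeConfig T n ω) ^ 2) := by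
        gcongr with p _ ω _
        exact h3 p ω
    _ = 48 * θ ^ 2 * L ^ 2 * 𝔼 ω : ι → Fin n → Bool, (∑ e, w (cubeConfig T n ω) e *
          (cubeConfig T n ω e + ε ^ 2)) * f (cubeConfig T n ω) ^ 2 := by
        rw [Fintype.sum_prod_type]
        simp only [← Finset.mul_expect, Finset.sum_const, Finset.card_univ, Fintype.card_prod,
          Fintype.card_fin, Fintype.card_unit, mul_one, nsmul_eq_mul, ← Finset.mul_sum,
          Finset.sum_mul, Finset.expect_sum_comm]
        have : (n : ℝ) * (2 * (6 * θ ^ 2 * ε ^ 2)) = 48 * θ ^ 2 * L ^ 2 := by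
          linear_combination 12 * θ ^ 2 * hεn
        rw [← this]
        ring
    _ ≤ _ := by
        gcongr with ω _
        simp only [mul_add, Finset.sum_add_distrib]
        refine add_le_add (hsum _) ?_
        rw [← Finset.sum_mul]
        refine mul_le_mul_of_nonneg_right ?_ (sq_nonneg _)
        calc ∑ e, w (cubeConfig T n ω) e ≤ ∑ _e : ι, (1 : ℝ) :=
              Finset.sum_le_sum fun e _ => h.le_one _ e
          _ = Fintype.card ι := by simp

/-- The variance inequality for exponentials of functions with an upper gradient, for products of
laws of squares of Lipschitz functions of a Gaussian. -/
theorem variance_exp_le {R : ℝ → ℝ} {L : ℝ} (hL : 0 ≤ L) (hR : ∀ s t, |R s - R t| ≤ L * |s - t|)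
    (hR0 : ∀ s, 0 ≤ R s) (T : C(ℝ, ℝ≥0)) (hT : ∀ s, (T s : ℝ) = R s ^ 2)
    {ν : Measure ℝ≥0} (hν : ν = gaussImage T)
    {G : (ι → ℝ≥0) → ℝ} {w : (ι → ℝ≥0) → ι → ℝ} {M : ℝ} (hG : Continuous G)
    (hG0 : ∀ x, 0 ≤ G x) (hGM : ∀ x, G x ≤ M)
    (h : UpperGradient G w M) (hsum : ∀ x, ∑ e, w x e * x e ≤ G x) {θ : ℝ} (hθ : |θ| ≤ 1)
    {σ : ℝ} (hσ : 0 < σ) :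
    ((∫ x, Real.exp (θ / 2 * G x) ^ 2 ∂(Measure.pi fun _ : ι => ν)) -
      (∫ x, Real.exp (θ / 2 * G x) ∂(Measure.pi fun _ : ι => ν)) ^ 2) * (1 - Real.log σ) -
      σ⁻¹ * ∑ e, (∫ x, ∫ y, 2 * |Real.exp (θ / 2 * G (update x e (max y (x e)))) -
        Real.exp (θ / 2 * G x)| ∂ν ∂(Measure.pi fun _ : ι => ν)) ^ 2 ≤
    48 * θ ^ 2 * L ^ 2 *
      ∫ x, G x * Real.exp (θ / 2 * G x) ^ 2 ∂(Measure.pi fun _ : ι => ν) := by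
  subst hν
  have hfc : Continuous fun x => Real.exp (θ / 2 * G x) := by fun_prop
  have hfb : ∀ x, Real.exp (θ / 2 * G x) ≤ Real.exp M := by
    intro x
    refine Real.exp_le_exp.2 ?_
    have := hG0 x
    have := hGM x
    have := (abs_le.1 hθ).2
    nlinarith
  have hfb2 : ∀ x, Real.exp (θ / 2 * G x) ^ 2 ≤ Real.exp M ^ 2 := fun x =>
    pow_le_pow_left₀ (Real.exp_pos _).le (hfb x) 2
  have hf0 : ∀ x, 0 ≤ Real.exp (θ / 2 * G x) := fun x => (Real.exp_pos _).le
  have l1 := tendsto_expect_cubeConfig' T (fun x => Real.exp (θ / 2 * G x) ^ 2) (hfc.pow 2)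
    (C := Real.exp M ^ 2) fun x => by rw [abs_of_nonneg (sq_nonneg _)]; exact hfb2 x
  have l2 := tendsto_expect_cubeConfig' T (fun x => Real.exp (θ / 2 * G x)) hfc
    (C := Real.exp M) fun x => by rw [abs_of_nonneg (hf0 x)]; exact hfb x
  have l3 := fun e => tendsto_expect_cubeConfig T
    (fun p : (ι → ℝ≥0) × ℝ≥0 => 2 * |Real.exp (θ / 2 * G (update p.1 e (max p.2 (p.1 e)))) -
        Real.exp (θ / 2 * G p.1)|) (by fun_prop) (C := 2 * (Real.exp M + Real.exp M)) (by
      intro p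
      rw [abs_mul, abs_two, abs_abs]
      refine mul_le_mul_of_nonneg_left ?_ zero_le_two
      refine (abs_sub _ _).trans ?_
      rw [abs_of_nonneg (hf0 _), abs_of_nonneg (hf0 _)]
      exact add_le_add (hfb _) (hfb _))
  have l4 := tendsto_expect_cubeConfig' T (fun x => G x * Real.exp (θ / 2 * G x) ^ 2)
    (hG.mul (hfc.pow 2)) (C := M * Real.exp M ^ 2) fun x => by
      rw [abs_of_nonneg (mul_nonneg (hG0 x) (sq_nonneg _))]
      have := hG0 x
      have := hGM x
      exact mul_le_mul (hGM x) (hfb2 x) (sq_nonneg _) (by linarith)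
  have lε : Tendsto (fun n : ℕ => 2 * L * (√n)⁻¹) atTop (𝓝 0) := by
    have : Tendsto (fun n : ℕ => (√(n : ℝ))⁻¹) atTop (𝓝 0) :=
      tendsto_inv_atTop_zero.comp (Real.tendsto_sqrt_atTop.comp tendsto_natCast_atTop_atTop)
    simpa using this.const_mul (2 * L)
  have lhs := ((l1.sub (l2.pow 2)).mul_const (1 - Real.log σ)).sub
    ((tendsto_finsetSum Finset.univ fun e _ => (l3 e).pow 2).const_mul σ⁻¹)
  have rhs := (l4.add (((lε.pow 2).const_mul (Fintype.card ι : ℝ)).mul l1)).const_mul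
    (48 * θ ^ 2 * L ^ 2)
  -- The cap `M` is fixed while `n` tends to infinity, so the smallness condition of
  -- `sum_expect_sq_le` eventually holds, and the error term `card ι * ε²` disappears in the limit.
  have hev : ∀ᶠ n : ℕ in atTop, 2 * L * (√n)⁻¹ * (2 * √M + 2 * L * (√n)⁻¹) ≤ 1 := by
    have : Tendsto (fun n : ℕ => 2 * L * (√n)⁻¹ * (2 * √M + 2 * L * (√n)⁻¹)) atTop (𝓝 0) := by
      simpa using lε.mul (lε.const_add (2 * √M))
    exact (this.eventually_lt_const one_pos).mono fun _ => le_of_lt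
  have := le_of_tendsto_of_tendsto lhs rhs ?_
  · simpa using this
  filter_upwards [hev, eventually_gt_atTop 0] with n h1 hn
  have key := (logSobolev_flipBit n).variance_le
    (fun ω : ι → Fin n → Bool => Real.exp (θ / 2 * G (cubeConfig T n ω))) hσ
  have henergy := sum_expect_sq_le hL hR hR0 T hT h hsum hθ hn rfl h1
  have heq : ∀ e, 𝔼 ω : ι → Fin n → Bool, 𝔼 b : Fin n → Bool,
      |Real.exp (θ / 2 * G (cubeConfig T n ω)) -
        Real.exp (θ / 2 * G (cubeConfig T n (update ω e b)))| = _ :=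
    fun e => expect_expect_abs_sub T n (fun x => Real.exp (θ / 2 * G x)) e
  simp only [heq] at key
  refine key.trans (henergy.trans (le_of_eq ?_))
  simp only [add_mul, Finset.expect_add_distrib, ← Finset.mul_expect]

end GaussianSquare

end FPP

namespace FPP

open scoped Topology
open Function Filter

/-! ### Nearly gamma laws as squares of Lipschitz functions of a Gaussian. -/

section Transport

lemma gaussDensity_pos (x : ℝ) : 0 < gaussDensity x := gaussianPDFReal_pos 0 1 x one_ne_zero

lemma hasDerivAt_gaussCDF (x : ℝ) : HasDerivAt gaussCDF (gaussDensity x) x := by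
  have hexpi : Integrable (gaussianPDFReal 0 1) := integrable_gaussianPDFReal 0 1
  have hcont : Continuous (gaussianPDFReal 0 1) := by
    rw [gaussianPDFReal_def]; fun_prop
  have h1 : ∀ y, gaussCDF y = ∫ t in Set.Iic y, gaussianPDFReal 0 1 t := by
    intro y
    rw [gaussCDF, cdf_eq_real, measureReal_def, gaussianReal_apply_eq_integral 0 one_ne_zero,
      ENNReal.toReal_ofReal]
    exact setIntegral_nonneg measurableSet_Iic fun t _ => gaussianPDFReal_nonneg 0 1 t
  have h2 : gaussCDF = fun y => gaussCDF 0 + ∫ t in (0 : ℝ)..y, gaussianPDFReal 0 1 t := by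
    funext y
    rw [h1 y, h1 0, ← intervalIntegral.integral_Iic_sub_Iic hexpi.integrableOn hexpi.integrableOn]
    ring
  rw [h2]
  exact (intervalIntegral.integral_hasDerivAt_right (hexpi.intervalIntegrable)
    (hcont.stronglyMeasurableAtFilter _ _) hcont.continuousAt).const_add _

lemma continuous_gaussCDF : Continuous gaussCDF :=
  continuous_iff_continuousAt.2 fun x => (hasDerivAt_gaussCDF x).continuousAt

lemma strictMono_gaussCDF : StrictMono gaussCDF :=
  strictMono_of_deriv_pos fun x => by
    rw [(hasDerivAt_gaussCDF x).deriv]; exact gaussDensity_pos x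

lemma gaussCDF_pos (x : ℝ) : 0 < gaussCDF x :=
  (cdf_nonneg _ (x - 1)).trans_lt (strictMono_gaussCDF (by linarith : x - 1 < x))

lemma gaussCDF_lt_one (x : ℝ) : gaussCDF x < 1 :=
  (strictMono_gaussCDF (by linarith : x < x + 1)).trans_le (cdf_le_one _ (x + 1))

lemma gaussCDF_invFun {u : ℝ} (h0 : 0 < u) (h1 : u < 1) : gaussCDF (invFun gaussCDF u) = u := by
  refine invFun_eq ?_
  have hb := ((tendsto_cdf_atBot (gaussianReal 0 1)).eventually_lt_const h0).exists
  have ht := ((tendsto_cdf_atTop (gaussianReal 0 1)).eventually_const_lt h1).exists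
  obtain ⟨a, ha⟩ := hb
  obtain ⟨b, hb⟩ := ht
  exact mem_range_of_exists_le_of_exists_ge continuous_gaussCDF ⟨a, ha.le⟩ ⟨b, hb.le⟩

lemma invFun_gaussCDF (s : ℝ) : invFun gaussCDF (gaussCDF s) = s :=
  leftInverse_invFun strictMono_gaussCDF.injective s

lemma hasDerivAt_invFun_gaussCDF {u : ℝ} (h0 : 0 < u) (h1 : u < 1) :
    HasDerivAt (invFun gaussCDF) (gaussDensity (invFun gaussCDF u))⁻¹ u := by
  have hev : ∀ᶠ v in 𝓝 u, gaussCDF (invFun gaussCDF v) = v := by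
    filter_upwards [Ioo_mem_nhds h0 h1] with v hv
    exact gaussCDF_invFun hv.1 hv.2
  have hrange : (Set.range gaussCDF).OrdConnected :=
    (isPreconnected_range continuous_gaussCDF).ordConnected
  have hcont : ContinuousAt (invFun gaussCDF) u := by
    rw [(strictMono_gaussCDF.isEmbedding_of_ordConnected hrange).continuousAt_iff]
    exact continuousAt_id.congr (hev.mono fun v hv => hv.symm)
  exact HasDerivAt.of_local_left_inverse hcont (hasDerivAt_gaussCDF _)
    (gaussDensity_pos _).ne' hev

variable {ν : Measure ℝ≥0} [IsProbabilityMeasure ν] {h : ℝ → ℝ}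

/-- The law of `ν` seen on the real line. -/
noncomputable abbrev realLaw (ν : Measure ℝ≥0) : Measure ℝ := ν.map (fun x : ℝ≥0 => (x : ℝ))

instance : IsProbabilityMeasure (realLaw ν) :=
  Measure.isProbabilityMeasure_map (by fun_prop)

lemma IsDensity.exists_pos_mem (hd : IsDensity ν h) {s : Set ℝ} (hs : MeasurableSet s)
    (h0 : realLaw ν s ≠ 0) : ∃ t ∈ s, t ∈ posSet h := by
  by_contra hcon
  push Not at hcon
  apply h0
  rw [realLaw, hd.map_eq, withDensity_apply _ hs, Measure.restrict_restrict hs]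
  rw [setLIntegral_congr_fun (hs.inter measurableSet_Ici) (g := fun _ => 0)]
  · simp
  · intro t ht
    have := hcon t ht.1
    simp only [posSet, Set.mem_ofPred_eq, not_and, not_lt] at this
    simpa using this ht.2

lemma IsDensity.integrableOn (hd : IsDensity ν h) : IntegrableOn h (Set.Ici 0) := by
  refine ⟨hd.measurable.aestronglyMeasurable, ?_⟩
  have h1 : realLaw ν Set.univ = 1 := measure_univ
  rw [realLaw, hd.map_eq, withDensity_apply _ MeasurableSet.univ, Measure.restrict_univ] at h1
  rw [hasFiniteIntegral_iff_ofReal (ae_of_all _ hd.nonneg), h1]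
  exact ENNReal.one_lt_top

lemma IsDensity.cdf_eq (hd : IsDensity ν h) {y : ℝ} (hy : 0 ≤ y) :
    cdf (realLaw ν) y = distFun h y := by
  rw [cdf_eq_real, measureReal_def, realLaw, hd.map_eq, withDensity_apply _ measurableSet_Iic,
    Measure.restrict_restrict measurableSet_Iic, distFun, intervalIntegral.integral_of_le hy,
    ← integral_Icc_eq_integral_Ioc, integral_eq_lintegral_of_nonneg_ae (ae_of_all _ hd.nonneg)
      hd.measurable.aestronglyMeasurable, Set.inter_comm, Set.Ici_inter_Iic]

lemma IsDensity.nullSingletonClass (hd : IsDensity ν h) : NullSingletonClass (realLaw ν) := by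
  refine ⟨fun x => ?_⟩
  rw [realLaw, hd.map_eq]
  exact withDensity_absolutelyContinuous _ _ (by simp)

lemma IsDensity.continuous_cdf (hd : IsDensity ν h) : Continuous (cdf (realLaw ν)) := by
  have := hd.nullSingletonClass
  refine continuous_iff_continuousAt.2 fun x => ?_
  have hmeas : (cdf (realLaw ν)).measure {x} = 0 := by rw [measure_cdf]; exact measure_singleton x
  rw [StieltjesFunction.measure_singleton, ENNReal.ofReal_eq_zero, sub_nonpos] at hmeas
  refine (cdf (realLaw ν)).mono.continuousAt_iff_leftLim_eq_rightLim.2 ?_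
  rw [StieltjesFunction.rightLim_eq]
  exact le_antisymm ((cdf (realLaw ν)).mono.leftLim_le le_rfl) hmeas

lemma cdf_realLaw_neg {y : ℝ} (hy : y < 0) : cdf (realLaw ν) y = 0 := by
  rw [cdf_eq_real, measureReal_def, realLaw, Measure.map_apply (by fun_prop) measurableSet_Iic]
  have : (fun x : ℝ≥0 => (x : ℝ)) ⁻¹' Set.Iic y = ∅ := by
    ext x
    simp only [Set.mem_preimage, Set.mem_Iic, Set.mem_empty_iff_false, iff_false, not_le]
    exact hy.trans_le x.2
  simp [this]

lemma IsDensity.pos_of_cdf_pos (hd : IsDensity ν h) {y : ℝ} (hy : 0 < cdf (realLaw ν) y) :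
    0 < y := by
  by_contra hcon
  rcases (not_lt.1 hcon).eq_or_lt with rfl | hneg
  · rw [hd.cdf_eq le_rfl] at hy; simp [distFun] at hy
  · rw [cdf_realLaw_neg hneg] at hy; exact lt_irrefl _ hy

/-- There is mass on both sides of `y`, so the density is positive somewhere below and somewhere
above; the interval property fills in between. -/
lemma IsDensity.posSet_mem_nhds (hd : IsDensity ν h) (hI : (posSet h).OrdConnected) {y : ℝ}
    (h0 : 0 < cdf (realLaw ν) y) (h1 : cdf (realLaw ν) y < 1) : posSet h ∈ 𝓝 y := by
  have := hd.nullSingletonClass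
  have hb : realLaw ν (Set.Iio y) ≠ 0 := by
    rw [measure_congr (Iio_ae_eq_Iic (μ := realLaw ν)), ← ofReal_cdf]
    simpa using h0
  have ha : realLaw ν (Set.Ioi y) ≠ 0 := by
    rw [← Set.compl_Iic, prob_compl_eq_one_sub measurableSet_Iic, ← ofReal_cdf]
    simp only [ne_eq, tsub_eq_zero_iff_le, not_le]
    rw [← ENNReal.ofReal_one]
    exact (ENNReal.ofReal_lt_ofReal_iff one_pos).2 h1
  obtain ⟨a, hay, haI⟩ := hd.exists_pos_mem measurableSet_Iio hb
  obtain ⟨b, hyb, hbI⟩ := hd.exists_pos_mem measurableSet_Ioi ha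
  exact mem_of_superset (Icc_mem_nhds hay hyb) (hI.out haI hbI)

lemma IsDensity.hasDerivAt_cdf (hd : IsDensity ν h) (hI : (posSet h).OrdConnected)
    (hc : ContinuousOn h (posSet h)) {y : ℝ}
    (h0 : 0 < cdf (realLaw ν) y) (h1 : cdf (realLaw ν) y < 1) :
    HasDerivAt (cdf (realLaw ν)) (h y) y := by
  have hy := hd.pos_of_cdf_pos h0
  have hca : ContinuousAt h y := hc.continuousAt (hd.posSet_mem_nhds hI h0 h1)
  have hder : HasDerivAt (distFun h) (h y) y :=
    intervalIntegral.integral_hasDerivAt_right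
      ((intervalIntegrable_iff_integrableOn_Icc_of_le hy.le).2
        (hd.integrableOn.mono_set Set.Icc_subset_Ici_self))
      hd.measurable.stronglyMeasurable.stronglyMeasurableAtFilter hca
  refine hder.congr_of_eventuallyEq ?_
  filter_upwards [Ioi_mem_nhds hy] with u hu
  exact hd.cdf_eq (le_of_lt hu)

/-- A nearly gamma law is the law of the square of a Lipschitz function of a Gaussian. -/
theorem IsNearlyGamma.exists_lipschitz (hν : IsNearlyGamma ν) :
    ∃ (R : ℝ → ℝ) (L : ℝ) (T : C(ℝ, ℝ≥0)), 0 ≤ L ∧ (∀ s t, |R s - R t| ≤ L * |s - t|) ∧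
      (∀ s, 0 ≤ R s) ∧ (∀ s, (T s : ℝ) = R s ^ 2) ∧ ν = gaussImage T := by
  obtain ⟨h, hd, hI, hc, A, hA, hψ⟩ := hν
  set N := cdf (realLaw ν) with hN
  have hNc : Continuous N := hd.continuous_cdf
  have hNm : Monotone N := monotone_cdf _
  have hex : ∀ s, ∃ y, N y = gaussCDF s := by
    intro s
    obtain ⟨a, ha⟩ := ((tendsto_cdf_atBot (realLaw ν)).eventually_lt_const (gaussCDF_pos s)).exists
    obtain ⟨b, hb⟩ :=
      ((tendsto_cdf_atTop (realLaw ν)).eventually_const_lt (gaussCDF_lt_one s)).exists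
    exact mem_range_of_exists_le_of_exists_ge hNc ⟨a, ha.le⟩ ⟨b, hb.le⟩
  -- `T` is the quantile transform: it sends the Gaussian quantile of each level to a quantile of
  -- `ν` of the same level.
  choose T hT using hex
  have hT0 : ∀ s, 0 < N (T s) := fun s => (hT s).symm ▸ gaussCDF_pos s
  have hT1 : ∀ s, N (T s) < 1 := fun s => (hT s).symm ▸ gaussCDF_lt_one s
  have hTpos : ∀ s, 0 < T s := fun s => hd.pos_of_cdf_pos (hT0 s)
  have hTmono : StrictMono T := by
    intro s s' hs
    have : N (T s) < N (T s') := by rw [hT, hT]; exact strictMono_gaussCDF hs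
    exact hNm.reflect_lt this
  have hder : ∀ y, 0 < N y → N y < 1 → HasDerivAt N (h y) y := fun y h0 h1 =>
    hd.hasDerivAt_cdf hI hc h0 h1
  have hmem : ∀ y, 0 < N y → N y < 1 → y ∈ posSet h := fun y h0 h1 =>
    mem_of_mem_nhds (hd.posSet_mem_nhds hI h0 h1)
  have hstrict : ∀ y y', 0 < N y → N y' < 1 → y < y' → N y < N y' := by
    intro y y' h0 h1 hyy
    have : StrictMonoOn N (Set.Icc y y') := by
      refine strictMonoOn_of_deriv_pos (convex_Icc _ _) hNc.continuousOn fun u hu => ?_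
      rw [interior_Icc] at hu
      have hu0 : 0 < N u := h0.trans_le (hNm hu.1.le)
      have hu1 : N u < 1 := (hNm hu.2.le).trans_lt h1
      rw [(hder u hu0 hu1).deriv]
      exact (hmem u hu0 hu1).2
    exact this ⟨le_rfl, hyy.le⟩ ⟨hyy.le, le_rfl⟩ hyy
  have hlip : ∀ s s', s < s' → √(T s') - √(T s) ≤ A / 2 * (s' - s) := by
    intro s s' hs
    set y := T s
    set y' := T s'
    have hyy : y < y' := hTmono hs
    set Φ : ℝ → ℝ := fun u => invFun gaussCDF (N u) with hΦ
    have hbd : ∀ u ∈ Set.Icc y y', 0 < N u ∧ N u < 1 := fun u hu =>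
      ⟨(hT0 s).trans_le (hNm hu.1), (hNm hu.2).trans_lt (hT1 s')⟩
    have hΦd : ∀ u ∈ Set.Icc y y', HasDerivAt (fun u => Φ u - 2 / A * √u)
        ((gaussDensity (Φ u))⁻¹ * h u - 2 / A * (1 / (2 * √u))) u := by
      intro u hu
      obtain ⟨h0, h1⟩ := hbd u hu
      have hu0 : 0 < u := hd.pos_of_cdf_pos h0
      exact ((hasDerivAt_invFun_gaussCDF h0 h1).comp u (hder u h0 h1)).sub
        ((Real.hasDerivAt_sqrt hu0.ne').const_mul (2 / A))
    -- The inverse transport `Φ` has derivative `h / g(Φ)`, and the nearly gamma bound says that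
    -- this is at least `1 / (A √u)`, the derivative of `(2 / A) √u`. Hence `√T` has slope at most
    -- `A / 2`.
    have hmono : MonotoneOn (fun u => Φ u - 2 / A * √u) (Set.Icc y y') := by
      refine monotoneOn_of_deriv_nonneg (convex_Icc _ _)
        (fun u hu => (hΦd u hu).continuousAt.continuousWithinAt)
        (fun u hu => (hΦd u (interior_subset hu)).differentiableAt.differentiableWithinAt) ?_
      intro u hu
      have hu' := interior_subset hu
      obtain ⟨h0, h1⟩ := hbd u hu'
      have hu0 : 0 < u := hd.pos_of_cdf_pos h0
      rw [(hΦd u hu').deriv]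
      have hpsi := hψ u (hmem u h0 h1)
      rw [psi, ← hd.cdf_eq hu0.le, gaussProfile, if_pos ⟨h0, h1⟩] at hpsi
      change gaussDensity (Φ u) / h u ≤ A * √u at hpsi
      have hg := gaussDensity_pos (Φ u)
      have hh : 0 < h u := (hmem u h0 h1).2
      have hsq : 0 < √u := Real.sqrt_pos.2 hu0
      have h3 : 2 / A * (1 / (2 * √u)) = (A * √u)⁻¹ := by field_simp
      have h4 : (gaussDensity (Φ u))⁻¹ * h u = (gaussDensity (Φ u) / h u)⁻¹ := by
        rw [inv_div]; ring
      rw [h3, h4, sub_nonneg]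
      exact inv_anti₀ (div_pos hg hh) hpsi
    have h5 := hmono ⟨le_rfl, hyy.le⟩ ⟨hyy.le, le_rfl⟩ hyy.le
    have h6 : Φ y = s := by simp only [hΦ, y, hT, invFun_gaussCDF]
    have h7 : Φ y' = s' := by simp only [hΦ, y', hT, invFun_gaussCDF]
    simp only [h6, h7] at h5
    have h8 : 2 / A * (√y' - √y) ≤ s' - s := by linarith
    calc √y' - √y = A / 2 * (2 / A * (√y' - √y)) := by field_simp
      _ ≤ A / 2 * (s' - s) := mul_le_mul_of_nonneg_left h8 (by positivity)
  have hlip' : ∀ s t, |√(T s) - √(T t)| ≤ A / 2 * |s - t| := by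
    intro s t
    rcases lt_trichotomy s t with hst | rfl | hst
    · rw [abs_sub_comm, abs_sub_comm s t, abs_of_pos (sub_pos.2 hst), abs_of_nonneg]
      · exact hlip s t hst
      · exact sub_nonneg.2 (Real.sqrt_le_sqrt (hTmono hst).le)
    · simp
    · rw [abs_of_pos (sub_pos.2 hst), abs_of_nonneg]
      · exact hlip t s hst
      · exact sub_nonneg.2 (Real.sqrt_le_sqrt (hTmono hst).le)
  have hRc : Continuous fun s => √(T s) := by
    refine (LipschitzWith.of_dist_le_mul (K := ⟨A / 2, by positivity⟩) fun s t => ?_).continuous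
    rw [Real.dist_eq, Real.dist_eq]
    exact hlip' s t
  have hTc : Continuous T := by
    have : T = fun s => √(T s) ^ 2 := by
      funext s; rw [Real.sq_sqrt (hTpos s).le]
    rw [this]; exact hRc.pow 2
  have hlaw : realLaw ν = (gaussianReal 0 1).map T := by
    have : IsProbabilityMeasure ((gaussianReal 0 1).map T) :=
      Measure.isProbabilityMeasure_map hTc.measurable.aemeasurable
    refine Measure.eq_of_cdf _ _ ?_
    ext y
    rw [cdf_eq_real ((gaussianReal 0 1).map T), measureReal_def,
      Measure.map_apply hTc.measurable measurableSet_Iic]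
    change N y = _
    -- `T` only takes values at levels strictly between zero and one. At level zero the preimage of
    -- the half-line is empty, and at level one it is the whole line.
    by_cases h0 : 0 < N y
    · by_cases h1 : N y < 1
      · set s := invFun gaussCDF (N y)
        have hs : gaussCDF s = N y := gaussCDF_invFun h0 h1
        have hTs : T s = y := by
          rcases lt_trichotomy (T s) y with hlt | heq | hgt
          · have := hstrict _ _ (hT0 s) h1 hlt
            rw [hT, hs] at this; exact absurd this (lt_irrefl _)
          · exact heq
          · have := hstrict _ _ h0 (hT1 s) hgt
            rw [hT, hs] at this; exact absurd this (lt_irrefl _)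
        have : T ⁻¹' Set.Iic y = Set.Iic s := by
          ext u
          simp only [Set.mem_preimage, Set.mem_Iic]
          conv_lhs => rw [← hTs]
          exact hTmono.le_iff_le
        rw [this, ← measureReal_def, ← cdf_eq_real]
        exact hs.symm
      · have : T ⁻¹' Set.Iic y = Set.univ := by
          ext u
          simp only [Set.mem_preimage, Set.mem_Iic, Set.mem_univ, iff_true]
          by_contra hcon
          exact h1 ((hNm (not_le.1 hcon).le).trans_lt (hT1 u))
        rw [this]
        simpa using le_antisymm (cdf_le_one _ y) (not_lt.1 h1)
    · have : T ⁻¹' Set.Iic y = ∅ := by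
        ext u
        simp only [Set.mem_preimage, Set.mem_Iic, Set.mem_empty_iff_false, iff_false]
        intro hcon
        exact h0 ((hT0 u).trans_le (hNm hcon))
      rw [this]
      simpa using le_antisymm (not_lt.1 h0) (cdf_nonneg _ y)
  refine ⟨fun s => √(T s), A / 2, ⟨fun s => (T s).toNNReal, by fun_prop⟩, by positivity, hlip',
    fun s => Real.sqrt_nonneg _, fun s => ?_, ?_⟩
  · simp [(hTpos s).le]
  · have h1 : ν = (realLaw ν).map Real.toNNReal := by
      rw [realLaw, Measure.map_map (by fun_prop) (by fun_prop)]
      have : Real.toNNReal ∘ (fun x : ℝ≥0 => (x : ℝ)) = id := by funext x; simp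
      rw [this, Measure.map_id]
    conv_lhs => rw [h1, hlaw, Measure.map_map (by fun_prop) hTc.measurable]
    rfl

/-- Absence of an atom at zero is what forbids long paths of small total time. -/
lemma IsNearlyGamma.measure_zero (hν : IsNearlyGamma ν) : ν {0} = 0 := by
  obtain ⟨h, hd, -⟩ := hν
  have := hd.nullSingletonClass
  have h0 : realLaw ν {0} = 0 := measure_singleton 0
  rw [realLaw, Measure.map_apply (by fun_prop) (MeasurableSet.singleton _)] at h0
  convert h0 using 2
  ext x
  simp

end Transport

end FPP

namespace FPP

open scoped BigOperators Topology
open Function Filter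

/-! ### The variance inequality on the infinite product, in terms of influences. -/

section InfiniteProduct

variable {ι : Type*} [DecidableEq ι] {ν : Measure ℝ≥0} [IsProbabilityMeasure ν]

/-- Extension of a finite configuration by `0`. -/
noncomputable def extendZero (s : Finset ι) (x : s → ℝ≥0) (i : ι) : ℝ≥0 :=
  if h : i ∈ s then x ⟨i, h⟩ else 0

lemma continuous_extendZero (s : Finset ι) : Continuous (extendZero s) := by
  refine continuous_pi fun i => ?_
  unfold extendZero
  by_cases h : i ∈ s
  · simp only [h, dite_true]; fun_prop
  · simp only [h, dite_false]; fun_prop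

lemma extendZero_update (s : Finset ι) (x : s → ℝ≥0) (e : s) (y : ℝ≥0) :
    extendZero s (update x e y) = update (extendZero s x) e y := by
  funext i
  by_cases hi : i = e
  · subst hi; simp [extendZero]
  · rw [update_of_ne hi]
    unfold extendZero
    by_cases h : i ∈ s
    · simp only [h, dite_true]
      rw [update_of_ne]
      exact fun h' => hi (congrArg Subtype.val h')
    · simp only [h, dite_false]

lemma extendZero_apply (s : Finset ι) (x : s → ℝ≥0) (e : s) : extendZero s x e = x e := by
  simp [extendZero]

/-- Version of `variance_exp_le` for functions of finitely many coordinates. -/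
theorem variance_exp_infinitePi_le {R : ℝ → ℝ} {L : ℝ} (hL : 0 ≤ L)
    (hR : ∀ s t, |R s - R t| ≤ L * |s - t|)
    (hR0 : ∀ s, 0 ≤ R s) (T : C(ℝ, ℝ≥0)) (hT : ∀ s, (T s : ℝ) = R s ^ 2)
    (hν : ν = gaussImage T)
    {G : (ι → ℝ≥0) → ℝ} {w : (ι → ℝ≥0) → ι → ℝ} {M : ℝ} (hG : Continuous G)
    (hG0 : ∀ x, 0 ≤ G x) (hGM : ∀ x, G x ≤ M) {s : Finset ι} (hs : DependsOn G s)
    (h : UpperGradient G w M) (hsum : ∀ x, ∑ e ∈ s, w x e * x e ≤ G x) {θ : ℝ} (hθ : |θ| ≤ 1)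
    {σ : ℝ} (hσ : 0 < σ) :
    ((∫ x, Real.exp (θ / 2 * G x) ^ 2 ∂(Measure.infinitePi fun _ : ι => ν)) -
      (∫ x, Real.exp (θ / 2 * G x) ∂(Measure.infinitePi fun _ : ι => ν)) ^ 2) * (1 - Real.log σ) -
      σ⁻¹ * ∑ e ∈ s, (∫ x, ∫ y, 2 * |Real.exp (θ / 2 * G (update x e (max y (x e)))) -
        Real.exp (θ / 2 * G x)| ∂ν ∂(Measure.infinitePi fun _ : ι => ν)) ^ 2 ≤
    48 * θ ^ 2 * L ^ 2 *
      ∫ x, G x * Real.exp (θ / 2 * G x) ^ 2 ∂(Measure.infinitePi fun _ : ι => ν) := by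
  set G' : (s → ℝ≥0) → ℝ := fun x => G (extendZero s x) with hG'
  have hG'c : Continuous G' := hG.comp (continuous_extendZero s)
  have hGG : ∀ x : ι → ℝ≥0, G x = G' (s.restrict x) := by
    intro x
    refine hs fun i hi => ?_
    have hi' : i ∈ s := hi
    simp [extendZero, hi']
  have hGu : ∀ (x : ι → ℝ≥0) (e : s) (y : ℝ≥0),
      G (update x e y) = G' (update (s.restrict x) e y) := by
    intro x e y
    rw [hGG]
    congr 1
    funext i
    by_cases hi : i = e
    · subst hi; simp
    · rw [update_of_ne hi, Finset.restrict, Finset.restrict, update_of_ne]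
      exact fun h' => hi (Subtype.ext h')
  have hgrad : UpperGradient G' (fun x e => w (extendZero s x) e) M :=
    { nonneg := fun x e => h.nonneg _ _
      le_one := fun x e => h.le_one _ _
      le_bound := fun x e hw => by
        have := h.le_bound _ _ hw
        rwa [extendZero_apply] at this
      mono := fun x e y hy => by
        simp only [hG', extendZero_update]
        exact h.mono _ _ _ (by rwa [extendZero_apply])
      le_add := fun x e y hy => by
        simp only [hG', extendZero_update]
        have := h.le_add (extendZero s x) e y (by rwa [extendZero_apply])
        rwa [extendZero_apply] at this }
  have hsum' : ∀ x : s → ℝ≥0, ∑ e : s, w (extendZero s x) e * x e ≤ G' x := by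
    intro x
    have := hsum (extendZero s x)
    rw [← Finset.sum_coe_sort] at this
    simpa only [extendZero_apply] using this
  have key := variance_exp_le hL hR hR0 T hT hν hG'c (fun x => hG0 _) (fun x => hGM _) hgrad
    hsum' hθ hσ
  have tr : ∀ Φ : (s → ℝ≥0) → ℝ, StronglyMeasurable Φ →
      ∫ x, Φ (s.restrict x) ∂(Measure.infinitePi fun _ : ι => ν) =
        ∫ x, Φ x ∂(Measure.pi fun _ : s => ν) := by
    intro Φ hΦ
    exact integral_restrict_infinitePi (fun _ : ι => ν) hΦ.aestronglyMeasurable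
  have t1 := tr (fun x => Real.exp (θ / 2 * G' x) ^ 2)
    (Continuous.stronglyMeasurable (by fun_prop))
  have t2 := tr (fun x => Real.exp (θ / 2 * G' x)) (Continuous.stronglyMeasurable (by fun_prop))
  have t4 := tr (fun x => G' x * Real.exp (θ / 2 * G' x) ^ 2)
    (Continuous.stronglyMeasurable (by fun_prop))
  have t3 := fun e : s => tr (fun x => ∫ y, 2 * |Real.exp (θ / 2 * G' (update x e (max y (x e)))) -
        Real.exp (θ / 2 * G' x)| ∂ν) (by
    have hc : Continuous fun p : (s → ℝ≥0) × ℝ≥0 =>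
      2 * |Real.exp (θ / 2 * G' (update p.1 e (max p.2 (p.1 e)))) - Real.exp (θ / 2 * G' p.1)| := by
      fun_prop
    exact hc.stronglyMeasurable.integral_prod_right')
  rw [← t1, ← t2, ← t4] at key
  simp only [← t3] at key
  rw [← Finset.sum_coe_sort]
  simp only [hGu]
  simpa only [hGG, Finset.restrict] using key

/-- Cauchy–Schwarz for the measure of density `w`: the integral of `w * (f - t)²` is a nonnegative
quadratic in `t`, so its discriminant is nonpositive. -/
lemma sq_integral_mul_le {Ω : Type*} [MeasurableSpace Ω] {μ : Measure Ω} {w f : Ω → ℝ}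
    (hw : ∀ x, 0 ≤ w x) (h0 : Integrable w μ) (h1 : Integrable (fun x => w x * f x) μ)
    (h2 : Integrable (fun x => w x * f x ^ 2) μ) :
    (∫ x, w x * f x ∂μ) ^ 2 ≤ (∫ x, w x ∂μ) * ∫ x, w x * f x ^ 2 ∂μ := by
  have h : ∀ t : ℝ, 0 ≤ (∫ x, w x ∂μ) * (t * t) + (-2 * ∫ x, w x * f x ∂μ) * t +
      ∫ x, w x * f x ^ 2 ∂μ := by
    intro t
    have h3 : ∫ x, w x * (f x - t) ^ 2 ∂μ = (∫ x, w x ∂μ) * (t * t) +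
        (-2 * ∫ x, w x * f x ∂μ) * t + ∫ x, w x * f x ^ 2 ∂μ := by
      have : (fun x => w x * (f x - t) ^ 2) =
          fun x => (w x * (t * t) + (-2 * t) * (w x * f x)) + w x * f x ^ 2 := by
        funext x; ring
      rw [this, integral_add (f := fun x => w x * (t * t) + (-2 * t) * (w x * f x))
          ((h0.mul_const _).add (h1.const_mul _)) h2,
        integral_add (h0.mul_const _) (h1.const_mul _), integral_mul_const, integral_const_mul]
      ring
    rw [← h3]
    exact integral_nonneg fun x => mul_nonneg (hw x) (sq_nonneg _)
  have := discrim_le_zero h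
  rw [discrim] at this
  nlinarith

/-- The variance of `exp (θ G / 2)` when the influences of the coordinates are small. -/
theorem variance_exp_le_of_influence {R : ℝ → ℝ} {L : ℝ} (hL : 0 ≤ L)
    (hR : ∀ s t, |R s - R t| ≤ L * |s - t|)
    (hR0 : ∀ s, 0 ≤ R s) (T : C(ℝ, ℝ≥0)) (hT : ∀ s, (T s : ℝ) = R s ^ 2)
    (hν : ν = gaussImage T)
    {G : (ι → ℝ≥0) → ℝ} {w : (ι → ℝ≥0) → ι → ℝ} {M : ℝ} (hG : Continuous G)
    (hG0 : ∀ x, 0 ≤ G x) (hGM : ∀ x, G x ≤ M) {s : Finset ι} (hs : DependsOn G s)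
    (h : UpperGradient G w M) (hsum : ∀ x, ∑ e ∈ s, w x e * x e ≤ G x)
    (hwm : ∀ e, Measurable fun x => w x e) {D η W a : ℝ}
    (hDi : Integrable (fun y : ℝ≥0 => (y : ℝ) * Real.exp (a * y)) ν)
    (hD : ∫ y : ℝ≥0, (y : ℝ) * Real.exp (a * y) ∂ν ≤ D)
    (hη0 : 0 ≤ η) (hη : ∀ e, ∫ x, w x e ∂(Measure.infinitePi fun _ : ι => ν) ≤ η)
    (hW : ∀ x, ∑ e ∈ s, w x e ≤ W) {θ : ℝ} (hθ : |θ| ≤ 1) (hθa : |θ| / 2 ≤ a)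
    {σ : ℝ} (hσ : 0 < σ) :
    ((∫ x, Real.exp (θ / 2 * G x) ^ 2 ∂(Measure.infinitePi fun _ : ι => ν)) -
      (∫ x, Real.exp (θ / 2 * G x) ∂(Measure.infinitePi fun _ : ι => ν)) ^ 2) * (1 - Real.log σ) ≤
    (σ⁻¹ * D ^ 2 * η * W + 48 * L ^ 2 * M) * θ ^ 2 *
      ∫ x, Real.exp (θ / 2 * G x) ^ 2 ∂(Measure.infinitePi fun _ : ι => ν) := by
  set μ := Measure.infinitePi fun _ : ι => ν with hμ
  set f : (ι → ℝ≥0) → ℝ := fun x => Real.exp (θ / 2 * G x) with hf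
  have hGm : Measurable G := by
    have hG'm : Measurable fun x : s → ℝ≥0 => G (extendZero s x) :=
      (hG.comp (continuous_extendZero s)).measurable
    have heq : G = fun x => G (extendZero s (s.restrict x)) := by
      funext x
      refine hs fun i hi => ?_
      have hi' : i ∈ s := hi
      simp [extendZero, hi']
    rw [heq]
    exact hG'm.comp (Finset.measurable_restrict s)
  have hfm : Measurable f := Real.measurable_exp.comp (hGm.const_mul _)
  have hf0 : ∀ x, 0 < f x := fun x => Real.exp_pos _
  have hfb : ∀ x, f x ≤ Real.exp M := by
    intro x
    refine Real.exp_le_exp.2 ?_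
    have := hG0 x
    have := hGM x
    have := (abs_le.1 hθ).2
    nlinarith
  have hM0 : 0 ≤ M := (hG0 0).trans (hGM 0)
  have bdd : ∀ (Φ : (ι → ℝ≥0) → ℝ) (C : ℝ), Measurable Φ → (∀ x, 0 ≤ Φ x) → (∀ x, Φ x ≤ C) →
      Integrable Φ μ := by
    intro Φ C hm h0 hC
    refine Integrable.of_bound hm.aestronglyMeasurable C (ae_of_all _ fun x => ?_)
    rw [Real.norm_of_nonneg (h0 x)]
    exact hC x
  have hf2i : Integrable (fun x => f x ^ 2) μ := bdd _ (Real.exp M ^ 2) (hfm.pow_const 2)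
    (fun x => sq_nonneg _) fun x => pow_le_pow_left₀ (hf0 x).le (hfb x) 2
  have hwi : ∀ e, Integrable (fun x => w x e) μ := fun e =>
    bdd _ 1 (hwm e) (fun x => h.nonneg x e) fun x => h.le_one x e
  have hwfi : ∀ e, Integrable (fun x => w x e * f x) μ := fun e =>
    bdd _ (1 * Real.exp M) ((hwm e).mul hfm) (fun x => mul_nonneg (h.nonneg x e) (hf0 x).le)
      fun x => mul_le_mul (h.le_one x e) (hfb x) (hf0 x).le zero_le_one
  have hwf2i : ∀ e, Integrable (fun x => w x e * f x ^ 2) μ := fun e =>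
    bdd _ (1 * Real.exp M ^ 2) ((hwm e).mul (hfm.pow_const 2))
      (fun x => mul_nonneg (h.nonneg x e) (sq_nonneg _))
      fun x => mul_le_mul (h.le_one x e) (pow_le_pow_left₀ (hf0 x).le (hfb x) 2) (sq_nonneg _)
        zero_le_one
  have hIf : 0 ≤ ∫ x, f x ^ 2 ∂μ := integral_nonneg fun x => sq_nonneg _
  have hD0 : 0 ≤ D := le_trans (integral_nonneg fun y => by positivity) hD
  have key := variance_exp_infinitePi_le hL hR hR0 T hT hν hG hG0 hGM hs h hsum hθ hσ
  rw [← hμ] at key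
  -- The upward jump is at most the resampled value `y`, independent of `x`; its contribution
  -- integrates to `D`, leaving only the weight times `f`.
  have ha : ∀ e, ∫ x, ∫ y, 2 * |Real.exp (θ / 2 * G (update x e (max y (x e)))) -
        Real.exp (θ / 2 * G x)| ∂ν ∂μ ≤ |θ| * D * ∫ x, w x e * f x ∂μ := by
    intro e
    rw [← integral_const_mul]
    refine integral_mono_of_nonneg (ae_of_all _ fun x => integral_nonneg fun y => by positivity)
      ((hwfi e).const_mul _) (ae_of_all _ fun x => ?_)
    have hpt : ∀ y : ℝ≥0, 2 * |Real.exp (θ / 2 * G (update x e (max y (x e)))) -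
        Real.exp (θ / 2 * G x)| ≤ |θ| * (w x e * f x) * ((y : ℝ) * Real.exp (a * y)) := by
      intro y
      have hδ : ((max y (x e) : ℝ≥0) : ℝ) - x e ≤ y := by
        rw [NNReal.coe_max, sub_le_iff_le_add]
        exact max_le (by linarith [(x e).2]) (by linarith [y.2])
      have h1 := h.abs_exp_sub_le θ x e (max y (x e)) (le_max_right _ _) hδ
      have hy : (0 : ℝ) ≤ y := y.2
      have h2 : Real.exp (|θ| / 2 * y) ≤ Real.exp (a * y) := by
        refine Real.exp_le_exp.2 ?_
        exact mul_le_mul_of_nonneg_right hθa hy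
      have hw0 := h.nonneg x e
      calc _ ≤ 2 * (|θ| / 2 * (w x e * y) * Real.exp (|θ| / 2 * y) * Real.exp (θ / 2 * G x)) := by
            gcongr
        _ ≤ 2 * (|θ| / 2 * (w x e * y) * Real.exp (a * y) * Real.exp (θ / 2 * G x)) := by gcongr
        _ = _ := by simp only [hf]; ring
    calc _ ≤ ∫ y : ℝ≥0, |θ| * (w x e * f x) * ((y : ℝ) * Real.exp (a * y)) ∂ν :=
          integral_mono_of_nonneg (ae_of_all _ fun y => by positivity) (hDi.const_mul _)
            (ae_of_all _ hpt)
      _ = |θ| * (w x e * f x) * ∫ y : ℝ≥0, (y : ℝ) * Real.exp (a * y) ∂ν := integral_const_mul _ _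
      _ ≤ |θ| * (w x e * f x) * D := by
          have := mul_nonneg (h.nonneg x e) (hf0 x).le
          gcongr
      _ = _ := by ring
  -- One factor of Cauchy–Schwarz is the small mean weight `η`; the other keeps `f²` with weight `w
  -- x e`, and these weights sum to at most `W`. The bound thus has the form of the energy term, a
  -- constant times `∫ f²`.
  have hasq : ∑ e ∈ s, (∫ x, ∫ y, 2 * |Real.exp (θ / 2 * G (update x e (max y (x e)))) -
        Real.exp (θ / 2 * G x)| ∂ν ∂μ) ^ 2 ≤ θ ^ 2 * D ^ 2 * (η * (W * ∫ x, f x ^ 2 ∂μ)) := by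
    calc _ ≤ ∑ e ∈ s, θ ^ 2 * D ^ 2 * (η * ∫ x, w x e * f x ^ 2 ∂μ) := by
          refine Finset.sum_le_sum fun e _ => ?_
          calc _ ≤ (|θ| * D * ∫ x, w x e * f x ∂μ) ^ 2 := pow_le_pow_left₀
                (integral_nonneg fun x => integral_nonneg fun y => by positivity) (ha e) 2
            _ = θ ^ 2 * D ^ 2 * (∫ x, w x e * f x ∂μ) ^ 2 := by rw [← sq_abs θ]; ring
            _ ≤ θ ^ 2 * D ^ 2 * ((∫ x, w x e ∂μ) * ∫ x, w x e * f x ^ 2 ∂μ) := by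
                gcongr
                exact sq_integral_mul_le (fun x => h.nonneg x e) (hwi e) (hwfi e) (hwf2i e)
            _ ≤ _ := by
                have : 0 ≤ ∫ x, w x e * f x ^ 2 ∂μ :=
                  integral_nonneg fun x => mul_nonneg (h.nonneg x e) (sq_nonneg _)
                gcongr
                exact hη e
      _ = θ ^ 2 * D ^ 2 * (η * ∫ x, (∑ e ∈ s, w x e) * f x ^ 2 ∂μ) := by
          simp only [Finset.sum_mul]
          rw [← Finset.mul_sum, ← Finset.mul_sum, integral_finsetSum _ fun e _ => hwf2i e]
      _ ≤ _ := by
          gcongr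
          rw [← integral_const_mul]
          refine integral_mono_of_nonneg (ae_of_all _ fun x => mul_nonneg
            (Finset.sum_nonneg fun e _ => h.nonneg x e) (sq_nonneg _)) (hf2i.const_mul W)
            (ae_of_all _ fun x => ?_)
          exact mul_le_mul_of_nonneg_right (hW x) (sq_nonneg _)
  have hen : ∫ x, G x * f x ^ 2 ∂μ ≤ M * ∫ x, f x ^ 2 ∂μ := by
    rw [← integral_const_mul]
    exact integral_mono_of_nonneg (ae_of_all _ fun x => mul_nonneg (hG0 x) (sq_nonneg _))
      (hf2i.const_mul M) (ae_of_all _ fun x => mul_le_mul_of_nonneg_right (hGM x) (sq_nonneg _))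
  have h1 := mul_le_mul_of_nonneg_left hasq (inv_pos.2 hσ).le
  have h2 := mul_le_mul_of_nonneg_left hen (by positivity : 0 ≤ 48 * θ ^ 2 * L ^ 2)
  change _ ≤ _ * ∫ x, f x ^ 2 ∂μ
  calc _ ≤ _ := sub_le_iff_le_add.1 key
    _ ≤ _ := add_le_add h2 h1
    _ = _ := by ring

end InfiniteProduct

/-! ### From variance bounds of exponentials to the Laplace transform. -/

section Laplace

variable {Ω : Type*} [MeasurableSpace Ω] {μ : Measure Ω} [IsProbabilityMeasure μ]

/-- A bound of the variance of the exponentials of `X` gives Gaussian bounds of its Laplace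
transform on a neighbourhood of `0`. -/
theorem integral_exp_le_of_variance_le {X : Ω → ℝ} (hX : Measurable X) {B : ℝ}
    (hb : ∀ ω, |X ω| ≤ B) (hmean : ∫ ω, X ω ∂μ = 0) {K θ₁ : ℝ} (hK : 0 ≤ K)
    (hvar : ∀ θ : ℝ, |θ| ≤ θ₁ → (∫ ω, Real.exp (θ * X ω) ∂μ) -
      (∫ ω, Real.exp (θ / 2 * X ω) ∂μ) ^ 2 ≤ K * θ ^ 2 * ∫ ω, Real.exp (θ * X ω) ∂μ)
    {θ : ℝ} (hθ : |θ| ≤ θ₁) (hKθ : K * θ ^ 2 ≤ 1 / 2) :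
    ∫ ω, Real.exp (θ * X ω) ∂μ ≤ Real.exp (4 * K * θ ^ 2) := by
  have hXi : Integrable X μ := Integrable.of_bound hX.aestronglyMeasurable B (ae_of_all _ hb)
  have hei : ∀ t : ℝ, Integrable (fun ω => Real.exp (t * X ω)) μ := by
    intro t
    refine Integrable.of_bound (by fun_prop) (Real.exp (|t| * B)) (ae_of_all _ fun ω => ?_)
    rw [Real.norm_of_nonneg (Real.exp_pos _).le]
    refine Real.exp_le_exp.2 ((le_abs_self _).trans ?_)
    rw [abs_mul]
    exact mul_le_mul_of_nonneg_left (hb ω) (abs_nonneg t)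
  -- Halving `θ` gives `φ(θ) (1 - K θ²) ≤ φ(θ/2)²`. The coefficient `4 K` is the fixed point of this
  -- recursion (`4 K / 2 + 2 K`), and the error from the second order expansion at the smallest
  -- scale is halved each time. The crude bound `B` therefore vanishes in the limit.
  have key : ∀ n : ℕ, ∀ θ : ℝ, |θ| ≤ θ₁ → K * θ ^ 2 ≤ 1 / 2 → |θ| * B ≤ 2 ^ n →
      ∫ ω, Real.exp (θ * X ω) ∂μ ≤ Real.exp ((4 * K + B ^ 2 / 2 ^ n) * θ ^ 2) := by
    intro n
    induction n with
    | zero =>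
      intro θ _ _ hn
      rw [pow_zero] at hn
      have hpt : ∀ ω, Real.exp (θ * X ω) ≤ 1 + θ * X ω + θ ^ 2 * B ^ 2 := by
        intro ω
        have h1 : |θ * X ω| ≤ 1 := by
          rw [abs_mul]
          exact (mul_le_mul_of_nonneg_left (hb ω) (abs_nonneg _)).trans hn
        have h2 := (le_abs_self _).trans (Real.abs_exp_sub_one_sub_id_le h1)
        have h3 : X ω ^ 2 ≤ B ^ 2 := sq_le_sq' (abs_le.1 (hb ω)).1 (abs_le.1 (hb ω)).2
        nlinarith [sq_nonneg θ]
      calc ∫ ω, Real.exp (θ * X ω) ∂μ ≤ ∫ ω, (1 + θ * X ω + θ ^ 2 * B ^ 2) ∂μ :=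
            integral_mono (hei θ) (by fun_prop) hpt
        _ = 1 + θ ^ 2 * B ^ 2 := by
            rw [integral_add (by fun_prop) (by fun_prop), integral_add (by fun_prop) (by fun_prop),
              integral_const_mul, hmean]
            simp
        _ ≤ Real.exp (θ ^ 2 * B ^ 2) := by linarith [Real.add_one_le_exp (θ ^ 2 * B ^ 2)]
        _ ≤ _ := Real.exp_le_exp.2 (by nlinarith [mul_nonneg hK (sq_nonneg θ)])
    | succ n ih =>
      intro θ h1 h2 h3
      have hhalf : |θ / 2| = |θ| / 2 := by rw [abs_div, abs_two]
      have h4 := ih (θ / 2) (by rw [hhalf]; linarith [abs_nonneg θ])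
        (by nlinarith [mul_nonneg hK (sq_nonneg θ)]) (by rw [hhalf, pow_succ] at *; linarith)
      have h5 := hvar θ h1
      set φ := ∫ ω, Real.exp (θ * X ω) ∂μ
      have hφ0 : 0 ≤ φ := integral_nonneg fun ω => (Real.exp_pos _).le
      set u := K * θ ^ 2 with hu
      have hu0 : 0 ≤ u := mul_nonneg hK (sq_nonneg θ)
      have h6 : φ * (1 - u) ≤ Real.exp ((4 * K + B ^ 2 / 2 ^ n) * (θ / 2) ^ 2) ^ 2 := by
        have : (∫ ω, Real.exp (θ / 2 * X ω) ∂μ) ^ 2 ≤ _ :=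
          pow_le_pow_left₀ (integral_nonneg fun ω => (Real.exp_pos _).le) h4 2
        linarith
      -- This is `1 / (1 - u) ≤ exp (2 u)` on `[0, 1/2]`; it is where `K * θ ^ 2 ≤ 1 / 2` enters.
      have h7 : 1 ≤ Real.exp (2 * u) * (1 - u) := by
        have := Real.add_one_le_exp (2 * u)
        nlinarith
      calc φ = φ * 1 := (mul_one _).symm
        _ ≤ φ * (Real.exp (2 * u) * (1 - u)) := mul_le_mul_of_nonneg_left h7 hφ0
        _ = Real.exp (2 * u) * (φ * (1 - u)) := by ring
        _ ≤ Real.exp (2 * u) * Real.exp ((4 * K + B ^ 2 / 2 ^ n) * (θ / 2) ^ 2) ^ 2 :=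
            mul_le_mul_of_nonneg_left h6 (Real.exp_pos _).le
        _ = _ := by
            rw [← Real.exp_nat_mul, ← Real.exp_add]
            congr 1
            rw [hu, pow_succ]
            push_cast
            field_simp
            ring
  have hlim : Tendsto (fun n : ℕ => Real.exp ((4 * K + B ^ 2 / 2 ^ n) * θ ^ 2)) atTop
      (𝓝 (Real.exp (4 * K * θ ^ 2))) := by
    refine (Real.continuous_exp.tendsto _).comp ?_
    have : Tendsto (fun n : ℕ => B ^ 2 / (2 : ℝ) ^ n) atTop (𝓝 0) :=
      tendsto_const_nhds.div_atTop (tendsto_pow_atTop_atTop_of_one_lt one_lt_two)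
    simpa using (this.const_add (4 * K)).mul_const (θ ^ 2)
  refine ge_of_tendsto hlim ?_
  have hev : ∀ᶠ n : ℕ in atTop, |θ| * B ≤ 2 ^ n :=
    (tendsto_pow_atTop_atTop_of_one_lt one_lt_two).eventually_ge_atTop _
  filter_upwards [hev] with n hn
  exact key n θ hθ hKθ hn

end Laplace

end FPP

namespace FPP

open scoped BigOperators Topology
open Function Filter

/-! ### Minimal times over finite families of edge sets, and their weights. -/

section PathSystem

variable {ι : Type*} [DecidableEq ι]

/-- The total time of a finite set of edges. -/
def setTime (p : Finset ι) (x : ι → ℝ≥0) : ℝ := ∑ e ∈ p, (x e : ℝ)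

/-- The minimal time of the sets of a finite family, capped at `c`. -/
def capMin (P : Finset (Finset ι)) (c : ℝ) (x : ι → ℝ≥0) : ℝ := P.fold min c fun p => setTime p x

/-- The sets of the family that realize the capped minimal time. -/
noncomputable def minimizers (P : Finset (Finset ι)) (c : ℝ) (x : ι → ℝ≥0) :
    Finset (Finset ι) :=
  open Classical in P.filter fun p => setTime p x ≤ capMin P c x

/-- The proportion of the minimizers that contain `e`. -/
noncomputable def minWeight (P : Finset (Finset ι)) (c : ℝ) (x : ι → ℝ≥0) (e : ι) : ℝ :=
  ((minimizers P c x).filter fun p => e ∈ p).card / (minimizers P c x).card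

variable {P : Finset (Finset ι)} {c : ℝ}

lemma setTime_nonneg (p : Finset ι) (x : ι → ℝ≥0) : 0 ≤ setTime p x :=
  Finset.sum_nonneg fun e _ => (x e).2

lemma continuous_setTime (p : Finset ι) : Continuous (setTime p) := by
  unfold setTime; fun_prop

lemma measurable_setTime (p : Finset ι) : Measurable (setTime p) := by
  unfold setTime; fun_prop

lemma setTime_update (p : Finset ι) (x : ι → ℝ≥0) (e : ι) (y : ℝ≥0) :
    setTime p (update x e y) = setTime p x + if e ∈ p then (y : ℝ) - x e else 0 := by
  unfold setTime
  split_ifs with he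
  · rw [← Finset.add_sum_erase _ _ he, ← Finset.add_sum_erase p (fun e => (x e : ℝ)) he,
      update_self, Finset.sum_congr rfl fun i hi => by rw [update_of_ne (Finset.ne_of_mem_erase hi)]]
    ring
  · rw [add_zero]
    exact Finset.sum_congr rfl fun i hi => by
      rw [update_of_ne (ne_of_mem_of_not_mem hi he)]

lemma le_capMin_iff {x : ι → ℝ≥0} {a : ℝ} :
    a ≤ capMin P c x ↔ a ≤ c ∧ ∀ p ∈ P, a ≤ setTime p x := Finset.le_fold_min a

lemma capMin_le_cap (x : ι → ℝ≥0) : capMin P c x ≤ c := (le_capMin_iff.1 le_rfl).1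

lemma capMin_le {p : Finset ι} (hp : p ∈ P) (x : ι → ℝ≥0) : capMin P c x ≤ setTime p x :=
  (le_capMin_iff.1 le_rfl).2 p hp

lemma capMin_nonneg (hc : 0 ≤ c) (x : ι → ℝ≥0) : 0 ≤ capMin P c x :=
  le_capMin_iff.2 ⟨hc, fun p _ => setTime_nonneg p x⟩

lemma continuous_capMin (P : Finset (Finset ι)) (c : ℝ) : Continuous (capMin P c) := by
  induction P using Finset.induction_on with
  | empty => exact continuous_const
  | insert p P hp ih =>
    have : capMin (insert p P) c = fun x => min (setTime p x) (capMin P c x) := by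
      funext x; simp only [capMin, Finset.fold_insert hp]
    rw [this]
    exact (continuous_setTime p).min ih

lemma measurable_capMin (P : Finset (Finset ι)) (c : ℝ) : Measurable (capMin P c) := by
  induction P using Finset.induction_on with
  | empty => exact measurable_const
  | insert p P hp ih =>
    have : capMin (insert p P) c = fun x => min (setTime p x) (capMin P c x) := by
      funext x; simp only [capMin, Finset.fold_insert hp]
    rw [this]
    exact (measurable_setTime p).min ih

lemma dependsOn_capMin (P : Finset (Finset ι)) (c : ℝ) :
    DependsOn (capMin P c) (P.biUnion id : Finset ι) := by
  intro x y hxy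
  refine Finset.fold_congr fun p hp => Finset.sum_congr rfl fun e he => ?_
  rw [hxy e (Finset.mem_coe.2 (Finset.mem_biUnion.2 ⟨p, hp, he⟩))]

lemma mem_minimizers {p : Finset ι} {x : ι → ℝ≥0} :
    p ∈ minimizers P c x ↔ p ∈ P ∧ setTime p x ≤ capMin P c x := by
  simp [minimizers]

lemma setTime_eq_of_mem_minimizers {p : Finset ι} {x : ι → ℝ≥0} (hp : p ∈ minimizers P c x) :
    setTime p x = capMin P c x :=
  le_antisymm (mem_minimizers.1 hp).2 (capMin_le (mem_minimizers.1 hp).1 x)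

lemma capMin_eq_cap_of_minimizers_eq_empty {x : ι → ℝ≥0} (h : minimizers P c x = ∅) :
    capMin P c x = c := by
  have hP : ∀ p ∈ P, capMin P c x < setTime p x := fun p hp => by
    by_contra hcon
    have : p ∈ minimizers P c x := mem_minimizers.2 ⟨hp, not_lt.1 hcon⟩
    simp [h] at this
  rcases (Finset.fold_min_le (b := c) (f := fun p => setTime p x) (s := P) (capMin P c x)).1 le_rfl
    with hc | ⟨p, hp, hle⟩
  · exact le_antisymm (capMin_le_cap x) hc
  · exact absurd hle (not_le.2 (hP p hp))

lemma measurable_minWeight (P : Finset (Finset ι)) (c : ℝ) (e : ι) :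
    Measurable fun x => minWeight P c x e := by
  classical
  have hset : ∀ p, MeasurableSet {x : ι → ℝ≥0 | setTime p x ≤ capMin P c x} := fun p =>
    measurableSet_le (measurable_setTime p) (measurable_capMin P c)
  have h1 : ∀ x, ((minimizers P c x).card : ℝ) =
      ∑ p ∈ P, if setTime p x ≤ capMin P c x then (1 : ℝ) else 0 := by
    intro x
    rw [minimizers, Finset.card_filter]
    push_cast
    refine Finset.sum_congr rfl fun p _ => ?_
    split_ifs <;> rfl
  have h2 : ∀ x, (((minimizers P c x).filter fun p => e ∈ p).card : ℝ) =
      ∑ p ∈ P.filter (fun p => e ∈ p), if setTime p x ≤ capMin P c x then (1 : ℝ) else 0 := by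
    intro x
    have : (minimizers P c x).filter (fun p => e ∈ p) =
        (P.filter fun p => e ∈ p).filter fun p => setTime p x ≤ capMin P c x := by
      ext p
      simp only [Finset.mem_filter, mem_minimizers]
      tauto
    rw [this, Finset.card_filter]
    push_cast
    rfl
  simp only [minWeight, h1, h2]
  exact (Finset.measurable_fun_sum _ fun p _ => Measurable.ite (hset p) measurable_const
    measurable_const).div (Finset.measurable_fun_sum _ fun p _ => Measurable.ite (hset p)
      measurable_const measurable_const)

/-- Double counting of pairs (index, minimizer): the sum of the weights is the average, over the
minimizers, of the number of listed edges they contain. -/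
lemma sum_minWeight_le {κ : Type*} (Z : Finset κ) (u : κ → ι) (x : ι → ℝ≥0) {b : ℝ} (hb : 0 ≤ b)
    (h : ∀ p ∈ minimizers P c x, ((Z.filter fun z => u z ∈ p).card : ℝ) ≤ b) :
    ∑ z ∈ Z, minWeight P c x (u z) ≤ b := by
  simp only [minWeight]
  rw [← Finset.sum_div]
  refine div_le_of_le_mul₀ (Nat.cast_nonneg _) hb ?_
  calc ∑ z ∈ Z, (((minimizers P c x).filter fun p => u z ∈ p).card : ℝ)
      = ∑ p ∈ minimizers P c x, ((Z.filter fun z => u z ∈ p).card : ℝ) := by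
        have := Finset.sum_card_bipartiteAbove_eq_sum_card_bipartiteBelow
          (s := Z) (t := minimizers P c x) (fun z p => u z ∈ p)
        exact_mod_cast this
    _ ≤ ∑ _p ∈ minimizers P c x, b := Finset.sum_le_sum h
    _ = b * (minimizers P c x).card := by rw [Finset.sum_const, nsmul_eq_mul, mul_comm]

lemma sum_minWeight_mul_le (hc : 0 ≤ c) (s : Finset ι) (x : ι → ℝ≥0) :
    ∑ e ∈ s, minWeight P c x e * x e ≤ capMin P c x := by
  simp only [minWeight, div_mul_eq_mul_div]
  rw [← Finset.sum_div]
  refine div_le_of_le_mul₀ (Nat.cast_nonneg _) (capMin_nonneg hc x) ?_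
  calc ∑ e ∈ s, (((minimizers P c x).filter fun p => e ∈ p).card : ℝ) * x e
      = ∑ e ∈ s, ∑ p ∈ minimizers P c x, if e ∈ p then (x e : ℝ) else 0 := by
        refine Finset.sum_congr rfl fun e _ => ?_
        rw [Finset.card_filter]
        push_cast
        rw [Finset.sum_mul]
        refine Finset.sum_congr rfl fun p _ => ?_
        split_ifs <;> simp
    _ = ∑ p ∈ minimizers P c x, ∑ e ∈ s, if e ∈ p then (x e : ℝ) else 0 := Finset.sum_comm
    _ ≤ ∑ p ∈ minimizers P c x, capMin P c x := by
        refine Finset.sum_le_sum fun p hp => ?_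
        rw [← setTime_eq_of_mem_minimizers hp, ← Finset.sum_filter, setTime]
        refine Finset.sum_le_sum_of_subset_of_nonneg (fun e he => (Finset.mem_filter.1 he).2)
          fun e _ _ => (x e).2
    _ = capMin P c x * (minimizers P c x).card := by
        rw [Finset.sum_const, nsmul_eq_mul, mul_comm]

/-- After raising `x e`, the minimum is at most the new time of every former minimizer; averaging
over the minimizers produces the proportion containing `e`, without a choice of geodesic. If there
is no minimizer the weight is `0 / 0 = 0`, and the cap gives the bound. -/
lemma upperGradient_capMin (P : Finset (Finset ι)) (c : ℝ) :
    UpperGradient (capMin P c) (minWeight P c) c where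
  nonneg x e := by unfold minWeight; positivity
  le_one x e := by
    unfold minWeight
    exact div_le_one_of_le₀ (by exact_mod_cast Finset.card_filter_le _ _) (Nat.cast_nonneg _)
  le_bound x e hw := by
    have : ((minimizers P c x).filter fun p => e ∈ p).Nonempty := by
      rw [Finset.nonempty_iff_ne_empty]
      intro h
      exact hw (by simp [minWeight, h])
    obtain ⟨p, hp⟩ := this
    obtain ⟨hp, he⟩ := Finset.mem_filter.1 hp
    calc (x e : ℝ) ≤ setTime p x :=
          Finset.single_le_sum (f := fun e => (x e : ℝ)) (fun i _ => (x i).2) he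
      _ ≤ capMin P c x := (mem_minimizers.1 hp).2
      _ ≤ c := capMin_le_cap x
  mono x e y hy := by
    refine le_capMin_iff.2 ⟨capMin_le_cap x, fun p hp => (capMin_le hp x).trans ?_⟩
    rw [setTime_update]
    have : (x e : ℝ) ≤ y := by exact_mod_cast hy
    split_ifs <;> linarith
  le_add x e y hy := by
    rcases (minimizers P c x).eq_empty_or_nonempty with h | h
    · rw [capMin_eq_cap_of_minimizers_eq_empty h]
      simp only [minWeight, h, Finset.filter_empty, Finset.card_empty, Nat.cast_zero, div_zero,
        zero_mul, add_zero]
      exact capMin_le_cap _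
    have hn : (0 : ℝ) < (minimizers P c x).card := by exact_mod_cast h.card_pos
    have hsum : ∑ _p ∈ minimizers P c x, capMin P c (update x e y) ≤
        ∑ p ∈ minimizers P c x, (capMin P c x + if e ∈ p then (y : ℝ) - x e else 0) := by
      refine Finset.sum_le_sum fun p hp => ?_
      rw [← setTime_eq_of_mem_minimizers hp, ← setTime_update]
      exact capMin_le (mem_minimizers.1 hp).1 _
    rw [Finset.sum_const, Finset.sum_add_distrib, Finset.sum_const, nsmul_eq_mul, nsmul_eq_mul,
      ← Finset.sum_filter, Finset.sum_const, nsmul_eq_mul] at hsum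
    rw [minWeight, ← sub_nonneg]
    rw [← sub_nonneg] at hsum
    have h2 : 0 ≤ ((minimizers P c x).card * capMin P c x +
        ((minimizers P c x).filter fun p => e ∈ p).card * ((y : ℝ) - x e) -
        (minimizers P c x).card * capMin P c (update x e y)) / (minimizers P c x).card :=
      div_nonneg hsum hn.le
    convert h2 using 1
    field_simp

lemma UpperGradient.comp_perm {G : (ι → ℝ≥0) → ℝ} {w : (ι → ℝ≥0) → ι → ℝ} {M : ℝ}
    (h : UpperGradient G w M) (σ : Equiv.Perm ι) :
    UpperGradient (fun x => G (x ∘ σ)) (fun x e => w (x ∘ σ) (σ.symm e)) M where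
  nonneg x e := h.nonneg _ _
  le_one x e := h.le_one _ _
  le_bound x e hw := by simpa using h.le_bound _ _ hw
  mono x e y hy := by
    rw [update_comp_equiv]
    exact h.mono _ _ _ (by simpa using hy)
  le_add x e y hy := by
    rw [update_comp_equiv]
    simpa using h.le_add (x ∘ σ) (σ.symm e) y (by simpa using hy)

/-- Averaging spreads the weight of an edge over its images; this is how smoothing lowers the
influences. -/
lemma UpperGradient.expect {κ : Type*} [Fintype κ] [Nonempty κ] {G : κ → (ι → ℝ≥0) → ℝ}
    {w : κ → (ι → ℝ≥0) → ι → ℝ} {M : ℝ} (h : ∀ z, UpperGradient (G z) (w z) M) :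
    UpperGradient (fun x => 𝔼 z, G z x) (fun x e => 𝔼 z, w z x e) M where
  nonneg x e := Finset.expect_nonneg fun z _ => (h z).nonneg x e
  le_one x e := by
    refine (Finset.expect_le_expect fun z _ => (h z).le_one x e).trans ?_
    simp
  le_bound x e hw := by
    obtain ⟨z, -, hz⟩ := Finset.exists_ne_zero_of_expect_ne_zero hw
    exact (h z).le_bound x e hz
  mono x e y hy := Finset.expect_le_expect fun z _ => (h z).mono x e y hy
  le_add x e y hy := by
    rw [Finset.expect_mul, ← Finset.expect_add_distrib]
    exact Finset.expect_le_expect fun z _ => (h z).le_add x e y hy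

variable {ν : Measure ℝ≥0} [IsProbabilityMeasure ν]

lemma measurePreserving_comp_perm (σ : Equiv.Perm ι) :
    MeasurePreserving (fun x : ι → ℝ≥0 => x ∘ σ) (Measure.infinitePi fun _ : ι => ν)
      (Measure.infinitePi fun _ : ι => ν) := by
  refine ⟨by fun_prop, ?_⟩
  have := Measure.infinitePi_map_piCongrLeft (fun _ : ι => ν) σ.symm
  convert this using 2
  funext x
  ext i
  have h := Equiv.piCongrLeft_apply_apply (fun _ : ι => ℝ≥0) σ.symm x (σ i)
  rw [Equiv.symm_apply_apply] at h
  rw [MeasurableEquiv.coe_piCongrLeft, h]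
  rfl

/-- Variance bound for the average of a capped minimum over a finite family of permutations of the
edges. -/
theorem variance_exp_expect_capMin_le {R : ℝ → ℝ} {L : ℝ} (hL : 0 ≤ L)
    (hR : ∀ s t, |R s - R t| ≤ L * |s - t|)
    (hR0 : ∀ s, 0 ≤ R s) (T : C(ℝ, ℝ≥0)) (hT : ∀ s, (T s : ℝ) = R s ^ 2)
    (hν : ν = gaussImage T) (P : Finset (Finset ι)) {c : ℝ} (hc : 0 ≤ c)
    {κ : Type*} [Fintype κ] [Nonempty κ] (τ : κ → Equiv.Perm ι) {D b W a : ℝ}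
    (hDi : Integrable (fun y : ℝ≥0 => (y : ℝ) * Real.exp (a * y)) ν)
    (hD : ∫ y : ℝ≥0, (y : ℝ) * Real.exp (a * y) ∂ν ≤ D)
    (hb0 : 0 ≤ b) (hb : ∀ e, ∫ x, ∑ z, minWeight P c x ((τ z).symm e)
      ∂(Measure.infinitePi fun _ : ι => ν) ≤ b)
    (hW0 : 0 ≤ W) (hW : ∀ p ∈ P, (p.card : ℝ) ≤ W) {θ : ℝ} (hθ : |θ| ≤ 1) (hθa : |θ| / 2 ≤ a)
    {σ : ℝ} (hσ : 0 < σ) :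
    ((∫ x, Real.exp (θ / 2 * 𝔼 z, capMin P c (x ∘ τ z)) ^ 2
        ∂(Measure.infinitePi fun _ : ι => ν)) -
      (∫ x, Real.exp (θ / 2 * 𝔼 z, capMin P c (x ∘ τ z))
        ∂(Measure.infinitePi fun _ : ι => ν)) ^ 2) * (1 - Real.log σ) ≤
    (σ⁻¹ * D ^ 2 * (b / Fintype.card κ) * W + 48 * L ^ 2 * c) * θ ^ 2 *
      ∫ x, Real.exp (θ / 2 * 𝔼 z, capMin P c (x ∘ τ z)) ^ 2
        ∂(Measure.infinitePi fun _ : ι => ν) := by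
  set s : Finset ι := Finset.univ.biUnion fun z => (P.biUnion id).map (τ z).toEmbedding
  have hgrad := UpperGradient.expect fun z => (upperGradient_capMin P c).comp_perm (τ z)
  have hreindex : ∀ (z : κ) (F : ι → ℝ), ∑ e ∈ s, F ((τ z).symm e) =
      ∑ e ∈ s.map (τ z).symm.toEmbedding, F e := fun z F => by simp
  refine variance_exp_le_of_influence hL hR hR0 T hT hν (M := c) (s := s)
    (w := fun x e => 𝔼 z, minWeight P c (x ∘ τ z) ((τ z).symm e)) ?_ ?_ ?_ ?_ hgrad ?_ ?_ hDi hD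
    (by positivity) ?_ ?_ hθ hθa hσ
  · simp only [Fintype.expect_eq_sum_div_card]
    refine Continuous.div_const (continuous_finsetSum _ fun z _ =>
      (continuous_capMin P c).comp ?_) _
    exact continuous_pi fun i => continuous_apply _
  · exact fun x => Finset.expect_nonneg fun z _ => capMin_nonneg hc _
  · intro x
    refine (Finset.expect_le_expect fun z _ => capMin_le_cap _).trans ?_
    simp
  · intro x y hxy
    refine Finset.expect_congr rfl fun z _ => dependsOn_capMin P c fun e he => hxy _ ?_
    exact Finset.mem_coe.2 (Finset.mem_biUnion.2 ⟨z, Finset.mem_univ z,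
      Finset.mem_map_of_mem (τ z).toEmbedding he⟩)
  · intro x
    simp only [Finset.expect_mul]
    rw [← Finset.expect_sum_comm]
    refine Finset.expect_le_expect fun z _ => ?_
    have := hreindex z fun e => minWeight P c (x ∘ τ z) e * (x ∘ τ z) e
    simp only [comp_apply, Equiv.apply_symm_apply] at this
    rw [this]
    exact sum_minWeight_mul_le hc _ _
  · intro e
    simp only [Fintype.expect_eq_sum_div_card]
    refine (Finset.measurable_fun_sum _ fun z _ => ?_).div_const _
    exact (measurable_minWeight P c ((τ z).symm e)).comp (by fun_prop)
  · intro e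
    simp only [Fintype.expect_eq_sum_div_card]
    rw [integral_div]
    refine div_le_div_of_nonneg_right (le_trans (le_of_eq ?_) (hb e)) (Nat.cast_nonneg _)
    have hexpi : ∀ e, Integrable (fun x => minWeight P c x e)
        (Measure.infinitePi fun _ : ι => ν) := fun e =>
      Integrable.of_bound (measurable_minWeight P c e).aestronglyMeasurable 1
        (ae_of_all _ fun x => by
          rw [Real.norm_of_nonneg ((upperGradient_capMin P c).nonneg x e)]
          exact (upperGradient_capMin P c).le_one x e)
    have hexpi' : ∀ z, Integrable (fun x => minWeight P c (x ∘ τ z) ((τ z).symm e))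
        (Measure.infinitePi fun _ : ι => ν) := fun z =>
      (measurePreserving_comp_perm (τ z)).integrable_comp_of_integrable (hexpi _)
    rw [integral_finsetSum _ fun z _ => hexpi _, integral_finsetSum _ fun z _ => hexpi' z]
    refine Finset.sum_congr rfl fun z _ => ?_
    -- The product law is invariant under permutations of the edges, so the mean weight of `e` is
    -- the average of the mean weights of its preimages under the `τ z`, computed for the unpermuted
    -- minimum.
    have h1 := (measurePreserving_comp_perm (ν := ν) (τ z)).map_eq
    conv_rhs => rw [← h1]
    rw [integral_map (measurePreserving_comp_perm (ν := ν) (τ z)).measurable.aemeasurable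
      (measurable_minWeight P c _).aestronglyMeasurable]
  · intro x
    rw [← Finset.expect_sum_comm]
    refine (Finset.expect_le_expect fun z _ => ?_).trans (Fintype.expect_const W).le
    rw [hreindex z fun e => minWeight P c (x ∘ τ z) e]
    refine sum_minWeight_le _ id _ hW0 fun p hp => (Nat.cast_le.2 ?_).trans
      (hW p (mem_minimizers.1 hp).1)
    exact Finset.card_le_card fun e he => (Finset.mem_filter.1 he).2

end PathSystem

end FPP

namespace FPP

open scoped BigOperators Topology
open Function Filter

/-! ### Cutting a walk at its visits to a set. -/

section WalkSegments

variable {V : Type*} {G : SimpleGraph V}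

/-- The cut is at the first visit: no vertex before `a` satisfies `Q`, so the remaining walk keeps
all the visits. -/
lemma exists_append_first (Q : V → Bool) {u v : V} (p : G.Walk u v) (h : ∃ a ∈ p.support, Q a) :
    ∃ a, Q a ∧ ∃ (q : G.Walk u a) (r : G.Walk a v), p = q.append r ∧
      r.support.countP Q = p.support.countP Q := by
  induction p with
  | nil =>
    obtain ⟨a, ha, hQ⟩ := h
    rw [SimpleGraph.Walk.support_nil, List.mem_singleton] at ha
    subst ha
    exact ⟨a, hQ, .nil, .nil, rfl, rfl⟩
  | @cons u b v hadj p ih =>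
    by_cases hu : Q u
    · exact ⟨u, hu, .nil, .cons hadj p, rfl, rfl⟩
    · obtain ⟨a, ha, hQ⟩ := h
      rw [SimpleGraph.Walk.support_cons, List.mem_cons] at ha
      have ha' : a ∈ p.support := ha.resolve_left fun h => hu (h ▸ hQ)
      obtain ⟨a', hQ', q, r, hp, hc⟩ := ih ⟨a, ha', hQ⟩
      refine ⟨a', hQ', .cons hadj q, r, by rw [hp]; rfl, ?_⟩
      rw [hc, SimpleGraph.Walk.support_cons, List.countP_cons_of_neg (by simpa using hu)]

/-- The segment of a walk between its first and its last visit to a set. -/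
lemma exists_segment (Q : V → Bool) {u v : V} (p : G.Walk u v) (h : ∃ a ∈ p.support, Q a) :
    ∃ a b, Q a ∧ Q b ∧ ∃ (q : G.Walk u a) (β : G.Walk a b) (r : G.Walk b v),
      p = q.append (β.append r) ∧ p.support.countP Q ≤ β.length + 1 := by
  obtain ⟨a, hQa, q, p', hp, hc⟩ := exists_append_first Q p h
  -- The last visit is the first visit of the reversed walk.
  obtain ⟨b, hQb, r, s, hr, hc'⟩ := exists_append_first Q p'.reverse
    ⟨a, by simp, hQa⟩
  refine ⟨a, b, hQa, hQb, q, s.reverse, r.reverse, ?_, ?_⟩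
  · rw [hp, ← SimpleGraph.Walk.reverse_append, ← hr, SimpleGraph.Walk.reverse_reverse]
  · rw [← hc]
    have h1 : p'.support.countP Q = s.support.countP Q := by
      rw [hc', SimpleGraph.Walk.support_reverse, List.countP_reverse]
    rw [h1, SimpleGraph.Walk.length_reverse, ← SimpleGraph.Walk.length_support]
    exact List.countP_le_length

end WalkSegments

/-! ### Lattice paths, their enumeration, detours and translations. -/

section Lattice

variable {d : ℕ}

open Classical in
/-- The edges of a walk, in order. -/
noncomputable def edgeList {u v : Fin d → ℤ} (α : (lattice d).Walk u v) : List (Edge d) :=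
  α.darts.map fun a => ⟨a.edge, a.edge_mem⟩

open Classical in
/-- The set of edges of a walk. -/
noncomputable def edgeFin {u v : Fin d → ℤ} (α : (lattice d).Walk u v) : Finset (Edge d) :=
  (edgeList α).toFinset

lemma pathTime_eq {u v : Fin d → ℤ} (x : Config d) (α : (lattice d).Walk u v) :
    pathTime x α = ((edgeList α).map fun e => (x e : ℝ)).sum := by
  simp [pathTime, edgeList, Function.comp_def]

lemma length_edgeList {u v : Fin d → ℤ} (α : (lattice d).Walk u v) :
    (edgeList α).length = α.length := by simp [edgeList]

lemma pathTime_append {u v w : Fin d → ℤ} (x : Config d) (α : (lattice d).Walk u v)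
    (β : (lattice d).Walk v w) : pathTime x (α.append β) = pathTime x α + pathTime x β := by
  simp [pathTime, SimpleGraph.Walk.darts_append]

lemma pathTime_nonneg {u v : Fin d → ℤ} (x : Config d) (α : (lattice d).Walk u v) :
    0 ≤ pathTime x α := by
  refine List.sum_nonneg fun a ha => ?_
  obtain ⟨e, -, rfl⟩ := List.mem_map.1 ha
  exact (x _).2

lemma map_val_edgeList {u v : Fin d → ℤ} (α : (lattice d).Walk u v) :
    (edgeList α).map Subtype.val = α.edges := by
  simp [edgeList, SimpleGraph.Walk.edges, Function.comp_def]

lemma nodup_edgeList {u v : Fin d → ℤ} {α : (lattice d).Walk u v} (h : α.IsPath) :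
    (edgeList α).Nodup := by
  have := h.isTrail.edges_nodup
  rw [← map_val_edgeList] at this
  exact this.of_map _

lemma pathTime_eq_setTime {u v : Fin d → ℤ} (x : Config d) {α : (lattice d).Walk u v}
    (h : α.IsPath) : pathTime x α = setTime (edgeFin α) x := by
  rw [pathTime_eq, setTime, edgeFin, List.sum_toFinset _ (nodup_edgeList h)]

lemma card_edgeFin {u v : Fin d → ℤ} {α : (lattice d).Walk u v} (h : α.IsPath) :
    (edgeFin α).card = α.length := by
  rw [edgeFin, List.toFinset_card_of_nodup (nodup_edgeList h), length_edgeList]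

lemma mem_edgeFin {u v : Fin d → ℤ} {α : (lattice d).Walk u v} {e : Edge d} :
    e ∈ edgeFin α ↔ e.1 ∈ α.edges := by
  rw [edgeFin, List.mem_toFinset, ← map_val_edgeList]
  simp

lemma setTime_toFinset_le [DecidableEq (Edge d)] (l : List (Edge d)) (x : Config d) :
    setTime l.toFinset x ≤ (l.map fun e => (x e : ℝ)).sum := by
  induction l with
  | nil => simp [setTime]
  | cons e l ih =>
    rw [List.toFinset_cons, List.map_cons, List.sum_cons]
    unfold setTime at *
    by_cases he : e ∈ l.toFinset
    · rw [Finset.insert_eq_of_mem he]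
      linarith [(x e).2]
    · rw [Finset.sum_insert he]
      linarith

/-- Making a walk self-avoiding does not increase its time. -/
lemma setTime_bypass_le {u v : Fin d → ℤ} (x : Config d) (α : (lattice d).Walk u v)
    [DecidableEq (Fin d → ℤ)] : setTime (edgeFin α.bypass) x ≤ pathTime x α := by
  classical
  refine le_trans ?_ ((setTime_toFinset_le (edgeList α) x).trans (pathTime_eq x α).ge)
  refine Finset.sum_le_sum_of_subset_of_nonneg (fun e he => ?_) fun e _ _ => (x e).2
  rw [mem_edgeFin] at he
  have := α.edges_bypass_subset_edges he
  rw [← map_val_edgeList] at this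
  simpa using this

lemma l1norm_neg (v : Fin d → ℤ) : l1norm (-v) = l1norm v := by simp [l1norm]

lemma l1norm_sub_comm (u v : Fin d → ℤ) : l1norm (u - v) = l1norm (v - u) := by
  rw [← l1norm_neg, neg_sub]

lemma l1norm_eq_zero {v : Fin d → ℤ} (h : l1norm v = 0) : v = 0 := by
  funext i
  simpa [l1norm] using (Finset.sum_eq_zero_iff.1 h) i (Finset.mem_univ i)

/-- The unit vector in a signed coordinate direction. -/
def dirVec (s : Fin d × Bool) : Fin d → ℤ := Pi.single s.1 (if s.2 then 1 else -1)

lemma l1norm_dirVec (s : Fin d × Bool) : l1norm (dirVec s) = 1 := by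
  unfold l1norm dirVec
  rw [Finset.sum_eq_single s.1]
  · rw [Pi.single_eq_same]; split_ifs <;> rfl
  · intro j _ hj; simp [Pi.single_eq_of_ne hj]
  · simp

lemma adj_add_dirVec (u : Fin d → ℤ) (s : Fin d × Bool) : (lattice d).Adj u (u + dirVec s) := by
  change l1norm (u - (u + dirVec s)) = 1
  rw [sub_add_cancel_left, l1norm_neg, l1norm_dirVec]

/-- Moving towards `v` in a suitable direction decreases the distance by one. -/
lemma exists_dirVec {v : Fin d → ℤ} (h : l1norm v ≠ 0) :
    ∃ s : Fin d × Bool, l1norm (v - dirVec s) + 1 = l1norm v := by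
  obtain ⟨i, hi⟩ : ∃ i, v i ≠ 0 := by
    by_contra hcon
    push Not at hcon
    exact h (by simp [l1norm, hcon])
  refine ⟨(i, decide (0 < v i)), ?_⟩
  unfold l1norm
  rw [← Finset.add_sum_erase _ _ (Finset.mem_univ i),
    ← Finset.add_sum_erase Finset.univ (fun j => (v j).natAbs) (Finset.mem_univ i)]
  have h1 : ∑ j ∈ Finset.univ.erase i, ((v - dirVec (i, decide (0 < v i))) j).natAbs =
      ∑ j ∈ Finset.univ.erase i, (v j).natAbs := by
    refine Finset.sum_congr rfl fun j hj => ?_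
    simp [dirVec, Pi.single_eq_of_ne (Finset.ne_of_mem_erase hj)]
  rw [h1]
  have h2 : ((v - dirVec (i, decide (0 < v i))) i).natAbs + 1 = (v i).natAbs := by
    simp only [dirVec, Pi.sub_apply, Pi.single_eq_same, decide_eq_true_eq]
    split_ifs <;> omega
  omega

lemma exists_eq_add_dirVec {u w : Fin d → ℤ} (h : (lattice d).Adj u w) :
    ∃ s, w = u + dirVec s := by
  have h1 : l1norm (w - u) = 1 := by rw [l1norm_sub_comm]; exact h
  obtain ⟨s, hs⟩ := exists_dirVec (v := w - u) (by omega)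
  refine ⟨s, ?_⟩
  have := l1norm_eq_zero (v := w - u - dirVec s) (by omega)
  rw [sub_sub, sub_eq_zero] at this
  exact this

lemma exists_walk (u v : Fin d → ℤ) : ∃ α : (lattice d).Walk u v, α.length = l1norm (v - u) := by
  induction hn : l1norm (v - u) generalizing u with
  | zero =>
    have := sub_eq_zero.1 (l1norm_eq_zero hn)
    subst this
    exact ⟨.nil, rfl⟩
  | succ n ih =>
    obtain ⟨s, hs⟩ := exists_dirVec (v := v - u) (by omega)
    obtain ⟨α, hα⟩ := ih (u + dirVec s) (by rw [← sub_sub]; omega)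
    exact ⟨.cons (adj_add_dirVec u s) α, by simp [hα]⟩

lemma exists_path (u v : Fin d → ℤ) :
    ∃ α : (lattice d).Walk u v, α.IsPath ∧ α.length ≤ l1norm (v - u) := by
  classical
  obtain ⟨α, hα⟩ := exists_walk u v
  exact ⟨α.bypass, α.bypass_isPath, hα ▸ α.length_bypass_le_length⟩

/-- A self-avoiding path of minimal length between two vertices. -/
noncomputable def shortPath (u v : Fin d → ℤ) : (lattice d).Walk u v := (exists_path u v).choose

lemma shortPath_isPath (u v : Fin d → ℤ) : (shortPath u v).IsPath :=
  (exists_path u v).choose_spec.1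

lemma length_shortPath_le (u v : Fin d → ℤ) : (shortPath u v).length ≤ l1norm (v - u) :=
  (exists_path u v).choose_spec.2

open Classical in
/-- The edge lists of the walks with `j` steps from `u`. -/
noncomputable def walkLists : ℕ → (Fin d → ℤ) → Finset (List (Edge d))
  | 0, _ => {[]}
  | j + 1, u => Finset.univ.biUnion fun s : Fin d × Bool =>
      (walkLists j (u + dirVec s)).image fun l =>
        (⟨s(u, u + dirVec s), adj_add_dirVec u s⟩ : Edge d) :: l

lemma card_walkLists_le (j : ℕ) (u : Fin d → ℤ) : (walkLists j u).card ≤ (2 * d) ^ j := by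
  induction j generalizing u with
  | zero => simp [walkLists]
  | succ j ih =>
    rw [walkLists]
    refine Finset.card_biUnion_le.trans ?_
    calc _ ≤ ∑ _s : Fin d × Bool, (2 * d) ^ j :=
          Finset.sum_le_sum fun s _ => Finset.card_image_le.trans (ih _)
      _ = (2 * d) ^ (j + 1) := by simp; ring

lemma length_of_mem_walkLists {j : ℕ} {u : Fin d → ℤ} {l : List (Edge d)}
    (h : l ∈ walkLists j u) : l.length = j := by
  induction j generalizing u l with
  | zero => simp [walkLists] at h; simp [h]
  | succ j ih =>
    simp only [walkLists, Finset.mem_biUnion, Finset.mem_univ, true_and, Finset.mem_image] at h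
    obtain ⟨s, l', hl', rfl⟩ := h
    simp [ih hl']

lemma edgeList_mem_walkLists {u v : Fin d → ℤ} (α : (lattice d).Walk u v) :
    edgeList α ∈ walkLists α.length u := by
  induction α with
  | nil => simp [edgeList, walkLists]
  | @cons u b v h p ih =>
    obtain ⟨s, rfl⟩ := exists_eq_add_dirVec h
    simp only [SimpleGraph.Walk.length_cons, walkLists, Finset.mem_biUnion, Finset.mem_univ,
      true_and, Finset.mem_image]
    exact ⟨s, edgeList p, ih, by simp [edgeList]⟩

open Classical in
/-- The edge sets of the self-avoiding paths of length at most `K` from `u` to `v`. -/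
noncomputable def pathSets (K : ℕ) (u v : Fin d → ℤ) : Finset (Finset (Edge d)) :=
  (((Finset.range (K + 1)).biUnion fun j => walkLists j u).image List.toFinset).filter
    fun p => ∃ α : (lattice d).Walk u v, α.IsPath ∧ α.length ≤ K ∧ edgeFin α = p

lemma mem_pathSets {K : ℕ} {u v : Fin d → ℤ} {p : Finset (Edge d)} : p ∈ pathSets K u v ↔
    ∃ α : (lattice d).Walk u v, α.IsPath ∧ α.length ≤ K ∧ edgeFin α = p := by
  classical
  simp only [pathSets, Finset.mem_filter, Finset.mem_image, Finset.mem_biUnion, Finset.mem_range,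
    and_iff_right_iff_imp]
  rintro ⟨α, -, hK, rfl⟩
  exact ⟨edgeList α, ⟨α.length, by omega, edgeList_mem_walkLists α⟩, by unfold edgeFin; congr⟩

/-- There is a self-avoiding path from `u` of length `j ≥ k` and of time at most `c j`. -/
def fastPaths (c : ℝ) (u : Fin d → ℤ) (k : ℕ) : Set (Config d) :=
  ⋃ i : ℕ, ⋃ l ∈ (open Classical in (walkLists (k + i) u).filter List.Nodup),
    {x | setTime (open Classical in l.toFinset) x ≤ c * ((k + i : ℕ) : ℝ)}

lemma mem_fastPaths {c : ℝ} {u v : Fin d → ℤ} {k : ℕ} {x : Config d}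
    {α : (lattice d).Walk u v} (hα : α.IsPath) (hk : k ≤ α.length)
    (ht : pathTime x α ≤ c * α.length) : x ∈ fastPaths c u k := by
  classical
  simp only [fastPaths, Set.mem_iUnion]
  refine ⟨α.length - k, edgeList α, ?_, ?_⟩
  · rw [Finset.mem_filter, Nat.add_sub_cancel' hk]
    exact ⟨edgeList_mem_walkLists α, nodup_edgeList hα⟩
  · rw [Nat.add_sub_cancel' hk]
    rw [pathTime_eq_setTime x hα] at ht
    unfold edgeFin at ht
    change setTime _ x ≤ c * (α.length : ℝ)
    convert ht

/-- A minimizing path makes few visits to a set of vertices, unless there is a fast path from this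
set or a slow short path between two of its points. -/
lemma countP_support_le {K k : ℕ} {c a : ℝ} (hc : 0 ≤ c) {v₀ v : Fin d → ℤ} {x : Config d}
    (Q : (Fin d → ℤ) → Bool) {α : (lattice d).Walk v₀ v} (hα : α.IsPath) (hK : α.length ≤ K)
    (hmin : edgeFin α ∈ minimizers (pathSets K v₀ v) a x)
    (hdist : ∀ u u', Q u → Q u' → l1norm (u' - u) ≤ k)
    (hfast : ∀ u, Q u → x ∉ fastPaths c u k)
    (hslow : ∀ u u', Q u → Q u' → pathTime x (shortPath u u') ≤ c * k) :
    α.support.countP Q ≤ k := by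
  classical
  by_contra hcon
  rw [not_le] at hcon
  have hex : ∃ u ∈ α.support, Q u := List.countP_pos_iff.1 (by omega)
  obtain ⟨u, u', hu, hu', q, β, r, hαe, hcount⟩ := exists_segment Q α hex
  have hβ : β.IsPath := by
    rw [hαe] at hα
    exact hα.of_append_right.of_append_left
  have hkβ : k ≤ β.length := by omega
  -- If there were more than `k` visits, the segment `β` would have length at least `k`, hence at
  -- least that of the detour, so the detour stays within the length bound `K`. Minimality makes `β`
  -- no slower than the detour, so `β` would be a fast path.
  set α' := q.append ((shortPath u u').append r) with hα'
  have hlen : α'.length ≤ K := by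
    have h1 := length_shortPath_le u u'
    have h2 := hdist u u' hu hu'
    rw [hαe] at hK
    simp only [hα', SimpleGraph.Walk.length_append] at hK ⊢
    omega
  have hmem : edgeFin α'.bypass ∈ pathSets K v₀ v := mem_pathSets.2
    ⟨α'.bypass, α'.bypass_isPath, α'.length_bypass_le_length.trans hlen, rfl⟩
  have h1 : pathTime x α ≤ pathTime x α' := by
    rw [pathTime_eq_setTime x hα, setTime_eq_of_mem_minimizers hmin]
    exact (capMin_le hmem x).trans (setTime_bypass_le x α')
  have h2 : pathTime x β ≤ pathTime x (shortPath u u') := by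
    rw [hαe, hα'] at h1
    simp only [pathTime_append] at h1
    linarith
  refine hfast u hu (mem_fastPaths hβ hkβ (h2.trans ((hslow u u' hu hu').trans ?_)))
  exact mul_le_mul_of_nonneg_left (by exact_mod_cast hkβ) hc

lemma passageTime_le {u v : Fin d → ℤ} (x : Config d) (α : (lattice d).Walk u v) :
    passageTime x u v ≤ pathTime x α :=
  ciInf_le ⟨0, by rintro _ ⟨β, rfl⟩; exact pathTime_nonneg x β⟩ α

lemma le_passageTime {u v : Fin d → ℤ} {x : Config d} {a : ℝ}
    (h : ∀ α : (lattice d).Walk u v, a ≤ pathTime x α) : a ≤ passageTime x u v := by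
  have : Nonempty ((lattice d).Walk u v) := ⟨shortPath u v⟩
  exact le_ciInf h

lemma passageTime_nonneg (x : Config d) (u v : Fin d → ℤ) : 0 ≤ passageTime x u v :=
  le_passageTime fun α => pathTime_nonneg x α

lemma passageTime_triangle (x : Config d) (u v w : Fin d → ℤ) :
    passageTime x u w ≤ passageTime x u v + pathTime x (shortPath v w) := by
  rw [← sub_le_iff_le_add]
  refine le_passageTime fun α => ?_
  rw [sub_le_iff_le_add, ← pathTime_append]
  exact passageTime_le x _

lemma passageTime_comm (x : Config d) (u v : Fin d → ℤ) :
    passageTime x u v = passageTime x v u := by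
  have h : ∀ u v : Fin d → ℤ, passageTime x u v ≤ passageTime x v u := by
    intro u v
    refine le_passageTime fun α => (passageTime_le x α.reverse).trans (le_of_eq ?_)
    unfold pathTime
    rw [SimpleGraph.Walk.darts_reverse, List.map_reverse, List.sum_reverse, List.map_map]
    congr 1
    refine List.map_congr_left fun a _ => ?_
    simp
  exact le_antisymm (h u v) (h v u)

/-- Outside `fastPaths`, a self-avoiding path longer than `K` takes more than `c * K`, so discarding
it does no harm below the cap; and the short path shows that the passage time is below the cap. -/
lemma capMin_eq_passageTime {K : ℕ} {c : ℝ} {u v : Fin d → ℤ} {x : Config d}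
    (hc : 0 ≤ c) (hK : l1norm (v - u) ≤ K) (hfast : x ∉ fastPaths c u K)
    (hslow : pathTime x (shortPath u v) ≤ c * K) :
    capMin (pathSets K u v) (c * K) x = passageTime x u v := by
  classical
  have hsp : edgeFin (shortPath u v) ∈ pathSets K u v := mem_pathSets.2
    ⟨_, shortPath_isPath u v, (length_shortPath_le u v).trans hK, rfl⟩
  refine le_antisymm (le_passageTime fun α => ?_) (le_capMin_iff.2 ⟨?_, fun p hp => ?_⟩)
  · by_cases hlen : α.bypass.length ≤ K
    · exact (capMin_le (mem_pathSets.2 ⟨α.bypass, α.bypass_isPath, hlen, rfl⟩) x).trans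
        (setTime_bypass_le x α)
    · have h1 : ¬ pathTime x α.bypass ≤ c * α.bypass.length := fun h =>
        hfast (mem_fastPaths α.bypass_isPath (by omega) h)
      have h2 : c * K ≤ c * α.bypass.length :=
        mul_le_mul_of_nonneg_left (by exact_mod_cast (not_le.1 hlen).le) hc
      have h3 := setTime_bypass_le x α
      rw [← pathTime_eq_setTime x α.bypass_isPath] at h3
      have h4 := capMin_le_cap (P := pathSets K u v) (c := c * K) x
      linarith
  · exact (passageTime_le x _).trans hslow
  · obtain ⟨α, hα, -, rfl⟩ := mem_pathSets.1 hp
    rw [← pathTime_eq_setTime x hα]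
    exact passageTime_le x α

/-- Both quantities lie between zero and the time of the short path. This crude bound serves on the
rare event where they differ. -/
lemma abs_passageTime_sub_capMin_le {K : ℕ} {c : ℝ} {u v : Fin d → ℤ} (x : Config d)
    (hc : 0 ≤ c) (hK : l1norm (v - u) ≤ K) :
    |passageTime x u v - capMin (pathSets K u v) c x| ≤ pathTime x (shortPath u v) := by
  have hsp : edgeFin (shortPath u v) ∈ pathSets K u v := mem_pathSets.2
    ⟨_, shortPath_isPath u v, (length_shortPath_le u v).trans hK, rfl⟩
  have h1 := capMin_le (c := c) hsp x
  rw [← pathTime_eq_setTime x (shortPath_isPath u v)] at h1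
  have h2 := capMin_nonneg (P := pathSets K u v) hc x
  have h3 := passageTime_le x (shortPath u v)
  have h4 := passageTime_nonneg x u v
  rw [abs_le]
  constructor <;> linarith

/-- Translation by `z`, as an automorphism of the lattice. -/
def shiftIso (z : Fin d → ℤ) : lattice d ≃g lattice d where
  toEquiv := Equiv.addRight z
  map_rel_iff' := by
    intro u v
    change l1norm (u + z - (v + z)) = 1 ↔ l1norm (u - v) = 1
    rw [add_sub_add_right_eq_sub]

/-- Translation of the edges by `z`. -/
def shift (z : Fin d → ℤ) : Equiv.Perm (Edge d) := (shiftIso z).mapEdgeSet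

lemma pathTime_map_shift (x : Config d) (z : Fin d → ℤ) {u v : Fin d → ℤ}
    (α : (lattice d).Walk u v) :
    pathTime x (α.map (shiftIso z).toHom) = pathTime (x ∘ shift z) α := by
  unfold pathTime
  rw [SimpleGraph.Walk.darts_map, List.map_map]
  rfl

lemma passageTime_shift (x : Config d) (z u v : Fin d → ℤ) :
    passageTime (x ∘ shift z) u v = passageTime x (u + z) (v + z) := by
  have h : ∀ (x : Config d) (z u v : Fin d → ℤ),
      passageTime x (u + z) (v + z) ≤ passageTime (x ∘ shift z) u v := fun x z u v =>
    le_passageTime fun α => by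
      rw [← pathTime_map_shift]
      exact passageTime_le x _
  refine le_antisymm ?_ (h x z u v)
  have h1 := h (x ∘ shift z) (-z) (u + z) (v + z)
  have h2 : (x ∘ shift z) ∘ shift (-z) = x := by
    funext e
    obtain ⟨e, he⟩ := e
    induction e using Sym2.ind with
    | _ a b =>
      simp only [comp_apply]
      congr 1
      apply Subtype.ext
      change Sym2.map _ (Sym2.map _ s(a, b)) = s(a, b)
      simp [shiftIso]
  rw [h2] at h1
  simpa using h1

end Lattice

end FPP

namespace FPP

open scoped BigOperators Topology
open Function Filter

/-! ### Laplace transforms of path times and the choice of a minimal speed. -/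

section ExpMoments

variable {ι : Type*} {ν : Measure ℝ≥0} [IsProbabilityMeasure ν]

lemma integrable_exp_setTime (p : Finset ι) {t : ℝ}
    (ht : Integrable (fun y : ℝ≥0 => Real.exp (t * y)) ν) :
    Integrable (fun x => Real.exp (t * setTime p x)) (Measure.infinitePi fun _ : ι => ν) := by
  have h : (fun x : ι → ℝ≥0 => Real.exp (t * setTime p x)) =
      (fun x : p → ℝ≥0 => ∏ i, Real.exp (t * x i)) ∘ p.restrict := by
    funext x
    simp only [comp_apply, ← Real.exp_sum, ← Finset.mul_sum, setTime, Finset.restrict]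
    rw [← Finset.sum_coe_sort p fun e => (x e : ℝ)]
  have hmap := Measure.infinitePi_map_restrict (μ := fun _ : ι => ν) (I := p)
  rw [h]
  refine Integrable.comp_measurable ?_ (by fun_prop)
  rw [hmap]
  exact Integrable.fintype_prod (f := fun _ (y : ℝ≥0) => Real.exp (t * y)) fun _ => ht

lemma integral_exp_setTime (p : Finset ι) (t : ℝ) :
    ∫ x, Real.exp (t * setTime p x) ∂(Measure.infinitePi fun _ : ι => ν) =
      (∫ y : ℝ≥0, Real.exp (t * y) ∂ν) ^ p.card := by
  have h : (fun x : ι → ℝ≥0 => Real.exp (t * setTime p x)) =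
      fun x => (fun x : p → ℝ≥0 => ∏ i, Real.exp (t * x i)) (p.restrict x) := by
    funext x
    simp only [← Real.exp_sum, ← Finset.mul_sum, setTime, Finset.restrict]
    rw [← Finset.sum_coe_sort p fun e => (x e : ℝ)]
  have hm : Measurable fun x : p → ℝ≥0 => ∏ i, Real.exp (t * x i) := by fun_prop
  rw [h]
  refine (integral_restrict_infinitePi (fun _ : ι => ν) (s := p)
    (f := fun x : p → ℝ≥0 => ∏ i, Real.exp (t * x i)) hm.aestronglyMeasurable).trans ?_
  have := integral_fintype_prod_eq_pow (ι := p) (μ := ν) fun y : ℝ≥0 => Real.exp (t * y)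
  rw [this, Fintype.card_coe]

lemma one_le_integral_exp {δ : ℝ} (hδ : 0 ≤ δ)
    (hexpi : Integrable (fun y : ℝ≥0 => Real.exp (δ * y)) ν) :
    1 ≤ ∫ y : ℝ≥0, Real.exp (δ * y) ∂ν := by
  have : ∫ _y : ℝ≥0, (1 : ℝ) ∂ν ≤ ∫ y : ℝ≥0, Real.exp (δ * y) ∂ν :=
    integral_mono (integrable_const _) hexpi fun y => Real.one_le_exp (by positivity)
  simpa using this

lemma integrable_exp_neg (c : ℝ) (hc : 0 ≤ c) :
    Integrable (fun y : ℝ≥0 => Real.exp (-c * y)) ν := by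
  refine Integrable.of_bound (by fun_prop) 1 (ae_of_all _ fun y => ?_)
  rw [Real.norm_of_nonneg (Real.exp_pos _).le]
  have : (0 : ℝ) ≤ c * y := mul_nonneg hc y.2
  exact Real.exp_le_one_iff.2 (by linarith)

/-- The Laplace transform of a law without atom at `0` tends to `0`. -/
lemma tendsto_integral_exp_neg (h0 : ν {0} = 0) :
    Tendsto (fun n : ℕ => ∫ y : ℝ≥0, Real.exp (-(n : ℝ) * y) ∂ν) atTop (𝓝 0) := by
  have := tendsto_integral_of_dominated_convergence (μ := ν)
    (F := fun (n : ℕ) (y : ℝ≥0) => Real.exp (-(n : ℝ) * y)) (f := fun _ => (0 : ℝ))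
    (fun _ => (1 : ℝ)) (fun n => (integrable_exp_neg (n : ℝ) n.cast_nonneg).aestronglyMeasurable)
    (integrable_const _) (fun n => ae_of_all _ fun y => by
      rw [Real.norm_of_nonneg (Real.exp_pos _).le]
      have : (0 : ℝ) ≤ n * y := by positivity
      exact Real.exp_le_one_iff.2 (by linarith)) ?_
  · simpa using this
  · have hne : ∀ᵐ y : ℝ≥0 ∂ν, y ≠ 0 := by
      rw [ae_iff]; simpa using h0
    filter_upwards [hne] with y hy
    have hy' : (0 : ℝ) < y := by exact_mod_cast pos_iff_ne_zero.2 hy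
    refine Real.tendsto_exp_atBot.comp ?_
    simp only [neg_mul]
    exact tendsto_neg_atTop_atBot.comp (tendsto_natCast_atTop_atTop.atTop_mul_const hy')

/-- There are at most `(2 * d) ^ j` walks of `j` steps, so the Chernoff factor per edge must beat `2
* d`. This holds for small `c` because the Laplace transform of a law without atom at zero tends to
zero; the margin `exp (-1)` makes the union bound geometric. -/
lemma exists_speed (h0 : ν {0} = 0) (d : ℕ) : ∃ c : ℝ, 0 < c ∧
    2 * d * Real.exp 1 * ∫ y : ℝ≥0, Real.exp (-c⁻¹ * y) ∂ν ≤ Real.exp (-1) := by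
  have h1 := (tendsto_integral_exp_neg h0).const_mul (2 * d * Real.exp 1)
  rw [mul_zero] at h1
  obtain ⟨n, hn, hn0⟩ := ((h1.eventually_lt_const (Real.exp_pos (-1))).and
    (eventually_gt_atTop 0)).exists
  have hn' : (0 : ℝ) < n := by exact_mod_cast hn0
  exact ⟨(n : ℝ)⁻¹, inv_pos.2 hn', by rw [inv_inv]; exact hn.le⟩

end ExpMoments

/-! ### Probabilities of fast and slow paths, and translates of an edge on geodesics. -/

section LatticeProbability

variable {d : ℕ} {ν : Measure ℝ≥0} [IsProbabilityMeasure ν]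

instance : IsProbabilityMeasure (edgeLaw d ν) := by unfold edgeLaw; infer_instance

lemma measurable_pathTime {u v : Fin d → ℤ} (α : (lattice d).Walk u v) :
    Measurable fun x : Config d => pathTime x α := by
  simp only [pathTime_eq]
  generalize edgeList α = l
  induction l with
  | nil => simp
  | cons e l ih =>
    simp only [List.map_cons, List.sum_cons]
    exact Measurable.add (by fun_prop) ih

lemma measurableSet_fastPaths (c : ℝ) (u : Fin d → ℤ) (k : ℕ) :
    MeasurableSet (fastPaths c u k) :=
  MeasurableSet.iUnion fun _ => Finset.measurableSet_biUnion _ fun _ _ =>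
    measurableSet_le (measurable_setTime _) measurable_const

/-- Chernoff bound with parameter `-1 / c`; the edges of `p` are distinct, hence independent. -/
lemma measure_setTime_le_le (p : Finset (Edge d)) {c : ℝ} (hc : 0 < c) :
    (edgeLaw d ν).real {x | setTime p x ≤ c * p.card} ≤
      (Real.exp 1 * ∫ y : ℝ≥0, Real.exp (-c⁻¹ * y) ∂ν) ^ p.card := by
  have hexpi : Integrable (fun x => Real.exp (-c⁻¹ * setTime p x)) (edgeLaw d ν) :=
    integrable_exp_setTime p (integrable_exp_neg _ (inv_pos.2 hc).le)
  have := measure_le_le_exp_mul_mgf (μ := edgeLaw d ν) (X := setTime p) (c * p.card)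
    (t := -c⁻¹) (by have := inv_pos.2 hc; linarith) hexpi
  refine this.trans (le_of_eq ?_)
  rw [mgf, edgeLaw, integral_exp_setTime, mul_pow, ← Real.exp_nat_mul]
  congr 2
  field_simp

/-- Union bound over the lists of each length `j ≥ k`: level `j` has probability at most `exp (-j)`,
and the geometric sum costs a factor `(1 - exp (-1))⁻¹ ≤ 2`. -/
lemma measure_fastPaths_le {c : ℝ} (hc : 0 < c)
    (hρ : 2 * d * Real.exp 1 * ∫ y : ℝ≥0, Real.exp (-c⁻¹ * y) ∂ν ≤ Real.exp (-1))
    (u : Fin d → ℤ) (k : ℕ) : (edgeLaw d ν).real (fastPaths c u k) ≤ 2 * Real.exp (-k) := by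
  classical
  set ρ := Real.exp 1 * ∫ y : ℝ≥0, Real.exp (-c⁻¹ * y) ∂ν with hρdef
  have hρ0 : 0 ≤ ρ := mul_nonneg (Real.exp_pos _).le (integral_nonneg fun y => (Real.exp_pos _).le)
  have hlev : ∀ i : ℕ, edgeLaw d ν (⋃ l ∈ (open Classical in
      (walkLists (k + i) u).filter List.Nodup),
      {x | setTime (open Classical in l.toFinset) x ≤ c * ((k + i : ℕ) : ℝ)}) ≤
      ENNReal.ofReal (Real.exp (-k) * Real.exp (-1) ^ i) := by
    intro i
    set j := k + i
    have hone : ∀ l ∈ (open Classical in (walkLists j u).filter List.Nodup),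
        edgeLaw d ν {x | setTime (open Classical in l.toFinset) x ≤ c * (j : ℝ)} ≤
          ENNReal.ofReal (ρ ^ j) := by
      intro l hl
      obtain ⟨hl1, hl2⟩ := Finset.mem_filter.1 hl
      have hcard : l.toFinset.card = j := by
        rw [List.toFinset_card_of_nodup hl2, length_of_mem_walkLists hl1]
      have := measure_setTime_le_le (ν := ν) l.toFinset hc
      rw [hcard] at this
      rw [← ENNReal.ofReal_toReal (measure_ne_top (edgeLaw d ν) _)]
      refine ENNReal.ofReal_le_ofReal ?_
      rw [← measureReal_def]
      convert this
    refine (measure_biUnion_finset_le _ _).trans ((Finset.sum_le_sum hone).trans ?_)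
    rw [Finset.sum_const, nsmul_eq_mul, ← ENNReal.ofReal_natCast,
      ← ENNReal.ofReal_mul (Nat.cast_nonneg _)]
    refine ENNReal.ofReal_le_ofReal ?_
    have hcount : ((open Classical in ((walkLists j u).filter List.Nodup)).card : ℝ) ≤
        (2 * d : ℝ) ^ j := by
      exact_mod_cast (Finset.card_filter_le _ _).trans (card_walkLists_le j u)
    calc _ ≤ (2 * d : ℝ) ^ j * ρ ^ j := mul_le_mul_of_nonneg_right hcount (pow_nonneg hρ0 j)
      _ = (2 * d * Real.exp 1 * ∫ y : ℝ≥0, Real.exp (-c⁻¹ * y) ∂ν) ^ j := by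
          rw [← mul_pow, hρdef]; ring
      _ ≤ Real.exp (-1) ^ j := by
          refine pow_le_pow_left₀ ?_ hρ j
          have := mul_nonneg (by positivity : (0 : ℝ) ≤ 2 * d) hρ0
          rw [hρdef] at this
          linarith
      _ = _ := by
          rw [pow_add, ← Real.exp_nat_mul]
          congr 2
          ring
  have hr1 : Real.exp (-1) < 1 := by simp
  have hsum : HasSum (fun i : ℕ => Real.exp (-k) * Real.exp (-1) ^ i)
      (Real.exp (-k) * (1 - Real.exp (-1))⁻¹) :=
    (hasSum_geometric_of_lt_one (Real.exp_pos _).le hr1).mul_left _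
  have hle : edgeLaw d ν (fastPaths c u k) ≤
      ENNReal.ofReal (Real.exp (-k) * (1 - Real.exp (-1))⁻¹) := by
    refine (measure_iUnion_le _).trans ((ENNReal.tsum_le_tsum hlev).trans (le_of_eq ?_))
    rw [← ENNReal.ofReal_tsum_of_nonneg (fun i => by positivity) hsum.summable, hsum.tsum_eq]
  have hinv : (1 - Real.exp (-1))⁻¹ ≤ 2 := by
    have h2 : Real.exp (-1) ≤ 1 / 2 := by
      rw [Real.exp_neg, one_div]
      exact inv_anti₀ two_pos (by have := Real.add_one_le_exp (1 : ℝ); linarith)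
    rw [inv_le_comm₀ (by linarith) two_pos]
    linarith
  refine (ENNReal.toReal_le_of_le_ofReal (by positivity) hle).trans ?_
  rw [mul_comm]
  exact mul_le_mul_of_nonneg_right hinv (Real.exp_pos _).le

lemma integrable_exp_pathTime {δ : ℝ} (hexpi : Integrable (fun y : ℝ≥0 => Real.exp (δ * y)) ν)
    (u v : Fin d → ℤ) :
    Integrable (fun x => Real.exp (δ * pathTime x (shortPath u v))) (edgeLaw d ν) := by
  simp only [fun x => pathTime_eq_setTime x (shortPath_isPath u v)]
  exact integrable_exp_setTime _ hexpi

lemma integral_exp_pathTime_le {δ : ℝ} (hδ : 0 ≤ δ)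
    (hexpi : Integrable (fun y : ℝ≥0 => Real.exp (δ * y)) ν)
    (u v : Fin d → ℤ) {n : ℕ} (hn : l1norm (v - u) ≤ n) :
    ∫ x, Real.exp (δ * pathTime x (shortPath u v)) ∂(edgeLaw d ν) ≤
      (∫ y : ℝ≥0, Real.exp (δ * y) ∂ν) ^ n := by
  simp only [fun x => pathTime_eq_setTime x (shortPath_isPath u v)]
  rw [edgeLaw, integral_exp_setTime, card_edgeFin (shortPath_isPath u v)]
  exact pow_le_pow_right₀ (one_le_integral_exp hδ hexpi) ((length_shortPath_le u v).trans hn)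

lemma measure_lt_pathTime_le {δ : ℝ} (hδ : 0 ≤ δ)
    (hexpi : Integrable (fun y : ℝ≥0 => Real.exp (δ * y)) ν)
    (u v : Fin d → ℤ) {n : ℕ} (hn : l1norm (v - u) ≤ n) (a : ℝ) :
    (edgeLaw d ν).real {x | a < pathTime x (shortPath u v)} ≤
      Real.exp (-δ * a) * (∫ y : ℝ≥0, Real.exp (δ * y) ∂ν) ^ n := by
  have h1 := measure_ge_le_exp_mul_mgf (μ := edgeLaw d ν)
    (X := fun x => pathTime x (shortPath u v)) a hδ (integrable_exp_pathTime hexpi u v)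
  have h2 : (edgeLaw d ν).real {x | a < pathTime x (shortPath u v)} ≤
      (edgeLaw d ν).real {x | a ≤ pathTime x (shortPath u v)} :=
    measureReal_mono fun x (hx : a < _) => le_of_lt hx
  refine h2.trans (h1.trans (mul_le_mul_of_nonneg_left ?_ (Real.exp_pos _).le))
  exact integral_exp_pathTime_le hδ hexpi u v hn

/-- The vector of `ℤ^d` with coordinates in `{0, …, m - 1}` given by `z`. -/
def boxVec {m : ℕ} (z : Fin d → Fin m) : Fin d → ℤ := fun i => ((z i : ℕ) : ℤ)

lemma l1norm_boxVec_sub_le {m : ℕ} (z z' : Fin d → Fin m) :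
    l1norm (boxVec z - boxVec z') ≤ d * m := by
  unfold l1norm
  calc _ ≤ ∑ _i : Fin d, m := Finset.sum_le_sum fun i _ => by
        have := (z i).2
        have := (z' i).2
        simp only [boxVec, Pi.sub_apply]
        omega
    _ = d * m := by simp

lemma l1norm_boxVec_le {m : ℕ} (z : Fin d → Fin m) : l1norm (boxVec z) ≤ d * m := by
  unfold l1norm
  calc _ ≤ ∑ _i : Fin d, m := Finset.sum_le_sum fun i _ => by
        have := (z i).2
        simp only [boxVec]
        omega
    _ = d * m := by simp

lemma boxVec_injective {m : ℕ} : Injective (boxVec : (Fin d → Fin m) → Fin d → ℤ) := by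
  intro z z' h
  funext i
  have := congrFun h i
  simp only [boxVec] at this
  exact Fin.ext (by exact_mod_cast this)

lemma shift_symm_val (z a b : Fin d → ℤ) (h : s(a, b) ∈ (lattice d).edgeSet) :
    ((shift z).symm ⟨s(a, b), h⟩).1 = s(a - z, b - z) := by
  change Sym2.map _ s(a, b) = _
  simp [shiftIso, sub_eq_add_neg]

open Classical in
/-- The expected number of translates of an edge by a box that lie on a minimizing path. -/
lemma integral_sum_minWeight_le {δ : ℝ} (hδ : 0 ≤ δ)
    (hexpi : Integrable (fun y : ℝ≥0 => Real.exp (δ * y)) ν) {c : ℝ} (hc : 0 < c)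
    (hρ : 2 * d * Real.exp 1 * ∫ y : ℝ≥0, Real.exp (-c⁻¹ * y) ∂ν ≤ Real.exp (-1))
    (K : ℕ) (a : ℝ) (v : Fin d → ℤ) {m k : ℕ} (hk : d * m ≤ k) (e : Edge d) :
    ∫ x, ∑ z : Fin d → Fin m, minWeight (pathSets K 0 v) a x ((shift (boxVec z)).symm e)
      ∂(edgeLaw d ν) ≤
    k + (m : ℝ) ^ d * ((m : ℝ) ^ d * (2 * Real.exp (-k)) + (m : ℝ) ^ d * ((m : ℝ) ^ d *
      (Real.exp (-δ * (c * k)) * (∫ y : ℝ≥0, Real.exp (δ * y) ∂ν) ^ (d * m)))) := by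
  obtain ⟨e, he⟩ := e
  induction e using Sym2.ind with
  | _ p q =>
  set P := pathSets K 0 v
  set Z := Fin d → Fin m
  -- It is enough to follow one endpoint of each translate: distinct translations give distinct
  -- endpoints, so a path contains no more of these edges than it makes visits to these points.
  set pt : Z → Fin d → ℤ := fun z => p - boxVec z with hpt
  have hptinj : Injective pt := fun z z' h => boxVec_injective (sub_right_injective h)
  have hdist : ∀ z z' : Z, l1norm (pt z' - pt z) ≤ d * m := by
    intro z z'
    rw [hpt]
    simp only [sub_sub_sub_cancel_left]
    exact l1norm_boxVec_sub_le z z'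
  -- Off `B` the two exclusions of `countP_support_le` hold and each minimizer contains at most `k`
  -- translates; on `B` the trivial bound `m ^ d` is used.
  set B : Set (Config d) := (⋃ z : Z, fastPaths c (pt z) k) ∪
    ⋃ z : Z, ⋃ z' : Z, {x | c * k < pathTime x (shortPath (pt z) (pt z'))} with hB
  have hBm : MeasurableSet B := (MeasurableSet.iUnion fun z => measurableSet_fastPaths c _ k).union
    (MeasurableSet.iUnion fun z => MeasurableSet.iUnion fun z' =>
      measurableSet_lt measurable_const (measurable_pathTime _))
  have hcardZ : (Fintype.card Z : ℝ) = (m : ℝ) ^ d := by simp [Z]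
  have hBμ : (edgeLaw d ν).real B ≤ (m : ℝ) ^ d * (2 * Real.exp (-k)) + (m : ℝ) ^ d * ((m : ℝ) ^ d *
      (Real.exp (-δ * (c * k)) * (∫ y : ℝ≥0, Real.exp (δ * y) ∂ν) ^ (d * m))) := by
    refine (measureReal_union_le _ _).trans (add_le_add ?_ ?_)
    · refine (measureReal_iUnion_fintype_le _).trans ?_
      calc _ ≤ ∑ _z : Z, 2 * Real.exp (-k) :=
            Finset.sum_le_sum fun z _ => measure_fastPaths_le hc hρ _ _
        _ = _ := by rw [Finset.sum_const, nsmul_eq_mul, Finset.card_univ, hcardZ]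
    · refine (measureReal_iUnion_fintype_le _).trans ?_
      calc _ ≤ ∑ _z : Z, ∑ _z' : Z,
            (Real.exp (-δ * (c * k)) * (∫ y : ℝ≥0, Real.exp (δ * y) ∂ν) ^ (d * m)) :=
            Finset.sum_le_sum fun z _ => (measureReal_iUnion_fintype_le _).trans
              (Finset.sum_le_sum fun z' _ => measure_lt_pathTime_le hδ hexpi _ _ (hdist z z') _)
        _ = _ := by simp only [Finset.sum_const, nsmul_eq_mul, Finset.card_univ, hcardZ]
  have hpoint : ∀ x, ∑ z : Z, minWeight P a x ((shift (boxVec z)).symm ⟨s(p, q), he⟩) ≤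
      k + (m : ℝ) ^ d * B.indicator (fun _ => (1 : ℝ)) x := by
    intro x
    by_cases hx : x ∈ B
    · rw [Set.indicator_of_mem hx, mul_one]
      calc _ ≤ ∑ _z : Z, (1 : ℝ) :=
            Finset.sum_le_sum fun z _ => (upperGradient_capMin P a).le_one x _
        _ = (m : ℝ) ^ d := by rw [Finset.sum_const, nsmul_eq_mul, Finset.card_univ, hcardZ, mul_one]
        _ ≤ _ := by linarith [(Nat.cast_nonneg k : (0 : ℝ) ≤ k)]
    · rw [Set.indicator_of_notMem hx, mul_zero, add_zero]
      simp only [hB, Set.mem_union, Set.mem_iUnion, not_or, not_exists] at hx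
      refine sum_minWeight_le Finset.univ (fun z => (shift (boxVec z)).symm ⟨s(p, q), he⟩) x
        (Nat.cast_nonneg k) fun s hs => ?_
      obtain ⟨α, hα, hK, rfl⟩ := mem_pathSets.1 (mem_minimizers.1 hs).1
      rw [Nat.cast_le]
      have hcount := countP_support_le (k := k) hc.le (fun u => decide (∃ z, u = pt z)) hα hK hs
        (by
          rintro u u' hu hu'
          simp only [decide_eq_true_eq] at hu hu'
          obtain ⟨z, rfl⟩ := hu
          obtain ⟨z', rfl⟩ := hu'
          exact (hdist z z').trans hk)
        (by
          intro u hu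
          simp only [decide_eq_true_eq] at hu
          obtain ⟨z, rfl⟩ := hu
          exact hx.1 z)
        (by
          rintro u u' hu hu'
          simp only [decide_eq_true_eq] at hu hu'
          obtain ⟨z, rfl⟩ := hu
          obtain ⟨z', rfl⟩ := hu'
          exact not_lt.1 (hx.2 z z'))
      refine le_trans ?_ hcount
      rw [List.countP_eq_length_filter]
      refine le_trans ?_ (List.toFinset_card_le _)
      refine Finset.card_le_card_of_injOn pt ?_ hptinj.injOn
      intro z hz
      have hz' := (Finset.mem_filter.1 (Finset.mem_coe.1 hz)).2
      rw [mem_edgeFin, shift_symm_val] at hz'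
      have := α.fst_mem_support_of_mem_edges hz'
      simp only [List.coe_toFinset, Set.mem_ofPred_eq, List.mem_filter, decide_eq_true_eq]
      exact ⟨this, z, rfl⟩
  have hi : Integrable (fun x => (k : ℝ) + (m : ℝ) ^ d * B.indicator (fun _ => (1 : ℝ)) x)
      (edgeLaw d ν) :=
    (integrable_const _).add (((integrable_const (1 : ℝ)).indicator hBm).const_mul _)
  refine (integral_mono_of_nonneg (ae_of_all _ fun x => Finset.sum_nonneg fun z _ =>
    (upperGradient_capMin P a).nonneg x _) hi (ae_of_all _ hpoint)).trans ?_
  rw [integral_add (integrable_const _) (((integrable_const (1 : ℝ)).indicator hBm).const_mul _),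
    integral_const_mul, integral_indicator_const _ hBm]
  simp only [integral_const, probReal_univ, smul_eq_mul, one_mul, mul_one]
  gcongr

end LatticeProbability

end FPP

namespace FPP

open scoped BigOperators Topology
open Function Filter

/-! ### The smoothed passage time and its exponential moments. -/

section Smoothing

variable {d : ℕ} {ν : Measure ℝ≥0} [IsProbabilityMeasure ν]

lemma pow_mul_exp_neg_le_factorial {x : ℝ} (hx : 0 ≤ x) (N : ℕ) :
    x ^ N * Real.exp (-x) ≤ N.factorial := by
  have h := Real.pow_div_factorial_le_exp x hx N
  rw [div_le_iff₀ (by positivity)] at h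
  rw [Real.exp_neg, ← div_eq_mul_inv, div_le_iff₀ (Real.exp_pos x)]
  linarith

lemma pow_eq_exp_mul_log {D : ℝ} (hD : 0 < D) (n : ℕ) : D ^ n = Real.exp (n * Real.log D) := by
  rw [Real.exp_nat_mul, Real.exp_log hD]

open Classical in
/-- The expected number of translates of an edge by a box of side `m` that lie on a minimizing path
is of order `m`. -/
lemma exists_integral_sum_minWeight_le {δ : ℝ} (hδ : 0 < δ)
    (hexpi : Integrable (fun y : ℝ≥0 => Real.exp (δ * y)) ν) {c : ℝ} (hc : 0 < c)
    (hρ : 2 * d * Real.exp 1 * ∫ y : ℝ≥0, Real.exp (-c⁻¹ * y) ∂ν ≤ Real.exp (-1)) :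
    ∃ C : ℝ, 0 ≤ C ∧ ∀ (K : ℕ) (a : ℝ) (v : Fin d → ℤ) (m : ℕ), 1 ≤ m → ∀ e : Edge d,
      ∫ x, ∑ z : Fin d → Fin m, minWeight (pathSets K 0 v) a x ((shift (boxVec z)).symm e)
        ∂(edgeLaw d ν) ≤ C * m := by
  set D := ∫ y : ℝ≥0, Real.exp (δ * y) ∂ν with hDdef
  have hD : 1 ≤ D := one_le_integral_exp hδ.le hexpi
  obtain ⟨N, hN⟩ := exists_nat_ge ((d * Real.log D + 1) / (δ * c))
  rw [div_le_iff₀ (by positivity)] at hN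
  -- With `k = C' * m`, the term `d` ensures `d * m ≤ k`, the term `1` gives `exp (-k) ≤ exp (-m)`,
  -- and `N` makes `exp (-δ c k)` absorb `D ^ (d * m)` with a factor `exp (-m)` left. That factor
  -- absorbs the powers of `m`.
  set C' := N + d + 1 with hC'
  refine ⟨C' + 2 * (2 * d).factorial + (3 * d).factorial, by positivity, ?_⟩
  intro K a v m hm e
  have hm' : (1 : ℝ) ≤ m := by exact_mod_cast hm
  have hk : d * m ≤ C' * m := Nat.mul_le_mul_right m (by omega)
  refine (integral_sum_minWeight_le hδ.le hexpi hc hρ K a v hk e).trans ?_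
  have h1 : Real.exp (-((C' * m : ℕ) : ℝ)) ≤ Real.exp (-m) := by
    refine Real.exp_le_exp.2 (neg_le_neg ?_)
    exact_mod_cast Nat.le_mul_of_pos_left m (by omega)
  have h2 : Real.exp (-δ * (c * ((C' * m : ℕ) : ℝ))) * D ^ (d * m) ≤ Real.exp (-m) := by
    rw [pow_eq_exp_mul_log (by linarith), ← Real.exp_add]
    refine Real.exp_le_exp.2 ?_
    have h3 : (N : ℝ) ≤ C' := by exact_mod_cast (by omega : N ≤ C')
    have h4 : d * Real.log D + 1 ≤ C' * (δ * c) :=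
      hN.trans (mul_le_mul_of_nonneg_right h3 (by positivity))
    have h5 := mul_le_mul_of_nonneg_right h4 (by positivity : (0 : ℝ) ≤ m)
    push_cast
    linarith
  have h3 := pow_mul_exp_neg_le_factorial (Nat.cast_nonneg m : (0 : ℝ) ≤ m) (2 * d)
  have h4 := pow_mul_exp_neg_le_factorial (Nat.cast_nonneg m : (0 : ℝ) ≤ m) (3 * d)
  calc _ ≤ ((C' * m : ℕ) : ℝ) + (m : ℝ) ^ d * ((m : ℝ) ^ d * (2 * Real.exp (-m)) +
        (m : ℝ) ^ d * ((m : ℝ) ^ d * Real.exp (-m))) := by gcongr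
    _ = C' * m + 2 * ((m : ℝ) ^ (2 * d) * Real.exp (-m)) + (m : ℝ) ^ (3 * d) * Real.exp (-m) := by
        push_cast
        ring
    _ ≤ C' * m + 2 * ((2 * d).factorial * m) + (3 * d).factorial * m := by
        have h5 : ((2 * d).factorial : ℝ) ≤ (2 * d).factorial * m :=
          le_mul_of_one_le_right (by positivity) hm'
        have h6 : ((3 * d).factorial : ℝ) ≤ (3 * d).factorial * m :=
          le_mul_of_one_le_right (by positivity) hm'
        linarith
    _ = _ := by ring

/-- The average over the translations by a box of side `m` of the minimal time of the paths of
length at most `K` from `0` to `v`, capped at `c * K`. -/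
noncomputable def smoothTime (c : ℝ) (K m : ℕ) (v : Fin d → ℤ) (x : Config d) : ℝ :=
  𝔼 z : Fin d → Fin m, capMin (pathSets K 0 v) (c * K) (x ∘ shift (boxVec z))

lemma measurable_smoothTime (c : ℝ) (K m : ℕ) (v : Fin d → ℤ) :
    Measurable (smoothTime c K m v) := by
  unfold smoothTime
  simp only [Fintype.expect_eq_sum_div_card]
  refine Measurable.div_const (Finset.measurable_fun_sum _ fun z _ =>
    (measurable_capMin _ _).comp ?_) _
  fun_prop

lemma smoothTime_nonneg {c : ℝ} (hc : 0 ≤ c) (K m : ℕ) (v : Fin d → ℤ) (x : Config d) :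
    0 ≤ smoothTime c K m v x :=
  Finset.expect_nonneg fun _ _ => capMin_nonneg (by positivity) _

lemma smoothTime_le {c : ℝ} (K : ℕ) {m : ℕ} (hm : 1 ≤ m) (v : Fin d → ℤ) (x : Config d) :
    smoothTime c K m v x ≤ c * K := by
  have : NeZero m := ⟨by omega⟩
  refine (Finset.expect_le_expect fun z _ => capMin_le_cap _).trans ?_
  simp

lemma integrable_mul_exp {δ : ℝ} (hδ : 0 < δ)
    (hexpi : Integrable (fun y : ℝ≥0 => Real.exp (δ * y)) ν) :
    Integrable (fun y : ℝ≥0 => (y : ℝ) * Real.exp (δ / 2 * y)) ν := by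
  refine (hexpi.const_mul (2 / δ)).mono' (by fun_prop) (ae_of_all _ fun y => ?_)
  rw [Real.norm_of_nonneg (by positivity)]
  have h1 : (y : ℝ) ≤ 2 / δ * Real.exp (δ / 2 * y) := by
    have := Real.add_one_le_exp (δ / 2 * y)
    calc (y : ℝ) = 2 / δ * (δ / 2 * y) := by field_simp
      _ ≤ _ := by gcongr; linarith
  calc _ ≤ 2 / δ * Real.exp (δ / 2 * y) * Real.exp (δ / 2 * y) := by gcongr
    _ = _ := by rw [mul_assoc, ← Real.exp_add]; ring_nf

/-- Variance bound for the exponentials of the smoothed passage time. -/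
theorem exists_variance_exp_smoothTime_le (hd : 2 ≤ d) (hν : IsNearlyGamma ν) {δ : ℝ} (hδ : 0 < δ)
    (hexpi : Integrable (fun y : ℝ≥0 => Real.exp (δ * y)) ν) {c : ℝ} (hc : 0 < c)
    (hρ : 2 * d * Real.exp 1 * ∫ y : ℝ≥0, Real.exp (-c⁻¹ * y) ∂ν ≤ Real.exp (-1)) :
    ∃ A : ℝ, 0 ≤ A ∧ ∀ (K m : ℕ) (v : Fin d → ℤ), 1 ≤ m → ∀ θ : ℝ, |θ| ≤ min 1 δ →
      ((∫ x, Real.exp (θ * smoothTime c K m v x) ∂(edgeLaw d ν)) -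
        (∫ x, Real.exp (θ / 2 * smoothTime c K m v x) ∂(edgeLaw d ν)) ^ 2) * (1 + Real.log m) ≤
      A * K * θ ^ 2 * ∫ x, Real.exp (θ * smoothTime c K m v x) ∂(edgeLaw d ν) := by
  classical
  obtain ⟨R, L, T, hL, hR, hR0, hT, hνT⟩ := hν.exists_lipschitz
  obtain ⟨C, hC, hinf⟩ := exists_integral_sum_minWeight_le (d := d) hδ hexpi hc hρ
  set D := ∫ y : ℝ≥0, (y : ℝ) * Real.exp (δ / 2 * y) ∂ν
  refine ⟨D ^ 2 * C + 48 * L ^ 2 * c, by positivity, fun K m v hm θ hθ => ?_⟩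
  have : NeZero m := ⟨by omega⟩
  have hm' : (1 : ℝ) ≤ m := by exact_mod_cast hm
  have hm0 : (0 : ℝ) < m := by linarith
  have key := variance_exp_expect_capMin_le hL hR hR0 T hT hνT (pathSets K (0 : Fin d → ℤ) v)
    (c := c * K) (by positivity) (fun z : Fin d → Fin m => shift (boxVec z))
    (integrable_mul_exp hδ hexpi) le_rfl (b := C * m) (by positivity)
    (fun e => hinf K (c * K) v m hm e) (W := K) (by positivity)
    (fun p hp => by
      obtain ⟨α, hα, hK, rfl⟩ := mem_pathSets.1 hp
      rw [card_edgeFin hα]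
      exact_mod_cast hK)
    (hθ.trans (min_le_left _ _)) (by linarith [hθ.trans (min_le_right _ _)])
    (σ := (m : ℝ)⁻¹) (by positivity)
  have hsq : ∀ x : Config d, Real.exp (θ / 2 * smoothTime c K m v x) ^ 2 =
      Real.exp (θ * smoothTime c K m v x) := fun x => by
    rw [← Real.exp_nat_mul]
    push_cast
    ring_nf
  change ((∫ x, Real.exp (θ / 2 * smoothTime c K m v x) ^ 2 ∂(edgeLaw d ν)) -
    (∫ x, Real.exp (θ / 2 * smoothTime c K m v x) ∂(edgeLaw d ν)) ^ 2) * _ ≤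
    _ * ∫ x, Real.exp (θ / 2 * smoothTime c K m v x) ^ 2 ∂(edgeLaw d ν) at key
  simp only [hsq] at key
  rw [Real.log_inv, sub_neg_eq_add] at key
  refine key.trans (mul_le_mul_of_nonneg_right (mul_le_mul_of_nonneg_right ?_ (sq_nonneg θ))
    (integral_nonneg fun x => (Real.exp_pos _).le))
  -- Here `d ≥ 2` matters: the mean weights are at most `C * m / m ^ d ≤ C / m`, which compensates
  -- `σ⁻¹ = m`, while `1 - log σ = 1 + log m` is gained on the other side.
  have hcard : (m : ℝ) * (C * m / Fintype.card (Fin d → Fin m)) ≤ C := by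
    rw [← mul_div_assoc, div_le_iff₀ (by simp; positivity)]
    have : (m : ℝ) ^ 2 ≤ m ^ d := pow_le_pow_right₀ hm' hd
    simp only [Fintype.card_pi, Fintype.card_fin, Finset.prod_const, Finset.card_univ, Nat.cast_pow]
    nlinarith
  have h2 : (0 : ℝ) ≤ D ^ 2 * K := by positivity
  have h3 := mul_le_mul_of_nonneg_right hcard h2
  rw [inv_inv]
  linarith

/-- For a box of side about `n ^ (1 / 4)` the gain `1 + log m` is comparable to `log n`: rounding
still leaves `n ≤ (2 * m) ^ 4`, and `log 2 < 1`. -/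
lemma log_le_four_mul (n : ℕ) (hn : 1 ≤ n) :
    Real.log n ≤ 4 * (1 + Real.log (Nat.sqrt (Nat.sqrt n))) := by
  set r := Nat.sqrt n
  set m := Nat.sqrt r
  have h1 : n < (r + 1) * (r + 1) := Nat.lt_succ_sqrt n
  have h2 : r < (m + 1) * (m + 1) := Nat.lt_succ_sqrt r
  have hr : 1 ≤ r := Nat.sqrt_pos.2 hn
  have hm : 1 ≤ m := Nat.sqrt_pos.2 hr
  have h3 : n ≤ (2 * m) ^ 4 := by
    have h4 : r + 1 ≤ (2 * m) ^ 2 := by nlinarith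
    calc n ≤ (r + 1) * (r + 1) := h1.le
      _ ≤ (2 * m) ^ 2 * (2 * m) ^ 2 := Nat.mul_le_mul h4 h4
      _ = _ := by ring
  have h4 : Real.log n ≤ Real.log ((2 * m : ℝ) ^ 4) :=
    Real.log_le_log (by exact_mod_cast hn) (by exact_mod_cast h3)
  have hm0 : (m : ℝ) ≠ 0 := by positivity
  rw [Real.log_pow, Real.log_mul two_ne_zero hm0] at h4
  have := Real.log_two_lt_d9
  push_cast at h4
  linarith

/-- Exponential moments of the smoothed passage time at the scale of its fluctuations. -/
theorem exists_integral_exp_smoothTime_sub_le (hd : 2 ≤ d) (hν : IsNearlyGamma ν) {δ : ℝ}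
    (hδ : 0 < δ) (hexpi : Integrable (fun y : ℝ≥0 => Real.exp (δ * y)) ν) {c : ℝ} (hc : 0 < c)
    (hρ : 2 * d * Real.exp 1 * ∫ y : ℝ≥0, Real.exp (-c⁻¹ * y) ∂ν ≤ Real.exp (-1)) (C : ℕ) :
    ∃ η : ℝ, 0 < η ∧ ∀ (n : ℕ) (v : Fin d → ℤ), 2 ≤ n → ∀ ε : ℝ, |ε| = 1 →
      ∫ x, Real.exp (ε * (η / √(n / Real.log n)) *
        (smoothTime c (C * n) (Nat.sqrt (Nat.sqrt n)) v x -
          ∫ y, smoothTime c (C * n) (Nat.sqrt (Nat.sqrt n)) v y ∂(edgeLaw d ν))) ∂(edgeLaw d ν) ≤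
        Real.exp 2 := by
  obtain ⟨A, hA, hvar⟩ := exists_variance_exp_smoothTime_le hd hν hδ hexpi hc hρ
  set B : ℝ := 4 * A * C + 1 with hB
  have hB0 : 0 < B := by positivity
  set θ₁ : ℝ := min 1 δ with hθ₁
  have hθ₁0 : 0 < θ₁ := by positivity
  -- With `K = B * q ^ 2` and `|θ| = η / q`, the second bound gives `K * θ ^ 2 ≤ 1 / 2`, hence the
  -- final `exp (4 * K * θ ^ 2) ≤ exp 2`; the first keeps `θ` in the range of the variance bound.
  set η : ℝ := min θ₁ (√(2 * B))⁻¹ with hη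
  have hη0 : 0 < η := by positivity
  refine ⟨η, hη0, fun n v hn ε hε => ?_⟩
  set m := Nat.sqrt (Nat.sqrt n)
  have hm : 1 ≤ m := Nat.sqrt_pos.2 (Nat.sqrt_pos.2 (by omega))
  have hn' : (2 : ℝ) ≤ n := by exact_mod_cast hn
  have hlog : 0 < Real.log n := Real.log_pos (by linarith)
  have hq1 : 1 ≤ (n : ℝ) / Real.log n := by
    rw [le_div_iff₀ hlog, one_mul]
    linarith [Real.log_le_sub_one_of_pos (by linarith : (0 : ℝ) < n)]
  set q := √(n / Real.log n) with hq
  have hqs : q ^ 2 = n / Real.log n := Real.sq_sqrt (by positivity)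
  have hq1' : 1 ≤ q := Real.one_le_sqrt.2 hq1
  set F := smoothTime c (C * n) m v with hF
  set M := ∫ y, F y ∂(edgeLaw d ν) with hM
  have hFm : Measurable F := measurable_smoothTime _ _ _ _
  have hF0 : ∀ x, 0 ≤ F x := smoothTime_nonneg hc.le _ _ _
  have hF1 : ∀ x, F x ≤ c * (C * n : ℕ) := smoothTime_le _ hm v
  have hFi : Integrable F (edgeLaw d ν) := Integrable.of_bound hFm.aestronglyMeasurable _
    (ae_of_all _ fun x => by rw [Real.norm_of_nonneg (hF0 x)]; exact hF1 x)
  have hbd : ∀ x, |F x - M| ≤ c * (C * n : ℕ) := by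
    intro x
    have h0 : 0 ≤ M := integral_nonneg hF0
    have h1 : M ≤ c * (C * n : ℕ) := by
      have := integral_mono hFi (integrable_const (μ := edgeLaw d ν) _) hF1
      simpa using this
    rw [abs_le]
    constructor <;> linarith [hF0 x, hF1 x]
  have hlogm : 0 < 1 + Real.log m := by
    have := Real.log_nonneg (by exact_mod_cast hm : (1 : ℝ) ≤ m)
    linarith
  have hvar' : ∀ θ : ℝ, |θ| ≤ θ₁ → (∫ x, Real.exp (θ * (F x - M)) ∂(edgeLaw d ν)) -
      (∫ x, Real.exp (θ / 2 * (F x - M)) ∂(edgeLaw d ν)) ^ 2 ≤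
      B * q ^ 2 * θ ^ 2 * ∫ x, Real.exp (θ * (F x - M)) ∂(edgeLaw d ν) := by
    intro θ hθ
    have h1 := hvar (C * n) m v hm θ hθ
    have hcen : ∀ t : ℝ, ∫ x, Real.exp (t * (F x - M)) ∂(edgeLaw d ν) =
        Real.exp (-(t * M)) * ∫ x, Real.exp (t * F x) ∂(edgeLaw d ν) := fun t => by
      rw [← integral_const_mul]
      congr 1
      funext x
      rw [← Real.exp_add]
      ring_nf
    rw [hcen θ, hcen (θ / 2), mul_pow, ← Real.exp_nat_mul]
    have h2 : ((2 : ℕ) : ℝ) * -(θ / 2 * M) = -(θ * M) := by push_cast; ring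
    rw [h2, ← mul_sub]
    set I := ∫ x, Real.exp (θ * F x) ∂(edgeLaw d ν)
    have hI : 0 ≤ I := integral_nonneg fun x => (Real.exp_pos _).le
    rw [← mul_assoc, mul_comm _ (Real.exp _), mul_assoc]
    refine mul_le_mul_of_nonneg_left ?_ (Real.exp_pos _).le
    refine ((le_div_iff₀ hlogm).2 h1).trans ?_
    rw [div_le_iff₀ hlogm]
    have h3 : A * (C * n : ℕ) ≤ B * q ^ 2 * (1 + Real.log m) := by
      rw [hqs]
      have h4 := log_le_four_mul n (by omega)
      have h5 : (n : ℝ) ≤ n / Real.log n * (4 * (1 + Real.log m)) := by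
        rw [div_mul_eq_mul_div, le_div_iff₀ hlog]
        exact mul_le_mul_of_nonneg_left h4 (by positivity)
      have h6 : 0 ≤ (n : ℝ) / Real.log n * (1 + Real.log m) := by positivity
      have h7 := mul_le_mul_of_nonneg_left h5 (by positivity : 0 ≤ A * C)
      push_cast
      rw [hB]
      linarith
    have h4 : 0 ≤ θ ^ 2 * I := by positivity
    have h5 := mul_le_mul_of_nonneg_right h3 h4
    linarith
  have hεs : (ε * (η / q)) ^ 2 = η ^ 2 / q ^ 2 := by
    rw [mul_pow, ← sq_abs, hε]; ring
  have hBη : B * η ^ 2 ≤ 1 / 2 := by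
    have h1 : η ^ 2 ≤ ((√(2 * B))⁻¹) ^ 2 := pow_le_pow_left₀ hη0.le (min_le_right _ _) 2
    rw [inv_pow, Real.sq_sqrt (by positivity)] at h1
    calc B * η ^ 2 ≤ B * (2 * B)⁻¹ := mul_le_mul_of_nonneg_left h1 hB0.le
      _ = _ := by field_simp
  have hKθ : B * q ^ 2 * (ε * (η / q)) ^ 2 ≤ 1 / 2 := by
    rw [hεs]
    calc _ = B * η ^ 2 := by field_simp
      _ ≤ _ := hBη
  refine (integral_exp_le_of_variance_le (μ := edgeLaw d ν) (X := fun x => F x - M)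
    (hFm.sub_const M) hbd ?_ (K := B * q ^ 2) (θ₁ := θ₁) (by positivity) hvar' ?_ hKθ).trans ?_
  · rw [integral_sub hFi (integrable_const _)]
    simp [hM]
  · rw [abs_mul, hε, one_mul, abs_of_pos (by positivity)]
    exact (div_le_self hη0.le hq1').trans (min_le_left _ _)
  · refine Real.exp_le_exp.2 ?_
    linarith

end Smoothing

end FPP

namespace FPP

open scoped BigOperators Topology
open Function Filter

/-! ### Comparison of the passage time with its smoothed version. -/

section Comparison

variable {d : ℕ} {ν : Measure ℝ≥0} [IsProbabilityMeasure ν]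

instance (u v : Fin d → ℤ) : Countable ((lattice d).Walk u v) :=
  Injective.countable (f := SimpleGraph.Walk.support) fun _ _ h => SimpleGraph.Walk.ext_support h

lemma measurable_passageTime (u v : Fin d → ℤ) :
    Measurable fun x : Config d => passageTime x u v := by
  unfold passageTime
  exact Measurable.iInf fun α => measurable_pathTime α

lemma integrable_pathTime {δ : ℝ} (hδ : 0 < δ)
    (hexpi : Integrable (fun y : ℝ≥0 => Real.exp (δ * y)) ν) (u v : Fin d → ℤ) :
    Integrable (fun x => pathTime x (shortPath u v)) (edgeLaw d ν) := by
  refine ((integrable_exp_pathTime hexpi u v).const_mul δ⁻¹).mono'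
    (measurable_pathTime _).aestronglyMeasurable (ae_of_all _ fun x => ?_)
  rw [Real.norm_of_nonneg (pathTime_nonneg x _)]
  have := Real.add_one_le_exp (δ * pathTime x (shortPath u v))
  rw [inv_mul_eq_div, le_div_iff₀ hδ]
  linarith

lemma integrable_passageTime {δ : ℝ} (hδ : 0 < δ)
    (hexpi : Integrable (fun y : ℝ≥0 => Real.exp (δ * y)) ν) (u v : Fin d → ℤ) :
    Integrable (fun x => passageTime x u v) (edgeLaw d ν) :=
  (integrable_pathTime hδ hexpi u v).mono' (measurable_passageTime u v).aestronglyMeasurable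
    (ae_of_all _ fun x => by
      rw [Real.norm_of_nonneg (passageTime_nonneg x u v)]
      exact passageTime_le x _)

lemma exp_add_le (a b : ℝ) : Real.exp (a + b) ≤ (Real.exp (2 * a) + Real.exp (2 * b)) / 2 := by
  rw [Real.exp_add, two_mul, two_mul, Real.exp_add, Real.exp_add]
  nlinarith [sq_nonneg (Real.exp a - Real.exp b)]

lemma exp_expect_le {κ : Type*} [Fintype κ] [Nonempty κ] (f : κ → ℝ) :
    Real.exp (𝔼 z, f z) ≤ 𝔼 z, Real.exp (f z) := by
  set a := 𝔼 z, f z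
  have h : ∀ z, Real.exp a * (f z - a + 1) ≤ Real.exp (f z) := fun z => by
    calc _ ≤ Real.exp a * Real.exp (f z - a) :=
          mul_le_mul_of_nonneg_left (Real.add_one_le_exp _) (Real.exp_pos _).le
      _ = _ := by rw [← Real.exp_add]; ring_nf
  calc Real.exp a = 𝔼 z, Real.exp a * (f z - a + 1) := by
        rw [← Finset.mul_expect, Finset.expect_add_distrib, Finset.expect_sub_distrib]
        simp [a]
    _ ≤ _ := Finset.expect_le_expect fun z _ => h z

lemma abs_passageTime_sub_le (x : Config d) (u v w : Fin d → ℤ) :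
    |passageTime x u v - passageTime x u w| ≤
      pathTime x (shortPath v w) + pathTime x (shortPath w v) := by
  have h1 := passageTime_triangle x u v w
  have h2 := passageTime_triangle x u w v
  have h3 := pathTime_nonneg x (shortPath v w)
  have h4 := pathTime_nonneg x (shortPath w v)
  rw [abs_le]
  constructor <;> linarith

/-- For a large constant `C`, restricting to paths of length at most `C * |v|` and capping the time
has a bounded effect on the passage time. -/
lemma exists_integral_exp_passageTime_sub_capMin_le {δ : ℝ} (hδ : 0 < δ)
    (hexpi : Integrable (fun y : ℝ≥0 => Real.exp (δ * y)) ν) {c : ℝ} (hc : 0 < c)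
    (hρ : 2 * d * Real.exp 1 * ∫ y : ℝ≥0, Real.exp (-c⁻¹ * y) ∂ν ≤ Real.exp (-1)) :
    ∃ C : ℕ, ∀ v : Fin d → ℤ, 1 ≤ l1norm v →
      Integrable (fun x => Real.exp (δ / 2 * |passageTime x 0 v -
        capMin (pathSets (C * l1norm v) 0 v) (c * (C * l1norm v : ℕ)) x|)) (edgeLaw d ν) ∧
      ∫ x, Real.exp (δ / 2 * |passageTime x 0 v -
        capMin (pathSets (C * l1norm v) 0 v) (c * (C * l1norm v : ℕ)) x|) ∂(edgeLaw d ν) ≤ 2 := by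
  classical
  set D := ∫ y : ℝ≥0, Real.exp (δ * y) ∂ν with hDdef
  have hD : 1 ≤ D := one_le_integral_exp hδ.le hexpi
  have hlD : 0 ≤ Real.log D := Real.log_nonneg hD
  -- `N₁` and `N₂` make the fast and the slow part of the bad event so unlikely that its probability
  -- beats `D ^ n`, with bounds `2 * (1 / 4)` and `1 / 2` that sum to one.
  obtain ⟨N₁, hN₁⟩ := exists_nat_ge (Real.log D + 2)
  obtain ⟨N₂, hN₂⟩ := exists_nat_ge ((2 * Real.log D + 1) / (δ * c))
  rw [div_le_iff₀ (by positivity)] at hN₂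
  refine ⟨N₁ + N₂ + 1, fun v hv => ?_⟩
  set C := N₁ + N₂ + 1 with hC
  set n := l1norm v with hn
  set K := C * n with hK
  have hn1 : (1 : ℝ) ≤ n := by exact_mod_cast hv
  have hvK : l1norm (v - 0) ≤ K := by
    rw [sub_zero]
    exact Nat.le_mul_of_pos_left n (by omega)
  set pt : Config d → ℝ := fun x => pathTime x (shortPath 0 v) with hpt
  have hpti : Integrable (fun x => Real.exp (δ * pt x)) (edgeLaw d ν) :=
    integrable_exp_pathTime hexpi 0 v
  set B : Config d → ℝ := fun x => |passageTime x 0 v - capMin (pathSets K 0 v) (c * K) x| with hB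
  have hBm : Measurable B := by
    exact ((measurable_passageTime 0 v).sub (measurable_capMin _ _)).abs
  have hBpt : ∀ x, B x ≤ pt x := fun x =>
    abs_passageTime_sub_capMin_le x (by positivity) hvK
  have hBi : Integrable (fun x => Real.exp (δ / 2 * B x)) (edgeLaw d ν) := by
    refine hpti.mono' (by fun_prop) (ae_of_all _ fun x => ?_)
    rw [Real.norm_of_nonneg (Real.exp_pos _).le]
    refine Real.exp_le_exp.2 ?_
    have := hBpt x
    have := abs_nonneg (passageTime x 0 v - capMin (pathSets K 0 v) (c * K) x)
    calc δ / 2 * B x ≤ δ * B x := mul_le_mul_of_nonneg_right (by linarith) this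
      _ ≤ _ := mul_le_mul_of_nonneg_left (hBpt x) hδ.le
  refine ⟨hBi, ?_⟩
  set bad : Set (Config d) := fastPaths c 0 K ∪ {x | c * K < pt x} with hbad
  have hbadm : MeasurableSet bad := (measurableSet_fastPaths c 0 K).union
    (measurableSet_lt measurable_const (measurable_pathTime _))
  have hDn : 0 < D ^ n := by positivity
  have hP : (edgeLaw d ν).real bad * D ^ n ≤ 1 := by
    have h1 : (edgeLaw d ν).real bad ≤ 2 * Real.exp (-K) + Real.exp (-δ * (c * K)) * D ^ n :=
      (measureReal_union_le _ _).trans (add_le_add (measure_fastPaths_le hc hρ _ _)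
        (measure_lt_pathTime_le hδ.le hexpi _ _ (by rw [sub_zero]) _))
    refine (mul_le_mul_of_nonneg_right h1 hDn.le).trans ?_
    have hKe : (K : ℝ) = C * n := by rw [hK]; push_cast; rfl
    have hC1 : (N₁ : ℝ) ≤ C := by exact_mod_cast (by omega : N₁ ≤ C)
    have hC2 : (N₂ : ℝ) ≤ C := by exact_mod_cast (by omega : N₂ ≤ C)
    have e1 : Real.exp (-1) ≤ 1 / 2 := by
      rw [Real.exp_neg, one_div]
      exact inv_anti₀ two_pos (by have := Real.add_one_le_exp (1 : ℝ); linarith)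
    have h2 : Real.exp (-K) * D ^ n ≤ Real.exp (-1) * Real.exp (-1) := by
      rw [pow_eq_exp_mul_log (by linarith), ← Real.exp_add, ← Real.exp_add]
      refine Real.exp_le_exp.2 ?_
      have := mul_le_mul_of_nonneg_right (hN₁.trans hC1) (by linarith : (0 : ℝ) ≤ n)
      rw [hKe]
      linarith
    have h3 : Real.exp (-δ * (c * K)) * D ^ n * D ^ n ≤ Real.exp (-1) := by
      rw [pow_eq_exp_mul_log (by linarith), ← Real.exp_add, ← Real.exp_add]
      refine Real.exp_le_exp.2 ?_
      have h4 := hN₂.trans (mul_le_mul_of_nonneg_right hC2 (by positivity : 0 ≤ δ * c))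
      have := mul_le_mul_of_nonneg_right h4 (by linarith : (0 : ℝ) ≤ n)
      rw [hKe]
      linarith
    have h4 : Real.exp (-1) * Real.exp (-1) ≤ 1 / 2 * (1 / 2) :=
      mul_le_mul e1 e1 (Real.exp_pos _).le (by norm_num)
    rw [add_mul]
    linarith
  -- On the bad event, weighted AM-GM separates the indicator from the exponential moment. The three
  -- terms then integrate to at most `1`, `1 / 2` and `1 / 2`.
  have hpoint : ∀ x, Real.exp (δ / 2 * B x) ≤ 1 + (1 / 2 * D ^ n) * bad.indicator (fun _ => 1) x +
      (1 / 2 * (D ^ n)⁻¹) * Real.exp (δ * pt x) := by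
    intro x
    by_cases hx : x ∈ bad
    · rw [Set.indicator_of_mem hx]
      have h1 : Real.exp (δ / 2 * B x) ≤ Real.exp (δ / 2 * pt x) :=
        Real.exp_le_exp.2 (mul_le_mul_of_nonneg_left (hBpt x) (by positivity))
      have h2 : Real.exp (δ * pt x) = Real.exp (δ / 2 * pt x) ^ 2 := by
        rw [← Real.exp_nat_mul]; push_cast; ring_nf
      rw [h2]
      set E := Real.exp (δ / 2 * pt x)
      have h3 : 0 ≤ 1 / 2 * (D ^ n)⁻¹ * (D ^ n - E) ^ 2 := by positivity
      have h4 : 1 / 2 * (D ^ n)⁻¹ * (D ^ n - E) ^ 2 =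
          1 / 2 * D ^ n * 1 + 1 / 2 * (D ^ n)⁻¹ * E ^ 2 - E := by
        field_simp
        ring
      linarith
    · rw [Set.indicator_of_notMem hx]
      simp only [hbad, Set.mem_union, not_or] at hx
      have h1 : B x = 0 := by
        have := capMin_eq_passageTime hc.le hvK hx.1 (not_lt.1 hx.2)
        simp [hB, this]
      rw [h1, mul_zero, Real.exp_zero]
      have : 0 ≤ 1 / 2 * (D ^ n)⁻¹ * Real.exp (δ * pt x) := by positivity
      linarith
  have hi1 : Integrable (fun x => (1 : ℝ) + (1 / 2 * D ^ n) * bad.indicator (fun _ => 1) x)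
      (edgeLaw d ν) :=
    (integrable_const _).add (((integrable_const (1 : ℝ)).indicator hbadm).const_mul _)
  refine (integral_mono hBi (hi1.add (hpti.const_mul _)) hpoint).trans ?_
  have h5 := integral_exp_pathTime_le (d := d) hδ.le hexpi 0 v (n := n) (by rw [sub_zero])
  simp only [Pi.add_apply]
  rw [integral_add hi1 (hpti.const_mul _), integral_add (integrable_const _)
    (((integrable_const (1 : ℝ)).indicator hbadm).const_mul _), integral_const_mul,
    integral_const_mul, integral_indicator_const _ hbadm]
  simp only [integral_const, probReal_univ, smul_eq_mul, mul_one]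
  have h6 : (D ^ n)⁻¹ * ∫ x, Real.exp (δ * pt x) ∂(edgeLaw d ν) ≤ 1 := by
    rw [inv_mul_le_iff₀ hDn, mul_one]
    exact h5
  linarith

/-- The passage time is well approximated by the smoothed passage time. -/
lemma exists_integral_exp_passageTime_sub_smoothTime_le {δ : ℝ} (hδ : 0 < δ)
    (hexpi : Integrable (fun y : ℝ≥0 => Real.exp (δ * y)) ν) {c : ℝ} (hc : 0 < c)
    (hρ : 2 * d * Real.exp 1 * ∫ y : ℝ≥0, Real.exp (-c⁻¹ * y) ∂ν ≤ Real.exp (-1)) :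
    ∃ C : ℕ, ∀ (v : Fin d → ℤ) (m : ℕ), 1 ≤ l1norm v → 1 ≤ m →
      Integrable (fun x => Real.exp (δ / 8 *
        |passageTime x 0 v - smoothTime c (C * l1norm v) m v x|)) (edgeLaw d ν) ∧
      ∫ x, Real.exp (δ / 8 *
        |passageTime x 0 v - smoothTime c (C * l1norm v) m v x|) ∂(edgeLaw d ν) ≤
        2 * (∫ y : ℝ≥0, Real.exp (δ * y) ∂ν) ^ (d * m) := by
  classical
  obtain ⟨C, hcap⟩ := exists_integral_exp_passageTime_sub_capMin_le (d := d) hδ hexpi hc hρ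
  refine ⟨C, fun v m hv hm => ?_⟩
  have : NeZero m := ⟨by omega⟩
  obtain ⟨hBi, hB2⟩ := hcap v hv
  set D := ∫ y : ℝ≥0, Real.exp (δ * y) ∂ν with hDdef
  have hD : 1 ≤ D := one_le_integral_exp hδ.le hexpi
  set K := C * l1norm v with hK
  set B : Config d → ℝ := fun x => |passageTime x 0 v - capMin (pathSets K 0 v) (c * K) x| with hB
  have hB0 : ∀ x, 0 ≤ B x := fun x => abs_nonneg _
  set Y : (Fin d → ℤ) → (Fin d → ℤ) → Config d → ℝ := fun u w x =>
    Real.exp (δ * pathTime x (shortPath u w)) with hY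
  have hYi : ∀ u w, Integrable (Y u w) (edgeLaw d ν) := integrable_exp_pathTime hexpi
  -- `S z` dominates the exponential of the error for the translation `z`: AM-GM gives half the
  -- weight to the capping error and splits the other half among four paths joining `0` with `z` and
  -- `v` with `v + z`. The successive doublings turn the exponent `δ / 8` into `δ` for each path.
  set S : (Fin d → ℤ) → Config d → ℝ := fun z x => 1 / 8 *
    (Y v (v + z) x + Y (v + z) v x + (Y 0 z x + Y z 0 x)) +
    1 / 2 * Real.exp (δ / 2 * B (x ∘ shift z)) with hS
  have hmp : ∀ z : Fin d → ℤ, MeasurePreserving (fun x : Config d => x ∘ shift z)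
      (edgeLaw d ν) (edgeLaw d ν) := fun z => measurePreserving_comp_perm (shift z)
  have hBzi : ∀ z, Integrable (fun x => Real.exp (δ / 2 * B (x ∘ shift z))) (edgeLaw d ν) :=
    fun z => (hmp z).integrable_comp_of_integrable hBi
  have hYY : ∀ u w, Integrable (fun x => Y u w x + Y w u x) (edgeLaw d ν) := fun u w =>
    (hYi u w).add (hYi w u)
  have hYs : ∀ z, Integrable (fun x => Y v (v + z) x + Y (v + z) v x + (Y 0 z x + Y z 0 x))
      (edgeLaw d ν) := fun z => (hYY _ _).add (hYY _ _)
  have hSi : ∀ z, Integrable (S z) (edgeLaw d ν) := fun z =>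
    ((hYs z).const_mul _).add ((hBzi z).const_mul _)
  have hSint : ∀ z : Fin d → Fin m, ∫ x, S (boxVec z) x ∂(edgeLaw d ν) ≤ 2 * D ^ (d * m) := by
    intro z
    set w := boxVec z
    have hw : l1norm w ≤ d * m := l1norm_boxVec_le z
    have hYle : ∀ u u' : Fin d → ℤ, l1norm (u' - u) ≤ d * m →
        ∫ x, Y u u' x ∂(edgeLaw d ν) ≤ D ^ (d * m) := fun u u' h =>
      integral_exp_pathTime_le hδ.le hexpi u u' h
    have h1 := hYle v (v + w) (by rwa [add_sub_cancel_left])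
    have h2 := hYle (v + w) v (by rwa [l1norm_sub_comm, add_sub_cancel_left])
    have h3 := hYle 0 w (by rwa [sub_zero])
    have h4 := hYle w 0 (by rwa [zero_sub, l1norm_neg])
    have h5 : ∫ x, Real.exp (δ / 2 * B (x ∘ shift w)) ∂(edgeLaw d ν) ≤ 2 := by
      have hm' : AEStronglyMeasurable (fun x => Real.exp (δ / 2 * B x))
          (Measure.map (fun x : Config d => x ∘ shift w) (edgeLaw d ν)) := by
        rw [(hmp w).map_eq]
        exact hBi.aestronglyMeasurable
      rw [← integral_map (hmp w).aemeasurable hm', (hmp w).map_eq]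
      exact hB2
    have h6 : 1 ≤ D ^ (d * m) := one_le_pow₀ hD
    simp only [hS]
    rw [integral_add ((hYs w).const_mul _) ((hBzi w).const_mul _), integral_const_mul,
      integral_const_mul, integral_add (hYY _ _) (hYY _ _),
      integral_add (hYi _ _) (hYi _ _), integral_add (hYi _ _) (hYi _ _)]
    linarith
  have hpoint : ∀ x, Real.exp (δ / 8 * |passageTime x 0 v - smoothTime c K m v x|) ≤
      𝔼 z : Fin d → Fin m, S (boxVec z) x := by
    intro x
    have h1 : |passageTime x 0 v - smoothTime c K m v x| ≤ 𝔼 z : Fin d → Fin m,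
        |passageTime x 0 v - capMin (pathSets K 0 v) (c * K) (x ∘ shift (boxVec z))| := by
      have : passageTime x 0 v - smoothTime c K m v x = 𝔼 z : Fin d → Fin m,
          (passageTime x 0 v - capMin (pathSets K 0 v) (c * K) (x ∘ shift (boxVec z))) := by
        rw [Finset.expect_sub_distrib, smoothTime]
        simp
      rw [this]
      exact Finset.abs_expect_le _ _
    have h2 : δ / 8 * |passageTime x 0 v - smoothTime c K m v x| ≤ 𝔼 z : Fin d → Fin m,
        δ / 8 * |passageTime x 0 v - capMin (pathSets K 0 v) (c * K) (x ∘ shift (boxVec z))| := by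
      rw [← Finset.mul_expect]
      exact mul_le_mul_of_nonneg_left h1 (by positivity)
    refine (Real.exp_le_exp.2 h2).trans ((exp_expect_le _).trans
      (Finset.expect_le_expect fun z _ => ?_))
    set w := boxVec z
    set y₁ := pathTime x (shortPath v (v + w))
    set y₂ := pathTime x (shortPath (v + w) v)
    set y₃ := pathTime x (shortPath 0 w)
    set y₄ := pathTime x (shortPath w 0)
    have h3 : |passageTime x 0 v - capMin (pathSets K 0 v) (c * K) (x ∘ shift w)| ≤
        y₁ + y₂ + (y₃ + y₄) + B (x ∘ shift w) := by
      have e1 := abs_passageTime_sub_le x 0 v (v + w)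
      have e2 := abs_passageTime_sub_le x (v + w) 0 w
      have e3 : B (x ∘ shift w) = |passageTime x w (v + w) -
          capMin (pathSets K 0 v) (c * K) (x ∘ shift w)| := by
        simp only [hB, passageTime_shift, zero_add]
      rw [passageTime_comm x (v + w) 0, passageTime_comm x (v + w) w] at e2
      rw [e3]
      have e4 := abs_sub_le (passageTime x 0 v) (passageTime x 0 (v + w))
        (capMin (pathSets K 0 v) (c * K) (x ∘ shift w))
      have e5 := abs_sub_le (passageTime x 0 (v + w)) (passageTime x w (v + w))
        (capMin (pathSets K 0 v) (c * K) (x ∘ shift w))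
      linarith
    have h4 : δ / 8 * |passageTime x 0 v - capMin (pathSets K 0 v) (c * K) (x ∘ shift w)| ≤
        δ / 8 * (y₁ + y₂ + (y₃ + y₄)) + δ / 8 * B (x ∘ shift w) := by
      rw [← mul_add]
      exact mul_le_mul_of_nonneg_left h3 (by positivity)
    refine (Real.exp_le_exp.2 h4).trans ((exp_add_le _ _).trans ?_)
    have h5 : Real.exp (2 * (δ / 8 * (y₁ + y₂ + (y₃ + y₄)))) ≤
        1 / 4 * (Real.exp (δ * y₁) + Real.exp (δ * y₂) +
          (Real.exp (δ * y₃) + Real.exp (δ * y₄))) := by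
      have e1 := exp_add_le (δ / 4 * (y₁ + y₂)) (δ / 4 * (y₃ + y₄))
      have e2 := exp_add_le (δ / 2 * y₁) (δ / 2 * y₂)
      have e3 := exp_add_le (δ / 2 * y₃) (δ / 2 * y₄)
      ring_nf at e1 e2 e3 ⊢
      linarith
    have h6 : Real.exp (2 * (δ / 8 * B (x ∘ shift w))) ≤ Real.exp (δ / 2 * B (x ∘ shift w)) := by
      refine Real.exp_le_exp.2 ?_
      have := mul_nonneg hδ.le (hB0 (x ∘ shift w))
      linarith
    simp only [hS, hY]
    linarith
  have hSE : Integrable (fun x => 𝔼 z : Fin d → Fin m, S (boxVec z) x) (edgeLaw d ν) := by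
    simp only [Fintype.expect_eq_sum_div_card]
    exact (integrable_finsetSum _ fun z _ => hSi _).div_const _
  have hi : Integrable (fun x => Real.exp (δ / 8 *
      |passageTime x 0 v - smoothTime c K m v x|)) (edgeLaw d ν) := by
    refine hSE.mono' ?_ (ae_of_all _ fun x => ?_)
    · have := measurable_passageTime (d := d) 0 v
      have := measurable_smoothTime (d := d) c K m v
      exact Measurable.aestronglyMeasurable (by fun_prop)
    · rw [Real.norm_of_nonneg (Real.exp_pos _).le]
      exact hpoint x
  refine ⟨hi, (integral_mono hi hSE hpoint).trans ?_⟩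
  have h7 : ∫ x, 𝔼 z : Fin d → Fin m, S (boxVec z) x ∂(edgeLaw d ν) =
      𝔼 z : Fin d → Fin m, ∫ x, S (boxVec z) x ∂(edgeLaw d ν) := by
    simp only [Fintype.expect_eq_sum_div_card]
    rw [integral_div, integral_finsetSum _ fun z _ => hSi _]
  rw [h7]
  refine (Finset.expect_le_expect fun z _ => hSint z).trans (le_of_eq ?_)
  simp

end Comparison

end FPP

namespace FPP

open scoped BigOperators Topology
open Function Filter

/-! ### Tail bounds and the choice of constants. -/

section Conclusion

/-- Concentration of `T` around its mean, from the concentration of an approximation `F`. -/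
lemma measure_lt_abs_sub_integral_le {Ω : Type*} [MeasurableSpace Ω] {μ : Measure Ω}
    [IsProbabilityMeasure μ] {T F : Ω → ℝ} (hT : Integrable T μ) (hF : Integrable F μ)
    {η q s b : ℝ} (hη : 0 < η) (hq : 0 < q) (hs : 0 < s)
    (hFi : ∀ ε : ℝ, Integrable (fun ω => Real.exp (ε * (η / q) * (F ω - ∫ ω', F ω' ∂μ))) μ)
    (hFe : ∀ ε : ℝ, |ε| = 1 →
      ∫ ω, Real.exp (ε * (η / q) * (F ω - ∫ ω', F ω' ∂μ)) ∂μ ≤ Real.exp 2)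
    (hTi : Integrable (fun ω => Real.exp (s * |T ω - F ω|)) μ)
    (hTe : ∫ ω, Real.exp (s * |T ω - F ω|) ∂μ ≤ 2 * Real.exp b)
    (hb : 1 + b ≤ s * q / 8) {t : ℝ} (ht : 1 ≤ t) :
    μ.real {ω | t * q < |T ω - ∫ ω', T ω' ∂μ|} ≤
      2 * Real.exp 2 * Real.exp (-(η / 2 * t)) + 2 * Real.exp (-(s * q / 8 * t)) := by
  set M := ∫ ω, F ω ∂μ with hM
  have hqt : q ≤ t * q := le_mul_of_one_le_left hq.le ht
  have hmean : |M - ∫ ω, T ω ∂μ| ≤ t * q / 4 := by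
    -- Tangent line of the exponential at `log 2 + b`. Integrating it yields a mean error of at most
    -- `(1 + b) / s ≤ q / 8`.
    have hpt : ∀ ω, s * |T ω - F ω| ≤ (2 * Real.exp b)⁻¹ * Real.exp (s * |T ω - F ω|) + b := by
      intro ω
      have h1 := Real.add_one_le_exp (s * |T ω - F ω| - (Real.log 2 + b))
      rw [Real.exp_sub, Real.exp_add, Real.exp_log two_pos, div_eq_inv_mul] at h1
      have := Real.log_two_lt_d9
      linarith
    have hdi : Integrable (fun ω => |T ω - F ω|) μ := (hT.sub hF).abs
    have h2 := integral_mono (hdi.const_mul s) ((hTi.const_mul _).add (integrable_const b)) hpt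
    simp only [Pi.add_apply] at h2
    rw [integral_const_mul, integral_add (hTi.const_mul _) (integrable_const b),
      integral_const_mul] at h2
    simp only [integral_const, probReal_univ, smul_eq_mul, one_mul] at h2
    have h3 : (2 * Real.exp b)⁻¹ * ∫ ω, Real.exp (s * |T ω - F ω|) ∂μ ≤ 1 := by
      rw [inv_mul_le_iff₀ (by positivity), mul_one]
      exact hTe
    have h4 : |M - ∫ ω, T ω ∂μ| ≤ ∫ ω, |T ω - F ω| ∂μ := by
      rw [hM, abs_sub_comm, ← integral_sub hT hF]
      exact abs_integral_le_integral_abs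
    have h5 : s * |M - ∫ ω, T ω ∂μ| ≤ s * (q / 8) := by
      have := mul_le_mul_of_nonneg_left h4 hs.le
      linarith
    have := le_of_mul_le_mul_left h5 hs
    linarith
  have hexp : ∀ ε : ℝ, |ε| = 1 → μ.real {ω | t * q / 2 ≤ ε * (F ω - M)} ≤
      Real.exp 2 * Real.exp (-(η / 2 * t)) := by
    intro ε hε
    have hmgf : mgf (fun ω => ε * (F ω - M)) μ (η / q) =
        ∫ ω, Real.exp (ε * (η / q) * (F ω - M)) ∂μ := by
      unfold mgf
      congr 1
      funext ω
      ring_nf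
    have h1 := measure_ge_le_exp_mul_mgf (μ := μ) (X := fun ω => ε * (F ω - M)) (t * q / 2)
      (t := η / q) (by positivity) (by
        convert hFi ε using 2
        ring_nf)
    rw [hmgf] at h1
    refine h1.trans ?_
    have h2 : -(η / q) * (t * q / 2) = -(η / 2 * t) := by field_simp
    rw [h2, mul_comm]
    exact mul_le_mul_of_nonneg_right (hFe ε hε) (Real.exp_pos _).le
  have happ : μ.real {ω | t * q / 4 ≤ |T ω - F ω|} ≤ 2 * Real.exp (-(s * q / 8 * t)) := by
    have h1 := measure_ge_le_exp_mul_mgf (μ := μ) (X := fun ω => |T ω - F ω|) (t * q / 4) hs.le hTi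
    refine h1.trans ((mul_le_mul_of_nonneg_left hTe (Real.exp_pos _).le).trans ?_)
    rw [mul_left_comm, ← Real.exp_add]
    refine mul_le_mul_of_nonneg_left (Real.exp_le_exp.2 ?_) zero_le_two
    have := mul_le_mul_of_nonneg_left hqt hs.le
    linarith
  -- The budget `t * q` is split: a half for the fluctuation of `F`, a quarter for `|T - F|`, a
  -- quarter for the difference of the means.
  have hsub : {ω | t * q < |T ω - ∫ ω', T ω' ∂μ|} ⊆
      ({ω | t * q / 2 ≤ 1 * (F ω - M)} ∪ {ω | t * q / 2 ≤ -1 * (F ω - M)}) ∪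
        {ω | t * q / 4 ≤ |T ω - F ω|} := by
    intro ω (hω : t * q < _)
    by_contra hcon
    simp only [Set.mem_union, Set.mem_ofPred_eq, not_or, not_le] at hcon
    obtain ⟨⟨h1, h2⟩, h3⟩ := hcon
    have h4 : |F ω - M| ≤ t * q / 2 := abs_le.2 ⟨by linarith, by linarith⟩
    have h5 := abs_sub_le (T ω) (F ω) (∫ ω', T ω' ∂μ)
    have h6 := abs_sub_le (F ω) M (∫ ω', T ω' ∂μ)
    linarith
  calc _ ≤ _ := measureReal_mono hsub
    _ ≤ _ := (measureReal_union_le _ _).trans (add_le_add_left (measureReal_union_le _ _) _)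
    _ ≤ _ := by linarith [hexp 1 (by simp), hexp (-1) (by simp), happ]

/-- The box side `n ^ (1 / 4)` is negligible with respect to the scale `√(n / log n)`. -/
lemma exists_forall_mul_sqrt_sqrt_le (A : ℝ) : ∃ V : ℕ, ∀ n : ℕ, V ≤ n → 2 ≤ n →
    A * (Nat.sqrt (Nat.sqrt n) : ℕ) ≤ √(n / Real.log n) := by
  have h0 := (isLittleO_log_rpow_atTop (r := 1 / 2) (by norm_num)).bound
    (c := (A ^ 2 + 1)⁻¹) (by positivity)
  have h1 := tendsto_natCast_atTop_atTop (R := ℝ) |>.eventually h0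
  obtain ⟨V, hV⟩ := eventually_atTop.1 h1
  refine ⟨V, fun n hn hn2 => ?_⟩
  have hn' : (2 : ℝ) ≤ n := by exact_mod_cast hn2
  have hlog : 0 < Real.log n := Real.log_pos (by linarith)
  have h2 := hV n hn
  rw [← Real.sqrt_eq_rpow, Real.norm_of_nonneg hlog.le, Real.norm_of_nonneg (Real.sqrt_nonneg _),
    inv_mul_eq_div, le_div_iff₀ (by positivity)] at h2
  set m := Nat.sqrt (Nat.sqrt n)
  have h3 : (m : ℝ) ^ 2 ≤ √n := by
    refine Real.le_sqrt_of_sq_le ?_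
    have h4 : m * m ≤ Nat.sqrt n := Nat.sqrt_le _
    have h5 : Nat.sqrt n * Nat.sqrt n ≤ n := Nat.sqrt_le _
    have h6 : (m ^ 2) ^ 2 ≤ n := by
      calc (m ^ 2) ^ 2 = (m * m) * (m * m) := by ring
        _ ≤ _ := (Nat.mul_le_mul h4 h4).trans h5
    exact_mod_cast h6
  refine Real.le_sqrt_of_sq_le ?_
  rw [le_div_iff₀ hlog]
  have h4 : √(n : ℝ) * √n = n := Real.mul_self_sqrt (by positivity)
  calc (A * m) ^ 2 * Real.log n = (m : ℝ) ^ 2 * (Real.log n * A ^ 2) := by ring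
    _ ≤ √n * (Real.log n * (A ^ 2 + 1)) := by gcongr; linarith
    _ ≤ √n * √n := by gcongr
    _ = n := h4

end Conclusion

end FPP

theorem mainTheorem1 (d : ℕ) (hd : 2 ≤ d) (ν : Measure ℝ≥0) [IsProbabilityMeasure ν]
    (hν : FPP.IsNearlyGamma ν)
    (hexp : ∃ δ : ℝ, 0 < δ ∧ Integrable (fun x : ℝ≥0 => Real.exp (δ * (x : ℝ))) ν) :
    ∃ C₁ C₂ : ℝ, 0 < C₁ ∧ 0 < C₂ ∧
      ∀ v : Fin d → ℤ, 2 ≤ FPP.l1norm v →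
        Integrable (fun x => FPP.passageTime x 0 v) (FPP.edgeLaw d ν) ∧
        ∀ t : ℝ, 0 < t → t ≤ (FPP.l1norm v : ℝ) →
          (FPP.edgeLaw d ν).real
            {x | t * Real.sqrt ((FPP.l1norm v : ℝ) / Real.log (FPP.l1norm v : ℝ)) <
              |FPP.passageTime x 0 v - ∫ y, FPP.passageTime y 0 v ∂(FPP.edgeLaw d ν)|}
            ≤ C₁ * Real.exp (-(C₂ * t)) := by
  obtain ⟨δ, hδ, hexpi⟩ := hexp
  obtain ⟨c, hc, hρ⟩ := FPP.exists_speed hν.measure_zero d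
  obtain ⟨C, happ⟩ := FPP.exists_integral_exp_passageTime_sub_smoothTime_le (d := d) hδ hexpi hc hρ
  obtain ⟨η, hη, hsm⟩ := FPP.exists_integral_exp_smoothTime_sub_le hd hν hδ hexpi hc hρ C
  set D := ∫ y : ℝ≥0, Real.exp (δ * y) ∂ν
  have hD : 1 ≤ D := FPP.one_le_integral_exp hδ.le hexpi
  have hlD : 0 ≤ Real.log D := Real.log_nonneg hD
  -- The factor `64` is `8 * 8`: the comparison holds at exponent `s = δ / 8` and the tail lemma
  -- asks for `1 + b ≤ s * q / 8`, with `b = d * m * log D`.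
  obtain ⟨V, hV⟩ := FPP.exists_forall_mul_sqrt_sqrt_le (64 / δ * (1 + d * Real.log D))
  set C₂ : ℝ := min (η / 2) (δ / 64) with hC₂
  have hC₂0 : 0 < C₂ := by positivity
  refine ⟨2 * Real.exp 2 + 2 + Real.exp (C₂ * (V + 1)), C₂, by positivity, hC₂0, fun v hv => ?_⟩
  have hTi := FPP.integrable_passageTime (d := d) hδ hexpi 0 v
  refine ⟨hTi, fun t ht0 ht => ?_⟩
  -- For bounded `t` the constant exceeds `exp (C₂ * t)` and the claim is trivial. This covers `t <
  -- 1`, and also `|v| < V` thanks to `t ≤ |v|`.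
  have htriv : t ≤ V + 1 → ∀ s : Set (FPP.Config d), (FPP.edgeLaw d ν).real s ≤
      (2 * Real.exp 2 + 2 + Real.exp (C₂ * (V + 1))) * Real.exp (-(C₂ * t)) := by
    intro htV s
    refine measureReal_le_one.trans ?_
    have h1 : 1 ≤ Real.exp (C₂ * (V + 1)) * Real.exp (-(C₂ * t)) := by
      rw [← Real.exp_add]
      refine Real.one_le_exp ?_
      have := mul_le_mul_of_nonneg_left htV hC₂0.le
      linarith
    have h2 : 0 ≤ (2 * Real.exp 2 + 2) * Real.exp (-(C₂ * t)) := by positivity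
    linarith
  by_cases ht1 : t < 1
  · refine htriv ?_ _
    linarith [(V.cast_nonneg : (0 : ℝ) ≤ V)]
  by_cases hnV : FPP.l1norm v < V
  · refine htriv ?_ _
    have : (FPP.l1norm v : ℝ) ≤ V := by exact_mod_cast hnV.le
    linarith
  rw [not_lt] at ht1 hnV
  set n := FPP.l1norm v
  set m := Nat.sqrt (Nat.sqrt n)
  have hm : 1 ≤ m := Nat.sqrt_pos.2 (Nat.sqrt_pos.2 (by omega))
  have hm' : (1 : ℝ) ≤ m := by exact_mod_cast hm
  have hn' : (2 : ℝ) ≤ n := by exact_mod_cast hv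
  have hlog : 0 < Real.log n := Real.log_pos (by linarith)
  have hq1 : 1 ≤ √((n : ℝ) / Real.log n) := by
    rw [Real.one_le_sqrt, le_div_iff₀ hlog, one_mul]
    linarith [Real.log_le_sub_one_of_pos (by linarith : (0 : ℝ) < n)]
  set q := √((n : ℝ) / Real.log n)
  obtain ⟨hai, hae⟩ := happ v m (by omega) hm
  have hF0 := FPP.smoothTime_nonneg hc.le (C * n) m v
  have hFm := FPP.measurable_smoothTime c (C * n) m v
  have hF1 := FPP.smoothTime_le (c := c) (C * n) hm v
  set F := FPP.smoothTime c (C * n) m v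
  have hFi : Integrable F (FPP.edgeLaw d ν) := Integrable.of_bound hFm.aestronglyMeasurable _
    (ae_of_all _ fun x => by rw [Real.norm_of_nonneg (hF0 x)]; exact hF1 x)
  have hFei : ∀ a M : ℝ, Integrable (fun x => Real.exp (a * (F x - M))) (FPP.edgeLaw d ν) := by
    intro a M
    refine Integrable.of_bound (by fun_prop) (Real.exp (|a| * (c * (C * n : ℕ) + |M|)))
      (ae_of_all _ fun x => ?_)
    rw [Real.norm_of_nonneg (Real.exp_pos _).le]
    refine Real.exp_le_exp.2 ((le_abs_self _).trans ?_)
    rw [abs_mul]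
    refine mul_le_mul_of_nonneg_left ?_ (abs_nonneg a)
    rw [abs_le]
    constructor <;> linarith [hF0 x, hF1 x, neg_abs_le M, le_abs_self M]
  have hb : 1 + (d * m : ℕ) * Real.log D ≤ δ / 8 * q / 8 := by
    have h1 := mul_le_mul_of_nonneg_left (hV n hnV hv) (by positivity : 0 ≤ δ / 64)
    have h2 : δ / 64 * (64 / δ * (1 + d * Real.log D) * m) = m + d * m * Real.log D := by
      field_simp
    push_cast
    linarith
  refine (FPP.measure_lt_abs_sub_integral_le hTi hFi hη (by linarith : 0 < q)
    (by positivity : 0 < δ / 8) (fun ε => hFei _ _) (hsm n v hv) hai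
    (by rw [← FPP.pow_eq_exp_mul_log (by linarith)]; exact hae) hb ht1).trans ?_
  have h1 : Real.exp (-(η / 2 * t)) ≤ Real.exp (-(C₂ * t)) :=
    Real.exp_le_exp.2 (neg_le_neg (mul_le_mul_of_nonneg_right (min_le_left _ _) ht0.le))
  have h2 : Real.exp (-(δ / 8 * q / 8 * t)) ≤ Real.exp (-(C₂ * t)) := by
    refine Real.exp_le_exp.2 (neg_le_neg (mul_le_mul_of_nonneg_right ?_ ht0.le))
    have := mul_le_mul_of_nonneg_left hq1 (by positivity : 0 ≤ δ / 64)
    linarith [min_le_right (η / 2) (δ / 64)]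
  have h3 := mul_le_mul_of_nonneg_left h1 (by positivity : 0 ≤ 2 * Real.exp 2)
  have h4 : 0 ≤ Real.exp (C₂ * (V + 1)) * Real.exp (-(C₂ * t)) := by positivity
  linarith
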